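/- **Setting.** Let $n\ge 3$, let $\Omega\subset\mathbb R^n$ be a bounded open set and $E\subset\Omega$ a compact set. Let $p\in L^\infty(\Omega)$ with $p^-:=\operatorname{ess\,inf}_\Omega p>1$ and $p^+:=\operatorname{ess\,sup}_\Omega p$. Let $\vartheta$ be a weight on $\Omega$ such that $\vartheta>0$ a.e. and $\vartheta,\ \vartheta^{-1/(p-1)}\in L^1_{\rm loc}(\Omega)$; write $d\vartheta=\vartheta\,dx$, extended by $0$ outside $\Omega$. Let $\alpha,\tau:\Omega\to[0,n]$ be measurable. The space $L^{p(\cdot)}(\Omega,\vartheta)$ consists of the measurable $f$ with $\int_\Omega|tf|^{p}\,d\vartheta<\infty$ for some $t>0$. The space $W^{1,p(\cdot)}(\Omega,\vartheta)$ consists of the $f\in L^{p(\cdot)}(\Omega,\vartheta)$ with weak gradient satisfying $|\nabla f|\in L^{p(\cdot)}(\Omega,\vartheta)$. The subscript loc means that the integrability holds on compact subsets. A measurable function "has an integral" if its positive or its negative part has finite integral. Let $W^{1,p(\cdot)}_{E,\rm loc}(\Omega,\vartheta)$ be the set of $u:\Omega\to\overline{\mathbb R}$ that have an integral over $\Omega$,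 satisfy $u|_{\Omega\setminus E}\in W^{1,p(\cdot)}_{\rm loc}(\Omega\setminus E,\vartheta)$, and for which some $\widetilde{\nabla u}:\Omega\to\overline{\mathbb R}^n$, with components that have an integral over $\Omega$, equals $\nabla u$ a.e. on $\Omega\setminus E$. **The equation.** Let $A:\Omega\times\mathbb R^n\to\mathbb R^n$ be measurable (jointly, Lebesgue in $x$ and Borel in $\eta$), and let $\mu>0$ be such that for a.e. $x\in\Omega$ and all $\eta\in\mathbb R^n$ $$\langle A(x,\eta),\eta\rangle\ge\mu|\eta|^{p(x)}\vartheta(x),\qquad |A(x,\eta)|\le\mu^{-1}|\eta|^{p(x)-1}\vartheta(x).$$ A function $u\in W^{1,p(\cdot)}_{E,\rm loc}(\Omega,\vartheta)$ is a weak sub-solution of $-\operatorname{div}A(x,\nabla u)=0$ in $\Omega\setminus E$ if $\int_{\Omega\setminus E}\langle A(\cdot,\nabla u),\nabla\varphi\rangle\,dx\le0$ for all $\varphi\in W^{1,p(\cdot)}(\Omega,\vartheta)$, $\varphi\ge0$, with compact support in $\Omega\setminus E$. **Dyadic cubes and net measure.** A dyadic cube of side length $\ell=2^{-k}$, $k\in\mathbb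 Z$, is a set $\prod_i[m_i2^{-k},(m_i+1)2^{-k}]$ with $m_i\in\mathbb Z$; $Q(y,\ell)$ denotes the one with center $y$. Two dyadic cubes are adjacent if they are distinct, have the same side length and intersect. For $\gamma>0$, the $(\alpha,\gamma,\vartheta)$-net measure of $E$ is $$\mathcal L_{\alpha,\gamma,\vartheta}(E)=\lim_{\varepsilon\to0^+}\inf\Big\{\sum_j\Big[\int_{Q_j}\ell_j^{\alpha-n}\,d\vartheta\Big]^\gamma\Big\},$$ where the infimum is over countable families of dyadic cubes $Q_j$ with side lengths $\ell_j<\varepsilon$ and $E\subset\operatorname{int}\big(\bigcup_jQ_j\big)$. **Theorem.** Assume in addition: 1. $\tau\le n-\alpha-p^+-p^+/p^-$ a.e. on $\Omega$. 2. There is a locally bounded $\sigma:\Omega\times\Omega\to(0,\infty)$ such that $\int_{Q(y,\ell)}\ell^{-\tau}\,d\vartheta\le\sigma(y,z)\int_{Q(z,\ell)}\ell^{-\tau}\,d\vartheta$ for all adjacent dyadic cubes $Q(y,\ell),Q(z,\ell)\subset\Omega$. 3. $\mathcal L_{\alpha,\gamma,\vartheta}(E)=0$ for some $\gamma\in(0,1/p^+]$.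 4. $u\ge 0$ is a weak sub-solution in $\Omega\setminus E$, and there is $C_*>0$ such that $\int_{B(y,r)}u^p\,d\vartheta\le C_*\int_{B(y,r/\sqrt n)}r^{-\tau}\,d\vartheta$ for all balls with $\overline{B(y,r)}\subset\Omega$. Then the singularity of $u$ at $E$ is removable: $u\in W^{1,p(\cdot)}_{\rm loc}(\Omega,\vartheta)$, and $$\int_{\Omega}\langle A(\cdot,\nabla u),\nabla\varphi\rangle\,dx\le0$$ for all $\varphi\in W^{1,p(\cdot)}(\Omega,\vartheta)$, $\varphi\ge0$, with compact support in $\Omega$. -/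

import Mathlib

open MeasureTheory Set Topology
open scoped ENNReal ContDiff

noncomputable section

namespace RemovableSing

/-- Euclidean space `ℝⁿ`. -/
abbrev Rn (n : ℕ) := EuclideanSpace ℝ (Fin n)

variable {n : ℕ}

/-! ### Exponents, weights, and the spaces `L^{p(·)}`, `W^{1,p(·)}` -/

/-- `p ∈ L^∞_+(Ω)`: essentially bounded on `Ω`, with essential infimum greater than `1`. -/
def IsExponent (Ω : Set (Rn n)) (p : Rn n → ℝ) : Prop :=
  MemLp p ⊤ (volume.restrict Ω) ∧ 1 < essInf p (volume.restrict Ω)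

/-- `p⁻`, the essential infimum of `p` on `Ω`. -/
def pMinus (Ω : Set (Rn n)) (p : Rn n → ℝ) : ℝ := essInf p (volume.restrict Ω)

/-- `p⁺`, the essential supremum of `p` on `Ω`. -/
def pPlus (Ω : Set (Rn n)) (p : Rn n → ℝ) : ℝ := essSup p (volume.restrict Ω)

/-- `ϑ ∈ W_p(Ω)`: `ϑ` is positive a.e. in `Ω`, and `ϑ` and `ϑ^{-1/(p-1)}` are locally integrable
in `Ω`. -/
structure IsWeight (Ω : Set (Rn n)) (p ϑ : Rn n → ℝ) : Prop where
  locallyIntegrable : LocallyIntegrableOn ϑ Ω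
  pos : ∀ᵐ x ∂volume.restrict Ω, 0 < ϑ x
  locallyIntegrable_dual : LocallyIntegrableOn (fun x => ϑ x ^ (-(1 / (p x - 1)))) Ω

/-- `f ∈ L^{p(·)}(S, ϑ)`: `f` is measurable on `S` and `∫_S |t f|^p ϑ dx < ∞` for some `t > 0`. -/
def MemLpVar (S : Set (Rn n)) (p ϑ f : Rn n → ℝ) : Prop :=
  AEMeasurable f (volume.restrict S) ∧
    ∃ t : ℝ, 0 < t ∧ ∫⁻ x in S, ENNReal.ofReal (|t * f x| ^ p x * ϑ x) < ⊤

/-- `f ∈ L^{p(·)}_loc(U, ϑ)`. -/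
def MemLpVarLoc (U : Set (Rn n)) (p ϑ f : Rn n → ℝ) : Prop :=
  ∀ K : Set (Rn n), IsCompact K → K ⊆ U → MemLpVar K p ϑ f

/-- `g` is a weak gradient of `u` in the open set `U`. -/
structure HasWeakGrad (U : Set (Rn n)) (u : Rn n → ℝ) (g : Rn n → Rn n) : Prop where
  locallyIntegrable : LocallyIntegrableOn u U
  locallyIntegrable_grad : LocallyIntegrableOn g U
  integral_eq : ∀ φ : Rn n → ℝ, ContDiff ℝ ∞ φ → HasCompactSupport φ → tsupport φ ⊆ U →
    ∀ i : Fin n, ∫ x in U, u x * fderiv ℝ φ x (EuclideanSpace.single i 1) =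
      -∫ x in U, g x i * φ x

open Classical in
/-- The weak gradient `∇u` of `u` in `U` (unique up to null sets in `U`); it is only used for
functions that have one. -/
def weakGrad (U : Set (Rn n)) (u : Rn n → ℝ) : Rn n → Rn n :=
  if h : ∃ g, HasWeakGrad U u g then h.choose else 0

/-- `u ∈ W^{1,p(·)}(U, ϑ)`. -/
def MemW1p (U : Set (Rn n)) (p ϑ u : Rn n → ℝ) : Prop :=
  MemLpVar U p ϑ u ∧ (∃ g, HasWeakGrad U u g) ∧ MemLpVar U p ϑ (fun x => ‖weakGrad U u x‖)

/-- The extended-real valued function `u` belongs to `W^{1,p(·)}_loc(U, ϑ)`; in particular it is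
finite a.e. in `U`. -/
def MemW1pLoc (U : Set (Rn n)) (p ϑ : Rn n → ℝ) (u : Rn n → EReal) : Prop :=
  (∀ᵐ x ∂volume.restrict U, u x ≠ ⊤ ∧ u x ≠ ⊥) ∧
  MemLpVarLoc U p ϑ (fun x => (u x).toReal) ∧
  (∃ g, HasWeakGrad U (fun x => (u x).toReal) g) ∧
  MemLpVarLoc U p ϑ (fun x => ‖weakGrad U (fun y => (u y).toReal) x‖)

/-- `f` is measurable and has an integral over `S`, possibly equal to `±∞`. -/
def HasExtIntegral (S : Set (Rn n)) (f : Rn n → EReal) : Prop :=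
  AEMeasurable f (volume.restrict S) ∧
    (∫⁻ x in S, (f x).toENNReal ≠ ⊤ ∨ ∫⁻ x in S, (-f x).toENNReal ≠ ⊤)

/-- `u ∈ W^{1,p(·)}_{E,loc}(Ω, ϑ)`: `u` has an integral over `Ω`, `u` restricted to `Ω \ E` is in
`W^{1,p(·)}_loc(Ω \ E, ϑ)`, and its gradient there extends to a function on `Ω` with values in the
extended reals each of whose components has an integral over `Ω`. -/
def MemW1pELoc (Ω E : Set (Rn n)) (p ϑ : Rn n → ℝ) (u : Rn n → EReal) : Prop :=
  HasExtIntegral Ω u ∧ MemW1pLoc (Ω \ E) p ϑ u ∧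
  ∃ G : Rn n → Fin n → EReal, (∀ i, HasExtIntegral Ω (fun x => G x i)) ∧
    ∀ᵐ x ∂volume.restrict (Ω \ E), ∀ i,
      G x i = ((weakGrad (Ω \ E) (fun y => (u y).toReal) x i : ℝ) : EReal)

/-! ### The equation `-div A(x, ∇u) = 0` -/

/-- The structure conditions: `A` is measurable on `Ω × ℝⁿ` (jointly, Lebesgue in `x` and Borel
in `η`), and the ellipticity and growth bounds hold for a.e. `x ∈ Ω` and all `η`. -/
structure StructureConditions (Ω : Set (Rn n)) (p ϑ : Rn n → ℝ) (A : Rn n → Rn n → Rn n)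
    (μ : ℝ) : Prop where
  measurable : Measurable
    (fun z : NullMeasurableSpace (Rn n) (volume.restrict Ω) × Rn n => A z.1 z.2)
  coercive : ∀ᵐ x ∂volume.restrict Ω, ∀ η : Rn n,
    μ * ‖η‖ ^ p x * ϑ x ≤ inner ℝ (A x η) η
  growth : ∀ᵐ x ∂volume.restrict Ω, ∀ η : Rn n,
    ‖A x η‖ ≤ μ⁻¹ * ‖η‖ ^ (p x - 1) * ϑ x

/-- `∫_U ⟨A(·, ∇u), ∇φ⟩ dx ≤ 0` (the integrand being integrable) for all
`φ ∈ W^{1,p(·)}(Ω, ϑ)`, `φ ≥ 0`, with compact support in `U`, where `U ⊆ Ω`. -/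
def SubsolutionIneq (Ω U : Set (Rn n)) (p ϑ : Rn n → ℝ) (A : Rn n → Rn n → Rn n)
    (u : Rn n → EReal) : Prop :=
  ∀ φ : Rn n → ℝ, MemW1p Ω p ϑ φ → (∀ᵐ x ∂volume.restrict Ω, 0 ≤ φ x) →
    (∃ K, IsCompact K ∧ K ⊆ U ∧ ∀ᵐ x ∂volume.restrict Ω, x ∉ K → φ x = 0) →
    IntegrableOn
      (fun x => inner ℝ (A x (weakGrad U (fun y => (u y).toReal) x)) (weakGrad Ω φ x)) U ∧
    ∫ x in U, inner ℝ (A x (weakGrad U (fun y => (u y).toReal) x)) (weakGrad Ω φ x) ≤ 0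

/-- `u ∈ W^{1,p(·)}_{E,loc}(Ω, ϑ)` is a weak sub-solution in `Ω \ E`. -/
def IsSubsolution (Ω E : Set (Rn n)) (p ϑ : Rn n → ℝ) (A : Rn n → Rn n → Rn n)
    (u : Rn n → EReal) : Prop :=
  MemW1pELoc Ω E p ϑ u ∧ SubsolutionIneq Ω (Ω \ E) p ϑ A u

/-- The singularity of the sub-solution `u` is removable: `u ∈ W^{1,p(·)}_loc(Ω, ϑ)`, and the
inequality defining sub-solutions holds for all non-negative `φ ∈ W^{1,p(·)}(Ω, ϑ)` with compact
support in the whole of `Ω`. -/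
def HasRemovableSingularity (Ω : Set (Rn n)) (p ϑ : Rn n → ℝ) (A : Rn n → Rn n → Rn n)
    (u : Rn n → EReal) : Prop :=
  MemW1pLoc Ω p ϑ u ∧ SubsolutionIneq Ω Ω p ϑ A u

/-! ### Dyadic cubes, net measure, and the two comparison conditions -/

/-- The closed dyadic cube `∏ᵢ [mᵢ 2⁻ᵏ, (mᵢ + 1) 2⁻ᵏ]` of side length `2⁻ᵏ`. -/
def dyadicCube (k : ℤ) (m : Fin n → ℤ) : Set (Rn n) :=
  {x | ∀ i, (m i : ℝ) * (2 : ℝ) ^ (-k) ≤ x i ∧ x i ≤ ((m i : ℝ) + 1) * (2 : ℝ) ^ (-k)}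

/-- The center of `dyadicCube k m`. -/
def dyadicCenter (k : ℤ) (m : Fin n → ℤ) : Rn n :=
  WithLp.toLp 2 (fun i => ((m i : ℝ) + 1 / 2) * (2 : ℝ) ^ (-k))

/-- `∫_{S ∩ Ω} ℓ^{s(x)} ϑ(x) dx`. -/
def powIntegral (Ω S : Set (Rn n)) (ϑ s : Rn n → ℝ) (ℓ : ℝ) : ℝ≥0∞ :=
  ∫⁻ x in S ∩ Ω, ENNReal.ofReal (ℓ ^ s x * ϑ x)

/-- `𝓛^ε_{α,γ,ϑ}(F)`: the infimum of `∑ (∫_Q ℓ(Q)^{α-n} dϑ)^γ` over all (finite or infinite)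
families of dyadic cubes of side length less than `ε` such that `F` lies in the interior of their
union. A family of cubes is a set of indices `(k, m)`. -/
def netContent (Ω : Set (Rn n)) (α : Rn n → ℝ) (γ : ℝ) (ϑ : Rn n → ℝ) (ε : ℝ)
    (F : Set (Rn n)) : ℝ≥0∞ :=
  ⨅ (S : Set (ℤ × (Fin n → ℤ))) (_ : ∀ c ∈ S, (2 : ℝ) ^ (-c.1) < ε)
    (_ : F ⊆ interior (⋃ c ∈ S, dyadicCube c.1 c.2)),
    ∑' c : S, powIntegral Ω (dyadicCube c.1.1 c.1.2) ϑ (fun x => α x - n)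
      ((2 : ℝ) ^ (-c.1.1)) ^ γ

/-- The `(α,γ,ϑ)`-net measure of `F`. The content increases as `ε` decreases, so its limit as
`ε → 0⁺` is the supremum. -/
def netMeasure (Ω : Set (Rn n)) (α : Rn n → ℝ) (γ : ℝ) (ϑ : Rn n → ℝ) (F : Set (Rn n)) : ℝ≥0∞ :=
  ⨆ (ε : ℝ) (_ : 0 < ε), netContent Ω α γ ϑ ε F

/-- There is a locally bounded `σ : Ω × Ω → (0,∞)` with
`∫_{Q(y,ℓ)} ℓ^{-τ} dϑ ≤ σ(y,z) ∫_{Q(z,ℓ)} ℓ^{-τ} dϑ` for all adjacent (distinct, of the same side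
length, and touching) dyadic cubes `Q(y,ℓ), Q(z,ℓ) ⊆ Ω`. -/
def AdjacentComparable (Ω : Set (Rn n)) (ϑ τ : Rn n → ℝ) : Prop :=
  ∃ σ : Rn n × Rn n → ℝ,
    (∀ q ∈ Ω ×ˢ Ω, 0 < σ q) ∧
    (∀ q ∈ Ω ×ˢ Ω, ∃ M : ℝ, ∀ᶠ q' in 𝓝 q, σ q' ≤ M) ∧
    ∀ (k : ℤ) (m m' : Fin n → ℤ), m ≠ m' →
      (dyadicCube k m ∩ dyadicCube k m').Nonempty →
      dyadicCube k m ⊆ Ω → dyadicCube k m' ⊆ Ω →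
      powIntegral Ω (dyadicCube k m) ϑ (fun x => -τ x) ((2 : ℝ) ^ (-k)) ≤
        ENNReal.ofReal (σ (dyadicCenter k m, dyadicCenter k m')) *
          powIntegral Ω (dyadicCube k m') ϑ (fun x => -τ x) ((2 : ℝ) ^ (-k))

/-- There is `C > 0` with `∫_{B(y,r)} u^p dϑ ≤ C ∫_{B(y,r/√n)} r^{-τ} dϑ` for all balls `B(y,r)`
whose closure is contained in `Ω`. -/
def GrowthBound (Ω : Set (Rn n)) (p ϑ τ : Rn n → ℝ) (u : Rn n → EReal) : Prop :=
  ∃ C : ℝ, 0 < C ∧ ∀ (y : Rn n) (r : ℝ), 0 < r → Metric.closedBall y r ⊆ Ω →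
    ∫⁻ x in Metric.ball y r, (u x).toENNReal ^ p x * ENNReal.ofReal (ϑ x) ≤
      ENNReal.ofReal C *
        powIntegral Ω (Metric.ball y (r / Real.sqrt n)) ϑ (fun x => -τ x) r

end RemovableSing

end

open RemovableSing

namespace RemovableSing

variable {n : ℕ}

/-! ### Weak gradients -/

/-! The set `E` is removable because it admits cutoffs `η`, zero near `E` and one away from it, for
which both `∫ (u |∇η|)^p dϑ` and `∫ |∇η|^p dϑ` are as small as desired (`exists_small_cutoff`).

Write `P = p⁺`. Vanishing net measure and `γ ≤ 1` give dyadic covers of `E` with `∑ ∫_Q ℓ^(α-n) dϑ`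
arbitrarily small. Since `ℓ^(α-n) ≥ 1` for `ℓ < 1`, the set `E` is `ϑ`-null, hence Lebesgue null. A
product of rescaled bumps over finitely many cubes gives `η` with `|∇η| ≤ C / ℓ(Q)`, where `Q` is a
cube whose double contains the point; overlaps cost only a constant by a geometric sum over
generations (`exists_family_cutoff`). The energy is then at most `C ∑ ℓ^(-P) ∫_{2Q} u^p dϑ`. The
growth bound replaces `u^p` by `ℓ^(-τ)`, comparability of adjacent cubes replaces `2Q` by `Q`, and
`τ ≤ n - α - P` turns `ℓ^(-P-τ)` into at most `ℓ^(α-n)`.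

Given a sequence `η_k` of such cutoffs, three limits finish the proof.

Testing the equation with `w^N u`, where `w = ζ η_k` and `N ≥ P`, gives `∫ w^N |∇u|^p dϑ ≤ C ∫ (u
|∇w|)^p dϑ` (`energy_estimate`). The right side is bounded in `k`, so Fatou's lemma makes `|∇u|`
locally `p(·)`-integrable across `E` (`memLpVarLoc_norm_weakGrad`).

Testing the definition of the weak gradient with `η_k φ` leaves the error `∫ u φ ∇η_k`. Young's
inequality against the dual weight sends it to zero, so the gradient off `E` is the gradient on `Ω`
(`IsCutoffSeq.hasWeakGrad`).

Testing the equation with `η_k φ` for bounded `φ` leaves an error of order `∫ |∇u|^(p-1) |∇η_k| dϑ`,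
which also vanishes. Unbounded `φ` are reached by a smooth truncation
(`IsCutoffSeq.subsolutionIneq`), whose chain rule is proved by mollification (`HasWeakGrad.comp`).
-/

theorem integrable_mul_of_tsupport_subset {U : Set (Rn n)} {f φ : Rn n → ℝ}
    (hf : LocallyIntegrableOn f U) (hφ : Continuous φ) (hc : HasCompactSupport φ)
    (hs : tsupport φ ⊆ U) : Integrable (fun x => f x * φ x) := by
  have h1 : IntegrableOn (fun x => f x * φ x) (tsupport φ) :=
    (hf.integrableOn_compact_subset hs hc).mul_continuousOn hφ.continuousOn hc
  refine (integrableOn_iff_integrable_of_support_subset ?_).1 h1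
  intro x hx
  refine subset_tsupport φ ?_
  intro h
  exact hx (by simp [h])

theorem locallyIntegrableOn_coord {U : Set (Rn n)} {g : Rn n → Rn n}
    (hg : LocallyIntegrableOn g U) (i : Fin n) : LocallyIntegrableOn (fun x => g x i) U :=
  (EuclideanSpace.proj (𝕜 := ℝ) i).locallyIntegrableOn_comp hg

theorem gradient_apply_coord (ζ : Rn n → ℝ) (x : Rn n) (i : Fin n) :
    gradient ζ x i = fderiv ℝ ζ x (EuclideanSpace.single i 1) := by
  have h : inner ℝ (gradient ζ x) (EuclideanSpace.single i (1 : ℝ)) =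
      fderiv ℝ ζ x (EuclideanSpace.single i 1) := by
    simp [gradient]
  rw [EuclideanSpace.inner_single_right] at h
  simpa using h

theorem norm_gradient_eq (ζ : Rn n → ℝ) (x : Rn n) : ‖gradient ζ x‖ = ‖fderiv ℝ ζ x‖ := by
  simp [gradient]

theorem continuous_gradient {ζ : Rn n → ℝ} (hζ : ContDiff ℝ ∞ ζ) : Continuous (gradient ζ) :=
  (InnerProductSpace.toDual ℝ (Rn n)).symm.continuous.comp
    (hζ.continuous_fderiv (by simp))

theorem gradient_eq_zero_of_notMem_tsupport {ζ : Rn n → ℝ} {x : Rn n} (hx : x ∉ tsupport ζ) :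
    gradient ζ x = 0 := by
  have : fderiv ℝ ζ x = 0 := by
    by_contra h
    exact hx (support_fderiv_subset ℝ h)
  simp [gradient, this]

/-- The fundamental lemma of the calculus of variations, coordinate by coordinate. It lets the
arbitrary choice in `weakGrad` be replaced by any explicit gradient up to null sets. -/
theorem HasWeakGrad.ae_eq {U : Set (Rn n)} (hU : IsOpen U) {u u' : Rn n → ℝ}
    {g g' : Rn n → Rn n} (h : HasWeakGrad U u g) (h' : HasWeakGrad U u' g')
    (huu : u =ᵐ[volume.restrict U] u') : g =ᵐ[volume.restrict U] g' := by
  have key : ∀ i, ∀ᵐ x, x ∈ U → g x i - g' x i = 0 := by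
    intro i
    have hi := locallyIntegrableOn_coord h.locallyIntegrable_grad i
    have hi' := locallyIntegrableOn_coord h'.locallyIntegrable_grad i
    refine hU.ae_eq_zero_of_integral_contDiff_smul_eq_zero (hi.sub hi') ?_
    intro φ hφ hc hs
    have e1 := h.integral_eq φ hφ hc hs i
    have e2 := h'.integral_eq φ hφ hc hs i
    have e3 : ∫ x in U, u x * fderiv ℝ φ x (EuclideanSpace.single i 1) =
        ∫ x in U, u' x * fderiv ℝ φ x (EuclideanSpace.single i 1) := by
      refine integral_congr_ae ?_
      filter_upwards [huu] with x hx
      rw [hx]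
    have e4 : ∫ x in U, g x i * φ x = ∫ x in U, g' x i * φ x := by linarith
    have i1 := integrable_mul_of_tsupport_subset hi hφ.continuous hc hs
    have i2 := integrable_mul_of_tsupport_subset hi' hφ.continuous hc hs
    have z : ∀ f : Rn n → ℝ, ∫ x in U, f x * φ x = ∫ x, f x * φ x := by
      intro f
      refine setIntegral_eq_integral_of_forall_compl_eq_zero ?_
      intro x hx
      rw [image_eq_zero_of_notMem_tsupport fun hh => hx (hs hh), mul_zero]
    have := integral_sub i1 i2
    rw [z, z] at e4
    rw [e4, sub_self] at this
    rw [← this]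
    refine integral_congr_ae (Filter.Eventually.of_forall fun x => ?_)
    simp only [smul_eq_mul]
    ring
  rw [Filter.EventuallyEq, ae_restrict_iff' hU.measurableSet]
  filter_upwards [ae_all_iff.2 key] with x hx hxU
  ext i
  exact sub_eq_zero.1 (hx i hxU)

theorem hasWeakGrad_weakGrad {U : Set (Rn n)} {u : Rn n → ℝ} (h : ∃ g, HasWeakGrad U u g) :
    HasWeakGrad U u (weakGrad U u) := by
  rw [weakGrad, dif_pos h]
  exact h.choose_spec

theorem HasWeakGrad.weakGrad_ae_eq {U : Set (Rn n)} (hU : IsOpen U) {u : Rn n → ℝ}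
    {g : Rn n → Rn n} (h : HasWeakGrad U u g) : weakGrad U u =ᵐ[volume.restrict U] g :=
  (hasWeakGrad_weakGrad ⟨g, h⟩).ae_eq hU h Filter.EventuallyEq.rfl

theorem hasWeakGrad_zero (U : Set (Rn n)) : HasWeakGrad U (fun _ => 0) fun _ => 0 where
  locallyIntegrable := (locallyIntegrable_zero (μ := volume)).locallyIntegrableOn U
  locallyIntegrable_grad := (locallyIntegrable_zero (μ := volume)).locallyIntegrableOn U
  integral_eq := by simp

theorem HasWeakGrad.mono {U V : Set (Rn n)} (hVU : V ⊆ U) {u : Rn n → ℝ} {g : Rn n → Rn n}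
    (h : HasWeakGrad U u g) : HasWeakGrad V u g where
  locallyIntegrable := h.locallyIntegrable.mono_set hVU
  locallyIntegrable_grad := h.locallyIntegrable_grad.mono_set hVU
  integral_eq := by
    intro φ hφ hc hs i
    have z : ∀ f : Rn n → ℝ, (∀ x, x ∉ tsupport φ → f x = 0) →
        ∫ x in V, f x = ∫ x in U, f x := by
      intro f hf
      rw [setIntegral_eq_integral_of_forall_compl_eq_zero fun x hx => hf x fun hh => hx (hs hh),
        setIntegral_eq_integral_of_forall_compl_eq_zero fun x hx => hf x fun hh => hx (hVU (hs hh))]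
    have := h.integral_eq φ hφ hc (hs.trans hVU) i
    rw [z, z]
    · exact this
    · intro x hx
      rw [image_eq_zero_of_notMem_tsupport hx, mul_zero]
    · intro x hx
      rw [← gradient_apply_coord, gradient_eq_zero_of_notMem_tsupport hx]
      simp

/-- A weak gradient vanishes a.e. on the open sets where the function does. -/
theorem HasWeakGrad.ae_eq_zero_of_ae_eq_zero {U V : Set (Rn n)} (hV : IsOpen V) (hVU : V ⊆ U)
    {u : Rn n → ℝ} {g : Rn n → Rn n} (h : HasWeakGrad U u g)
    (h0 : ∀ᵐ x ∂volume.restrict V, u x = 0) : ∀ᵐ x ∂volume.restrict V, g x = 0 :=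
  (h.mono hVU).ae_eq hV (hasWeakGrad_zero V) h0

/-- On a compact `k ⊆ V` the product lives on `tsupport ζ ∩ k`, a compact subset of `U`. The support
condition is imposed only inside `V`: for `U = V` it is vacuous and any smooth factor is admitted.
-/
theorem locallyIntegrableOn_smul_of_tsupport_inter_subset {F : Type*} [NormedAddCommGroup F]
    [NormedSpace ℝ F] {U V : Set (Rn n)} (hV : IsOpen V)
    {f : Rn n → F} (hf : LocallyIntegrableOn f U) {ζ : Rn n → ℝ} (hζ : Continuous ζ)
    (hs : tsupport ζ ∩ V ⊆ U) : LocallyIntegrableOn (fun x => ζ x • f x) V := by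
  rw [locallyIntegrableOn_iff hV.isLocallyClosed]
  intro k hk hkc
  have hc : IsCompact (tsupport ζ ∩ k) := hkc.inter_left (isClosed_tsupport ζ)
  have hsub : tsupport ζ ∩ k ⊆ U := (inter_subset_inter_right _ hk).trans hs
  have h1 : IntegrableOn (fun x => ζ x • f x) (tsupport ζ ∩ k) :=
    (hf.integrableOn_compact_subset hsub hc).continuousOn_smul hζ.continuousOn hc
  refine h1.of_forall_sdiff_eq_zero hkc.measurableSet ?_
  rintro x ⟨hx, hx'⟩
  rw [image_eq_zero_of_notMem_tsupport fun hh => hx' ⟨hh, hx⟩, zero_smul]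

theorem locallyIntegrableOn_smul_gradient {U V : Set (Rn n)} (hV : IsOpen V)
    {f : Rn n → ℝ} (hf : LocallyIntegrableOn f U) {ζ : Rn n → ℝ} (hζ : ContDiff ℝ ∞ ζ)
    (hs : tsupport ζ ∩ V ⊆ U) : LocallyIntegrableOn (fun x => f x • gradient ζ x) V := by
  rw [locallyIntegrableOn_iff hV.isLocallyClosed]
  intro k hk hkc
  have hc : IsCompact (tsupport ζ ∩ k) := hkc.inter_left (isClosed_tsupport ζ)
  have hsub : tsupport ζ ∩ k ⊆ U := (inter_subset_inter_right _ hk).trans hs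
  have h1 : IntegrableOn (fun x => f x • gradient ζ x) (tsupport ζ ∩ k) :=
    (hf.integrableOn_compact_subset hsub hc).smul_continuousOn
      (continuous_gradient hζ).continuousOn hc
  refine h1.of_forall_sdiff_eq_zero hkc.measurableSet ?_
  rintro x ⟨hx, hx'⟩
  rw [gradient_eq_zero_of_notMem_tsupport fun hh => hx' ⟨hh, hx⟩, smul_zero]

/-- Product rule for a smooth factor; the product is extended by zero from `U` to `V`. -/
theorem HasWeakGrad.smooth_mul {U V : Set (Rn n)} (hV : IsOpen V) (hUV : U ⊆ V)
    {u : Rn n → ℝ} {g : Rn n → Rn n} (h : HasWeakGrad U u g) {ζ : Rn n → ℝ}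
    (hζ : ContDiff ℝ ∞ ζ) (hs : tsupport ζ ∩ V ⊆ U) :
    HasWeakGrad V (fun x => ζ x * u x) (fun x => ζ x • g x + u x • gradient ζ x) where
  locallyIntegrable :=
    locallyIntegrableOn_smul_of_tsupport_inter_subset hV h.locallyIntegrable hζ.continuous hs
  locallyIntegrable_grad :=
    (locallyIntegrableOn_smul_of_tsupport_inter_subset hV h.locallyIntegrable_grad
      hζ.continuous hs).add (locallyIntegrableOn_smul_gradient hV h.locallyIntegrable hζ hs)
  integral_eq := by
    intro φ hφ hc hφV i
    set e : Rn n := EuclideanSpace.single i 1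
    have hψ : ContDiff ℝ ∞ fun x => ζ x * φ x := hζ.mul hφ
    -- A function vanishing off both supports has compact support in `U`: compactness comes from
    -- `φ`, the inclusion in `U` from `ζ`.
    have tsub : ∀ f : Rn n → ℝ, (∀ x, x ∉ tsupport ζ → f x = 0) →
        (∀ x, x ∉ tsupport φ → f x = 0) → HasCompactSupport f ∧ tsupport f ⊆ U := by
      intro f h1 h2
      have hsub : tsupport f ⊆ tsupport ζ ∩ tsupport φ := by
        refine closure_minimal ?_ ((isClosed_tsupport ζ).inter (isClosed_tsupport φ))
        intro x hx
        exact ⟨by_contra fun hh => hx (h1 x hh), by_contra fun hh => hx (h2 x hh)⟩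
      refine ⟨HasCompactSupport.of_support_subset_isCompact hc
        ((subset_tsupport f).trans (hsub.trans inter_subset_right)), ?_⟩
      exact hsub.trans ((inter_subset_inter_right _ hφV).trans hs)
    have dζ0 : ∀ x, x ∉ tsupport ζ → fderiv ℝ ζ x e = 0 := by
      intro x hx
      rw [← gradient_apply_coord, gradient_eq_zero_of_notMem_tsupport hx]
      simp
    have dφ0 : ∀ x, x ∉ tsupport φ → fderiv ℝ φ x e = 0 := by
      intro x hx
      rw [← gradient_apply_coord, gradient_eq_zero_of_notMem_tsupport hx]
      simp
    have cζ : Continuous fun x => fderiv ℝ ζ x e :=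
      (hζ.continuous_fderiv (by simp)).clm_apply continuous_const
    have cφ : Continuous fun x => fderiv ℝ φ x e :=
      (hφ.continuous_fderiv (by simp)).clm_apply continuous_const
    obtain ⟨c1, s1⟩ := tsub (fun x => ζ x * φ x)
      (fun x hx => by simp [image_eq_zero_of_notMem_tsupport hx])
      (fun x hx => by simp [image_eq_zero_of_notMem_tsupport hx])
    obtain ⟨c2, s2⟩ := tsub (fun x => ζ x * fderiv ℝ φ x e)
      (fun x hx => by simp [image_eq_zero_of_notMem_tsupport hx])
      (fun x hx => by simp [dφ0 x hx])
    obtain ⟨c3, s3⟩ := tsub (fun x => fderiv ℝ ζ x e * φ x)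
      (fun x hx => by simp [dζ0 x hx])
      (fun x hx => by simp [image_eq_zero_of_notMem_tsupport hx])
    have I1 := integrable_mul_of_tsupport_subset (φ := fun x => ζ x * φ x)
      (locallyIntegrableOn_coord h.locallyIntegrable_grad i) hψ.continuous c1 s1
    have I2 := integrable_mul_of_tsupport_subset (φ := fun x => ζ x * fderiv ℝ φ x e) h.locallyIntegrable
      (hζ.continuous.mul cφ) c2 s2
    have I3 := integrable_mul_of_tsupport_subset (φ := fun x => fderiv ℝ ζ x e * φ x) h.locallyIntegrable
      (cζ.mul hφ.continuous) c3 s3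
    -- The product rule is the gradient identity for `u` tested with `ζ φ`, the term `u φ ∂ζ` being
    -- moved to the other side.
    have key := h.integral_eq _ hψ c1 s1 i
    have hd : ∀ x, fderiv ℝ (fun x => ζ x * φ x) x e =
        ζ x * fderiv ℝ φ x e + fderiv ℝ ζ x e * φ x := by
      intro x
      rw [fderiv_fun_mul (hζ.differentiable (by simp) x) (hφ.differentiable (by simp) x)]
      simp [mul_comm]
    have z : ∀ f : Rn n → ℝ, (∀ x, x ∉ tsupport ζ → f x = 0) →
        ∫ x in V, f x = ∫ x in U, f x := by
      intro f hf
      refine setIntegral_eq_of_subset_of_forall_sdiff_eq_zero hV.measurableSet hUV ?_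
      intro x hx
      exact hf x fun hh => hx.2 (hs ⟨hh, hx.1⟩)
    rw [z, z]
    · have e1 : ∫ x in U, u x * fderiv ℝ (fun x => ζ x * φ x) x e =
          (∫ x in U, u x * (ζ x * fderiv ℝ φ x e)) + ∫ x in U, u x * (fderiv ℝ ζ x e * φ x) := by
        rw [← integral_add I2.integrableOn I3.integrableOn]
        refine integral_congr_ae (Filter.Eventually.of_forall fun x => ?_)
        simp only [hd]
        ring
      have e2 : ∫ x in U, (ζ x • g x + u x • gradient ζ x) i * φ x =
          (∫ x in U, g x i * (ζ x * φ x)) + ∫ x in U, u x * (fderiv ℝ ζ x e * φ x) := by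
        rw [← integral_add I1.integrableOn I3.integrableOn]
        refine integral_congr_ae (Filter.Eventually.of_forall fun x => ?_)
        simp only [PiLp.add_apply, PiLp.smul_apply, smul_eq_mul, gradient_apply_coord]
        ring
      have e3 : ∫ x in U, ζ x * u x * fderiv ℝ φ x e =
          ∫ x in U, u x * (ζ x * fderiv ℝ φ x e) := by
        refine integral_congr_ae (Filter.Eventually.of_forall fun x => ?_)
        simp only
        ring
      rw [e2, e3]
      rw [e1] at key
      linarith
    · intro x hx
      rw [gradient_eq_zero_of_notMem_tsupport hx, image_eq_zero_of_notMem_tsupport hx]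
      simp
    · intro x hx
      rw [image_eq_zero_of_notMem_tsupport hx]
      simp

end RemovableSing

namespace RemovableSing

variable {n : ℕ}

/-! ### Mollification and the chain rule -/

open Filter ContinuousLinearMap in
-- Split `c' F - c f = c' (F - f) + (c' - c) f`: the first term is controlled by `L¹` convergence
-- and the bound `C`, the second by dominated convergence.
theorem tendsto_integral_mul_of_tendsto_L1 {X : Type*} [MeasurableSpace X] {m : Measure X}
    {f : X → ℝ} {F : ℕ → X → ℝ} {c : X → ℝ} {c' : ℕ → X → ℝ} {C : ℝ}
    (hf : Integrable f m) (hF : ∀ k, Integrable (F k) m)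
    (hlim : Tendsto (fun k => ∫ x, |F k x - f x| ∂m) atTop (𝓝 0))
    (hc' : ∀ k, AEStronglyMeasurable (c' k) m) (hb : ∀ k x, |c' k x| ≤ C)
    (hc : ∀ᵐ x ∂m, Tendsto (fun k => c' k x) atTop (𝓝 (c x))) :
    Tendsto (fun k => ∫ x, c' k x * F k x ∂m) atTop (𝓝 (∫ x, c x * f x ∂m)) := by
  have h1 : Tendsto (fun k => ∫ x, c' k x * f x ∂m) atTop (𝓝 (∫ x, c x * f x ∂m)) := by
    refine tendsto_integral_of_dominated_convergence (fun x => C * |f x|)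
      (fun k => (hc' k).mul hf.aestronglyMeasurable) (hf.abs.const_mul C) ?_ ?_
    · intro k
      refine Eventually.of_forall fun x => ?_
      rw [norm_mul]
      exact mul_le_mul_of_nonneg_right (hb k x) (abs_nonneg _)
    · filter_upwards [hc] with x hx
      exact hx.mul_const _
  have i1 : ∀ k, Integrable (fun x => c' k x * f x) m := fun k =>
    hf.bdd_mul (hc' k) (Eventually.of_forall (hb k))
  have i2 : ∀ k, Integrable (fun x => c' k x * F k x) m := fun k =>
    (hF k).bdd_mul (hc' k) (Eventually.of_forall (hb k))
  have h2 : Tendsto (fun k => ∫ x, c' k x * F k x ∂m - ∫ x, c' k x * f x ∂m) atTop (𝓝 0) := by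
    refine squeeze_zero_norm (a := fun k => C * ∫ x, |F k x - f x| ∂m) ?_
      (by simpa using hlim.const_mul C)
    intro k
    rw [← integral_sub (i2 k) (i1 k), ← integral_const_mul]
    refine (norm_integral_le_integral_norm _).trans ?_
    refine integral_mono_ae ((i2 k).sub (i1 k)).norm (((hF k).sub hf).abs.const_mul C) ?_
    refine Eventually.of_forall fun x => ?_
    simp only [← mul_sub, norm_mul]
    exact mul_le_mul_of_nonneg_right (hb k x) (abs_nonneg _)
  simpa using h2.add h1

open Filter in
/-- Nonnegative functions converging a.e. without loss of mass converge in `L¹`. -/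
theorem tendsto_L1_of_nonneg_of_integral_eq {X : Type*} [MeasurableSpace X] {m : Measure X}
    {f : X → ℝ} {F : ℕ → X → ℝ} (hf : Integrable f m) (hF : ∀ k, Integrable (F k) m)
    (hf0 : ∀ x, 0 ≤ f x) (hF0 : ∀ k x, 0 ≤ F k x) (hI : ∀ k, ∫ x, F k x ∂m = ∫ x, f x ∂m)
    (hlim : ∀ᵐ x ∂m, Tendsto (fun k => F k x) atTop (𝓝 (f x))) :
    Tendsto (fun k => ∫ x, |F k x - f x| ∂m) atTop (𝓝 0) := by
  have ip : ∀ k, Integrable (fun x => max (f x - F k x) 0) m := fun k => (hf.sub (hF k)).pos_part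
  have h1 : Tendsto (fun k => ∫ x, max (f x - F k x) 0 ∂m) atTop (𝓝 (∫ _, (0 : ℝ) ∂m)) := by
    refine tendsto_integral_of_dominated_convergence f (fun k => (ip k).aestronglyMeasurable)
      hf ?_ ?_
    · intro k
      refine Eventually.of_forall fun x => ?_
      rw [Real.norm_of_nonneg (le_max_right _ _)]
      exact max_le (by linarith [hF0 k x]) (hf0 x)
    · filter_upwards [hlim] with x hx
      have : Tendsto (fun k => max (f x - F k x) 0) atTop (𝓝 (max (f x - f x) 0)) :=
        (tendsto_const_nhds.sub hx).max tendsto_const_nhds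
      simpa using this
  -- `|F - f| = 2 (f - F)⁺ + (F - f)`, and `F - f` has integral zero. Only `(f - F)⁺` remains, and
  -- it is dominated by `f`.
  have h2 : ∀ k, ∫ x, |F k x - f x| ∂m = 2 * ∫ x, max (f x - F k x) 0 ∂m := by
    intro k
    have e : ∀ x, |F k x - f x| = 2 * max (f x - F k x) 0 + (F k x - f x) := by
      intro x
      rcases le_total (f x) (F k x) with h | h
      · rw [abs_of_nonneg (by linarith), max_eq_right (by linarith)]
        ring
      · rw [abs_of_nonpos (by linarith), max_eq_left (by linarith)]
        ring
    simp_rw [e]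
    rw [integral_add (g := fun x => F k x - f x) ((ip k).const_mul 2) ((hF k).sub hf), integral_const_mul,
      integral_sub (hF k) hf, hI k]
    ring
  simp_rw [h2]
  simpa using h1.const_mul 2

/-- A sequence of smooth bumps concentrating at the origin. -/
noncomputable def bumpSeq (n k : ℕ) : ContDiffBump (0 : Rn n) where
  rIn := 1 / (k + 1)
  rOut := 2 / (k + 1)
  rIn_pos := by positivity
  rIn_lt_rOut := by gcongr; norm_num

open scoped Convolution in
/-- The mollification of `f` with the `k`-th bump. -/
noncomputable def mollify (k : ℕ) (f : Rn n → ℝ) : Rn n → ℝ :=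
  (bumpSeq n k).normed volume ⋆[ContinuousLinearMap.lsmul ℝ ℝ, volume] f

theorem integrable_bumpSeq_normed (k : ℕ) : Integrable ((bumpSeq n k).normed volume) :=
  (bumpSeq n k).integrable_normed

theorem Integrable.mollify (k : ℕ) {f : Rn n → ℝ} (hf : Integrable f) :
    Integrable (mollify k f) :=
  (integrable_bumpSeq_normed k).integrable_convolution _ hf

theorem contDiff_mollify (k : ℕ) {f : Rn n → ℝ} (hf : Integrable f) :
    ContDiff ℝ ∞ (mollify k f) :=
  (bumpSeq n k).hasCompactSupport_normed.contDiff_convolution_left _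
    (bumpSeq n k).contDiff_normed hf.locallyIntegrable

open Filter in
theorem ae_tendsto_mollify {f : Rn n → ℝ} (hf : Integrable f) :
    ∀ᵐ x, Tendsto (fun k => mollify k f x) atTop (𝓝 (f x)) := by
  -- The outer radii `2 / (k + 1)` are twice the inner ones; a bounded ratio of radii is what
  -- convergence at Lebesgue points requires.
  refine ContDiffBump.ae_convolution_tendsto_right_of_locallyIntegrable (K := 2) ?_ ?_
    hf.locallyIntegrable
  · have := (tendsto_one_div_add_atTop_nhds_zero_nat (𝕜 := ℝ)).const_mul 2
    simpa [bumpSeq, div_eq_mul_inv] using this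
  · refine Eventually.of_forall fun k => le_of_eq ?_
    simp only [bumpSeq]
    ring

theorem integral_mollify (k : ℕ) {f : Rn n → ℝ} (hf : Integrable f) :
    ∫ x, mollify k f x = ∫ x, f x := by
  unfold mollify
  rw [integral_convolution _ (integrable_bumpSeq_normed k) hf, (bumpSeq n k).integral_normed]
  simp

theorem mollify_nonneg (k : ℕ) {f : Rn n → ℝ} (hf : ∀ x, 0 ≤ f x) (x : Rn n) :
    0 ≤ mollify k f x := by
  unfold mollify
  rw [convolution_lsmul]
  exact integral_nonneg fun t => mul_nonneg ((bumpSeq n k).nonneg_normed t) (hf _)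

open Filter in
-- Mollification preserves sign and total mass and converges a.e., so
-- `tendsto_L1_of_nonneg_of_integral_eq` applies to the positive and the negative part.
theorem tendsto_L1_mollify {f : Rn n → ℝ} (hf : Integrable f) :
    Tendsto (fun k => ∫ x, |mollify k f x - f x|) atTop (𝓝 0) := by
  set p : Rn n → ℝ := fun x => max (f x) 0
  set q : Rn n → ℝ := fun x => max (-f x) 0
  have hp : Integrable p := hf.pos_part
  have hq : Integrable q := hf.neg_part
  have hfpq : f = p + (-1 : ℝ) • q := by
    funext x
    simp only [Pi.add_apply, Pi.smul_apply, smul_eq_mul, p, q]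
    rcases le_total 0 (f x) with h | h
    · rw [max_eq_left h, max_eq_right (by linarith)]
      ring
    · rw [max_eq_right h, max_eq_left (by linarith)]
      ring
  have ex : ∀ (k : ℕ) (h : Rn n → ℝ), Integrable h →
      ConvolutionExists ((bumpSeq n k).normed volume) h
        (ContinuousLinearMap.lsmul ℝ ℝ) volume := fun k h hh =>
    (bumpSeq n k).hasCompactSupport_normed.convolutionExists_left _
      (bumpSeq n k).continuous_normed hh.locallyIntegrable
  have hm : ∀ k x, mollify k f x = mollify k p x - mollify k q x := by
    intro k x
    unfold mollify
    rw [hfpq, (ex k p hp).distrib_add (ex k _ (hq.smul (-1 : ℝ))), convolution_smul]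
    simp
    ring
  have lp := tendsto_L1_of_nonneg_of_integral_eq hp (fun k => Integrable.mollify k hp)
    (fun x => le_max_right _ _) (fun k => mollify_nonneg k fun x => le_max_right _ _)
    (fun k => integral_mollify k hp) (ae_tendsto_mollify hp)
  have lq := tendsto_L1_of_nonneg_of_integral_eq hq (fun k => Integrable.mollify k hq)
    (fun x => le_max_right _ _) (fun k => mollify_nonneg k fun x => le_max_right _ _)
    (fun k => integral_mollify k hq) (ae_tendsto_mollify hq)
  refine squeeze_zero (fun k => integral_nonneg fun x => abs_nonneg _) ?_
    (by simpa using lp.add lq)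
  intro k
  have ip := ((Integrable.mollify k hp).sub hp).abs
  have iq := ((Integrable.mollify k hq).sub hq).abs
  refine (integral_mono ((Integrable.mollify k hf).sub hf).abs (ip.add iq) ?_).trans_eq
    (integral_add ip iq)
  intro x
  have : f x = p x - q x := by
    have := congrFun hfpq x
    simpa [sub_eq_add_neg] using this
  simp only [Pi.add_apply, Pi.sub_apply]
  rw [hm, this]
  calc |mollify k p x - mollify k q x - (p x - q x)|
      = |(mollify k p x - p x) - (mollify k q x - q x)| := by ring_nf
    _ ≤ _ := abs_sub _ _

/-- The derivative of the convolution falls on the bump `ρ`, and `t ↦ ρ (x - t)` is an admissible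
test function. The sign from the reflection cancels the sign from integration by parts. -/
theorem fderiv_mollify {f : Rn n → ℝ} {g : Rn n → Rn n} (h : HasWeakGrad univ f g)
    (hf : Integrable f) (k : ℕ) (i : Fin n) (x : Rn n) :
    fderiv ℝ (mollify k f) x (EuclideanSpace.single i 1) = mollify k (fun y => g y i) x := by
  set ρ := (bumpSeq n k).normed (volume : Measure (Rn n)) with hρ
  set e : Rn n := EuclideanSpace.single i 1
  have ρs : ContDiff ℝ ∞ ρ := (bumpSeq n k).contDiff_normed
  have ρc : HasCompactSupport ρ := (bumpSeq n k).hasCompactSupport_normed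
  have hd := ρc.hasFDerivAt_convolution_left (ContinuousLinearMap.lsmul ℝ ℝ)
    (ρs.of_le (by simp)) (hf.locallyIntegrable) x
  have ex : ConvolutionExistsAt (fderiv ℝ ρ) f x
      ((ContinuousLinearMap.lsmul ℝ ℝ : ℝ →L[ℝ] ℝ →L[ℝ] ℝ).precompL (Rn n)) volume :=
    (ρc.fderiv ℝ).convolutionExists_left _ (ρs.continuous_fderiv (by simp))
      hf.locallyIntegrable x
  have e1 : fderiv ℝ (mollify k f) x e = ∫ t, fderiv ℝ ρ t e * f (x - t) := by
    have : fderiv ℝ (mollify k f) x = _ := hd.fderiv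
    rw [this, convolution_def, ContinuousLinearMap.integral_apply ex]
    rfl
  have e2 : ∫ t, fderiv ℝ ρ t e * f (x - t) = ∫ t, fderiv ℝ ρ (x - t) e * f t := by
    rw [← integral_sub_left_eq_self (fun t => fderiv ℝ ρ t e * f (x - t)) volume x]
    simp
  have φs : ContDiff ℝ ∞ fun t => ρ (x - t) := ρs.comp (contDiff_const.sub contDiff_id)
  have φc : HasCompactSupport fun t => ρ (x - t) :=
    ρc.comp_homeomorph (Homeomorph.subLeft x)
  have key := h.integral_eq _ φs φc (subset_univ _) i
  have dφ : ∀ t, fderiv ℝ (fun t => ρ (x - t)) t e = -fderiv ℝ ρ (x - t) e := by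
    intro t
    have h1 : HasFDerivAt (fun t : Rn n => x - t) (-ContinuousLinearMap.id ℝ (Rn n)) t := by
      simpa using (hasFDerivAt_id t).const_sub x
    have h2 := ((ρs.differentiable (by simp)) (x - t)).hasFDerivAt.comp t h1
    have : fderiv ℝ (fun t => ρ (x - t)) t = _ := h2.fderiv
    rw [this]
    simp
  rw [e1, e2]
  unfold mollify
  rw [convolution_lsmul_swap]
  simp only [setIntegral_univ] at key
  rw [show (∫ t, f t * fderiv ℝ (fun t => ρ (x - t)) t (EuclideanSpace.single i 1)) =
    -∫ t, fderiv ℝ ρ (x - t) e * f t by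
      rw [← integral_neg]
      refine integral_congr_ae (Filter.Eventually.of_forall fun t => ?_)
      simp only
      rw [dφ]
      ring] at key
  rw [neg_inj] at key
  rw [key]
  refine integral_congr_ae (Filter.Eventually.of_forall fun t => ?_)
  simp [mul_comm, hρ]

theorem abs_sub_le_of_abs_deriv_le_one {G : ℝ → ℝ} (hG : ContDiff ℝ 1 G)
    (h1 : ∀ t, |deriv G t| ≤ 1) (a b : ℝ) : |G a - G b| ≤ |a - b| := by
  have := convex_univ.norm_image_sub_le_of_norm_deriv_le (f := G) (C := 1) (x := b) (y := a)
    (fun x _ => (hG.differentiable (by simp)) x) (fun x _ => h1 x) (mem_univ _) (mem_univ _)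
  simpa using this

open Filter in
-- The identity is classical for the mollified functions. The left side passes to the limit because
-- `G` is 1-Lipschitz, the right side because `deriv G` is bounded and continuous while the
-- mollified gradients converge in `L¹`.
theorem integral_comp_mul_fderiv_of_integrable {f : Rn n → ℝ} {g : Rn n → Rn n}
    (h : HasWeakGrad univ f g) (hf : Integrable f) (i : Fin n) (hg : Integrable fun x => g x i)
    {G : ℝ → ℝ} (hG : ContDiff ℝ 1 G) (h0 : G 0 = 0) (h1 : ∀ t, |deriv G t| ≤ 1)
    {φ : Rn n → ℝ} (hφ : ContDiff ℝ ∞ φ) (hc : HasCompactSupport φ) :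
    ∫ x, G (f x) * fderiv ℝ φ x (EuclideanSpace.single i 1) =
      -∫ x, deriv G (f x) * g x i * φ x := by
  set e : Rn n := EuclideanSpace.single i 1
  have lip := abs_sub_le_of_abs_deriv_le_one hG h1
  have cdG : Continuous (deriv G) := hG.continuous_deriv (by simp)
  have hms : ∀ k, ContDiff ℝ ∞ (mollify k f) := fun k => contDiff_mollify k hf
  have iG : ∀ F : Rn n → ℝ, Integrable F → Integrable fun x => G (F x) := by
    intro F hF
    refine hF.mono (hG.continuous.comp_aestronglyMeasurable hF.aestronglyMeasurable)
      (Eventually.of_forall fun x => ?_)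
    simpa [h0] using lip (F x) 0
  have cφ : Continuous fun x => fderiv ℝ φ x e :=
    (hφ.continuous_fderiv (by simp)).clm_apply continuous_const
  have cc : HasCompactSupport fun x => fderiv ℝ φ x e := hc.fderiv_apply ℝ e
  obtain ⟨C1, hC1⟩ := cc.exists_bound_of_continuous cφ
  obtain ⟨C2, hC2⟩ := hc.exists_bound_of_continuous hφ.continuous
  have dG : ∀ k x, fderiv ℝ (fun x => G (mollify k f x)) x e =
      deriv G (mollify k f x) * mollify k (fun y => g y i) x := by
    intro k x
    have a1 := ((hG.differentiable (by simp)) (mollify k f x)).hasDerivAt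
    have a2 := ((hms k).differentiable (by simp) x).hasFDerivAt
    have := (a1.comp_hasFDerivAt x a2).fderiv
    rw [show (fun x => G (mollify k f x)) = G ∘ mollify k f from rfl, this]
    simp [fderiv_mollify h hf, e]
  have parts : ∀ k, ∫ x, fderiv ℝ φ x e * G (mollify k f x) =
      -∫ x, (deriv G (mollify k f x) * φ x) * mollify k (fun y => g y i) x := by
    intro k
    have cmf := (hms k).continuous
    have cmg : Continuous (mollify k fun y => g y i) := (contDiff_mollify k hg).continuous
    have hGk : ContDiff ℝ 1 fun x => G (mollify k f x) := hG.comp ((hms k).of_le (by simp))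
    have := integral_mul_fderiv_eq_neg_fderiv_mul_of_integrable (μ := (volume : Measure (Rn n)))
      (f := fun x => G (mollify k f x)) (g := φ) (v := e) ?_ ?_ ?_
      (fun x _ => hGk.differentiable (by simp) x) (fun x _ => hφ.differentiable (by simp) x)
    · simp_rw [dG] at this
      calc _ = ∫ x, G (mollify k f x) * fderiv ℝ φ x e := by simp_rw [mul_comm]
        _ = _ := this
        _ = _ := by
          congr 1
          refine integral_congr_ae (Eventually.of_forall fun x => ?_)
          simp only
          ring
    · simp_rw [dG]
      exact (((cdG.comp cmf).mul cmg).mul hφ.continuous).integrable_of_hasCompactSupport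
        hc.mul_left
    · exact ((hG.continuous.comp cmf).mul cφ).integrable_of_hasCompactSupport cc.mul_left
    · exact ((hG.continuous.comp cmf).mul hφ.continuous).integrable_of_hasCompactSupport hc.mul_left
  have L1 : Tendsto (fun k => ∫ x, fderiv ℝ φ x e * G (mollify k f x)) atTop
      (𝓝 (∫ x, fderiv ℝ φ x e * G (f x))) := by
    refine tendsto_integral_mul_of_tendsto_L1 (C := C1) (c' := fun _ x => fderiv ℝ φ x e)
      (iG f hf) (fun k => iG _ (Integrable.mollify k hf)) ?_ (fun _ => cφ.aestronglyMeasurable)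
      (fun _ => hC1) (Eventually.of_forall fun x => tendsto_const_nhds)
    refine squeeze_zero (fun k => integral_nonneg fun x => abs_nonneg _) ?_ (tendsto_L1_mollify hf)
    intro k
    have ik := Integrable.mollify k hf
    exact integral_mono ((iG _ ik).sub (iG f hf)).abs (ik.sub hf).abs fun x => lip _ _
  have L2 : Tendsto (fun k => ∫ x, (deriv G (mollify k f x) * φ x) *
      mollify k (fun y => g y i) x) atTop (𝓝 (∫ x, (deriv G (f x) * φ x) * g x i)) := by
    refine tendsto_integral_mul_of_tendsto_L1 (C := C2)
      (c' := fun k x => deriv G (mollify k f x) * φ x) hg (fun k => Integrable.mollify k hg)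
      (tendsto_L1_mollify hg)
      (fun k => ((cdG.comp (hms k).continuous).mul hφ.continuous).aestronglyMeasurable) ?_ ?_
    · intro k x
      rw [abs_mul]
      calc _ ≤ 1 * C2 := mul_le_mul (h1 _) (hC2 x) (abs_nonneg _) zero_le_one
        _ = C2 := one_mul _
    · filter_upwards [ae_tendsto_mollify hf] with x hx
      exact ((cdG.tendsto _).comp hx).mul_const _
  have L3 := tendsto_nhds_unique (L1.congr parts) L2.neg
  calc _ = ∫ x, fderiv ℝ φ x e * G (f x) := by simp_rw [mul_comm]
    _ = _ := L3
    _ = _ := by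
      congr 1
      refine integral_congr_ae (Eventually.of_forall fun x => ?_)
      simp only
      ring

/-- A smooth cutoff between a compact set and an open neighbourhood of it. -/
theorem exists_smooth_cutoff {K U : Set (Rn n)} (hK : IsCompact K) (hU : IsOpen U)
    (hKU : K ⊆ U) : ∃ ζ : Rn n → ℝ, ContDiff ℝ ∞ ζ ∧ HasCompactSupport ζ ∧ tsupport ζ ⊆ U ∧
      (∀ x, ζ x ∈ Icc (0 : ℝ) 1) ∧ ∃ V, IsOpen V ∧ K ⊆ V ∧ ∀ x ∈ V, ζ x = 1 := by
  obtain ⟨L, hL, hKL, hLU⟩ := exists_compact_between hK hU hKU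
  obtain ⟨f, h1, h0, hI⟩ := exists_contMDiffMap_one_nhds_of_subset_interior
    (modelWithCornersSelf ℝ (Rn n)) (n := (⊤ : ℕ∞)) hK.isClosed hKL
  have hs : tsupport f ⊆ L := by
    refine closure_minimal ?_ hL.isClosed
    intro x hx
    by_contra hxL
    exact hx (h0 x hxL)
  refine ⟨f, f.contMDiff.contDiff, HasCompactSupport.of_support_subset_isCompact hL
    ((subset_tsupport _).trans hs), hs.trans hLU, hI, ?_⟩
  obtain ⟨W, hWo, hKW, hW⟩ := eventually_nhdsSet_iff_exists.1 h1
  exact ⟨W, hWo, hKW, hW⟩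

/-- Chain rule for weak gradients. -/
theorem HasWeakGrad.comp {U : Set (Rn n)} (hU : IsOpen U) {u : Rn n → ℝ} {g : Rn n → Rn n}
    (h : HasWeakGrad U u g) {G : ℝ → ℝ} (hG : ContDiff ℝ 1 G) (h0 : G 0 = 0)
    (h1 : ∀ t, |deriv G t| ≤ 1) :
    HasWeakGrad U (fun x => G (u x)) (fun x => deriv G (u x) • g x) where
  locallyIntegrable := by
    have hl := h.locallyIntegrable
    rw [locallyIntegrableOn_iff hU.isLocallyClosed] at hl ⊢
    intro k hk hkc
    refine Integrable.mono (hl k hk hkc) (hG.continuous.comp_aestronglyMeasurable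
      (hl k hk hkc).aestronglyMeasurable) (Filter.Eventually.of_forall fun x => ?_)
    simpa [h0] using abs_sub_le_of_abs_deriv_le_one hG h1 (u x) 0
  locallyIntegrable_grad := by
    have hl := h.locallyIntegrable
    have hl' := h.locallyIntegrable_grad
    rw [locallyIntegrableOn_iff hU.isLocallyClosed] at hl hl' ⊢
    intro k hk hkc
    have cdG : Continuous (deriv G) := hG.continuous_deriv (by simp)
    exact (hl' k hk hkc).bdd_smul 1 (cdG.comp_aestronglyMeasurable
      (hl k hk hkc).aestronglyMeasurable) (Filter.Eventually.of_forall fun x => h1 _)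
  integral_eq := by
    intro φ hφ hc hs i
    -- Localization: `ζ u` is integrable on the whole space with integrable gradient. As `ζ = 1` on
    -- a neighbourhood of the support of `φ`, neither integral changes.
    obtain ⟨ζ, hζ, hζc, hζU, -, V, hVo, hKV, hV1⟩ := exists_smooth_cutoff hc hU hs
    have hw := h.smooth_mul isOpen_univ (subset_univ _) hζ (by simpa using hζU)
    have supp : ∀ {F : Type} [NormedAddCommGroup F] {f : Rn n → F},
        LocallyIntegrableOn f univ → (∀ x, x ∉ tsupport ζ → f x = 0) → Integrable f := by
      intro F _ f hf hf0
      have : IntegrableOn f (tsupport ζ) := hf.integrableOn_compact_subset (subset_univ _) hζc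
      refine (integrableOn_iff_integrable_of_support_subset fun x hx => ?_).1 this
      by_contra hh
      exact hx (hf0 x hh)
    have i1 := supp hw.locallyIntegrable fun x hx => by
      simp [image_eq_zero_of_notMem_tsupport hx]
    have i2 := supp hw.locallyIntegrable_grad fun x hx => by
      simp [image_eq_zero_of_notMem_tsupport hx, gradient_eq_zero_of_notMem_tsupport hx]
    have key := integral_comp_mul_fderiv_of_integrable hw i1 i
      ((EuclideanSpace.proj (𝕜 := ℝ) i).integrable_comp i2) hG h0 h1 hφ hc
    have hVζ : ∀ x ∈ V, gradient ζ x = 0 := by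
      intro x hx
      have : ζ =ᶠ[𝓝 x] fun _ => 1 := by
        filter_upwards [hVo.mem_nhds hx] with y hy using hV1 y hy
      simp [gradient, this.fderiv_eq]
    have dφ0 : ∀ x, x ∉ tsupport φ → fderiv ℝ φ x (EuclideanSpace.single i 1) = 0 := by
      intro x hx
      rw [← gradient_apply_coord, gradient_eq_zero_of_notMem_tsupport hx]
      simp
    rw [setIntegral_eq_integral_of_forall_compl_eq_zero
        fun x hx => by rw [dφ0 x fun hh => hx (hs hh), mul_zero],
      setIntegral_eq_integral_of_forall_compl_eq_zero fun x hx => by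
        rw [image_eq_zero_of_notMem_tsupport fun hh => hx (hs hh), mul_zero]]
    calc _ = ∫ x, G (ζ x * u x) * fderiv ℝ φ x (EuclideanSpace.single i 1) := by
          refine integral_congr_ae (Filter.Eventually.of_forall fun x => ?_)
          by_cases hx : x ∈ tsupport φ
          · simp [hV1 x (hKV hx)]
          · simp [dφ0 x hx]
      _ = _ := key
      _ = _ := by
          congr 1
          refine integral_congr_ae (Filter.Eventually.of_forall fun x => ?_)
          by_cases hx : x ∈ tsupport φ
          · simp [hV1 x (hKV hx), hVζ x (hKV hx)]
          · simp [image_eq_zero_of_notMem_tsupport hx]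

end RemovableSing

namespace RemovableSing

variable {n : ℕ}

/-! ### Dyadic cubes and smooth cutoffs -/

/-- The closed cube with the center of `dyadicCube k m` and twice its side length. -/
def doubleCube (k : ℤ) (m : Fin n → ℤ) : Set (Rn n) :=
  {x | ∀ i, |x i - dyadicCenter k m i| ≤ (2 : ℝ) ^ (-k)}

/-- The open cube with the center of `dyadicCube k m` and side length larger by half. -/
def midCube (k : ℤ) (m : Fin n → ℤ) : Set (Rn n) :=
  {x | ∀ i, |x i - dyadicCenter k m i| < 3 / 4 * (2 : ℝ) ^ (-k)}

/-- The open cube with the center of `dyadicCube k m` and twice its side length. -/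
def openDoubleCube (k : ℤ) (m : Fin n → ℤ) : Set (Rn n) :=
  {x | ∀ i, |x i - dyadicCenter k m i| < (2 : ℝ) ^ (-k)}

theorem norm_le_sqrt_mul {a : ℝ} {x : Rn n} (ha : 0 ≤ a) (h : ∀ i, |x i| ≤ a) :
    ‖x‖ ≤ Real.sqrt n * a := by
  rw [EuclideanSpace.norm_eq]
  refine Real.sqrt_le_iff.2 ⟨by positivity, ?_⟩
  rw [mul_pow, Real.sq_sqrt (Nat.cast_nonneg n)]
  calc ∑ i, ‖x i‖ ^ 2 ≤ ∑ _i : Fin n, a ^ 2 := by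
        refine Finset.sum_le_sum fun i _ => ?_
        exact pow_le_pow_left₀ (norm_nonneg _) (h i) 2
    _ = n * a ^ 2 := by simp

theorem norm_lt_sqrt_mul {a : ℝ} {x : Rn n} (hn : 0 < n) (h : ∀ i, |x i| < a) :
    ‖x‖ < Real.sqrt n * a := by
  have hne : (Finset.univ : Finset (Fin n)).Nonempty := ⟨⟨0, hn⟩, Finset.mem_univ _⟩
  obtain ⟨j, -, hj⟩ := Finset.exists_max_image Finset.univ (fun i => |x i|) hne
  refine (norm_le_sqrt_mul (abs_nonneg _) fun i => hj i (Finset.mem_univ _)).trans_lt ?_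
  exact mul_lt_mul_of_pos_left (h j) (Real.sqrt_pos.2 (by exact_mod_cast hn))

theorem abs_coord_le_norm (x : Rn n) (i : Fin n) : |x i| ≤ ‖x‖ := PiLp.norm_apply_le x i

theorem isOpen_coord_lt (a : ℝ) : IsOpen {x : Rn n | ∀ i, |x i| < a} := by
  simp only [ofPred_forall]
  exact isOpen_iInter_of_finite fun i => isOpen_lt (by fun_prop) continuous_const

theorem isCompact_coord_le (a : ℝ) : IsCompact {x : Rn n | ∀ i, |x i| ≤ a} := by
  refine Metric.isCompact_of_isClosed_isBounded ?_ ?_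
  · simp only [ofPred_forall]
    exact isClosed_iInter fun i => isClosed_le (by fun_prop) continuous_const
  · refine (Metric.isBounded_closedBall (x := (0 : Rn n)) (r := Real.sqrt n * |a|)).subset ?_
    intro x hx
    rw [mem_closedBall_zero_iff]
    exact norm_le_sqrt_mul (abs_nonneg a) fun i => (hx i).trans (le_abs_self a)

theorem dyadicCenter_apply (k : ℤ) (m : Fin n → ℤ) (i : Fin n) :
    dyadicCenter k m i = ((m i : ℝ) + 1 / 2) * (2 : ℝ) ^ (-k) := rfl

theorem abs_sub_center_le {k : ℤ} {m : Fin n → ℤ} {x : Rn n} (hx : x ∈ dyadicCube k m)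
    (i : Fin n) : |x i - dyadicCenter k m i| ≤ (2 : ℝ) ^ (-k) / 2 := by
  obtain ⟨h1, h2⟩ := hx i
  rw [dyadicCenter_apply, abs_le]
  constructor <;> linarith

theorem isOpen_cube (y : Rn n) (a : ℝ) : IsOpen {x : Rn n | ∀ i, |x i - y i| < a} :=
  (isOpen_coord_lt a).preimage (continuous_id.sub continuous_const)

theorem isOpen_midCube (k : ℤ) (m : Fin n → ℤ) : IsOpen (midCube k m) := isOpen_cube _ _

theorem isOpen_openDoubleCube (k : ℤ) (m : Fin n → ℤ) : IsOpen (openDoubleCube k m) :=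
  isOpen_cube _ _

theorem openDoubleCube_subset (k : ℤ) (m : Fin n → ℤ) : openDoubleCube k m ⊆ doubleCube k m :=
  fun _ hx i => (hx i).le

theorem dyadicCube_subset_midCube (k : ℤ) (m : Fin n → ℤ) : dyadicCube k m ⊆ midCube k m := by
  intro x hx i
  have hl : (0 : ℝ) < (2 : ℝ) ^ (-k) := by positivity
  have := abs_sub_center_le hx i
  linarith

theorem openDoubleCube_subset_ball (hn : 0 < n) (k : ℤ) (m : Fin n → ℤ) :
    openDoubleCube k m ⊆ Metric.ball (dyadicCenter k m) (Real.sqrt n * (2 : ℝ) ^ (-k)) := by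
  intro x hx
  rw [mem_ball_iff_norm]
  exact norm_lt_sqrt_mul hn hx

theorem ball_subset_doubleCube (k : ℤ) (m : Fin n → ℤ) :
    Metric.ball (dyadicCenter k m) ((2 : ℝ) ^ (-k)) ⊆ doubleCube k m := by
  intro x hx i
  rw [mem_ball_iff_norm] at hx
  exact (abs_coord_le_norm (x - dyadicCenter k m) i).trans hx.le

theorem dist_le_of_mem_doubleCube {k : ℤ} {m : Fin n → ℤ} {x e : Rn n} (hx : x ∈ doubleCube k m)
    (he : e ∈ dyadicCube k m) : dist x e ≤ Real.sqrt n * (2 * (2 : ℝ) ^ (-k)) := by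
  have hl : (0 : ℝ) < (2 : ℝ) ^ (-k) := by positivity
  rw [dist_eq_norm]
  refine norm_le_sqrt_mul (by positivity) fun i => ?_
  have h1 := abs_le.1 (hx i)
  have h2 := abs_le.1 (abs_sub_center_le he i)
  rw [PiLp.sub_apply, abs_le]
  constructor <;> linarith

/-- The dyadic cubes around a point of the doubled cube. -/
theorem doubleCube_subset (k : ℤ) (m : Fin n → ℤ) :
    doubleCube k m ⊆ ⋃ d ∈ Fintype.piFinset fun _ : Fin n => Finset.Icc (-1 : ℤ) 1,
      dyadicCube k (m + d) := by
  intro x hx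
  have hl : (0 : ℝ) < (2 : ℝ) ^ (-k) := by positivity
  set ℓ : ℝ := (2 : ℝ) ^ (-k)
  have h : ∀ i, ∃ d : ℤ, d ∈ Finset.Icc (-1 : ℤ) 1 ∧
      ((m i + d : ℤ) : ℝ) * ℓ ≤ x i ∧ x i ≤ (((m i + d : ℤ) : ℝ) + 1) * ℓ := by
    intro i
    have h1 := abs_le.1 (hx i)
    rw [dyadicCenter_apply] at h1
    by_cases c1 : x i < m i * ℓ
    · refine ⟨-1, by simp, ?_⟩
      push_cast
      constructor <;> linarith
    · by_cases c2 : x i ≤ (m i + 1) * ℓ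
      · refine ⟨0, by simp, ?_⟩
        push_cast
        constructor <;> linarith
      · refine ⟨1, by simp, ?_⟩
        push_cast
        constructor <;> linarith
  choose d hd1 hd2 using h
  simp only [mem_iUnion]
  exact ⟨d, Fintype.mem_piFinset.2 hd1, hd2⟩

theorem dyadicCube_inter_nonempty (k : ℤ) (m d : Fin n → ℤ)
    (hd : d ∈ Fintype.piFinset fun _ : Fin n => Finset.Icc (-1 : ℤ) 1) :
    (dyadicCube k m ∩ dyadicCube k (m + d)).Nonempty := by
  have hl : (0 : ℝ) < (2 : ℝ) ^ (-k) := by positivity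
  -- A common vertex: the upper face of the first cube in the directions with `d i = 1`, the lower
  -- face in the others.
  refine ⟨WithLp.toLp 2 fun i => ((m i : ℝ) + if d i = 1 then 1 else 0) * (2 : ℝ) ^ (-k), ?_, ?_⟩
  · intro i
    simp only
    split_ifs <;> constructor <;> nlinarith
  · intro i
    have := Fintype.mem_piFinset.1 hd i
    rw [Finset.mem_Icc] at this
    have h3 : d i = -1 ∨ d i = 0 ∨ d i = 1 := by omega
    simp only [Pi.add_apply]
    generalize (2 : ℝ) ^ (-k) = ℓ at hl
    rcases h3 with h | h | h <;> rw [h] <;> constructor <;> norm_num <;> nlinarith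

theorem dyadicCube_add_subset_closedBall {k : ℤ} {m d : Fin n → ℤ} {e : Rn n}
    (he : e ∈ dyadicCube k m)
    (hd : d ∈ Fintype.piFinset fun _ : Fin n => Finset.Icc (-1 : ℤ) 1) :
    dyadicCube k (m + d) ⊆ Metric.closedBall e (Real.sqrt n * (2 * (2 : ℝ) ^ (-k))) := by
  intro x hx
  have hl : (0 : ℝ) < (2 : ℝ) ^ (-k) := by positivity
  rw [mem_closedBall_iff_norm]
  refine norm_le_sqrt_mul (by positivity) fun i => ?_
  obtain ⟨h1, h2⟩ := hx i
  obtain ⟨h3, h4⟩ := he i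
  have := Fintype.mem_piFinset.1 hd i
  rw [Finset.mem_Icc] at this
  have a1 : (-1 : ℝ) ≤ d i := by exact_mod_cast this.1
  have a2 : (d i : ℝ) ≤ 1 := by exact_mod_cast this.2
  simp only [Pi.add_apply, Int.cast_add] at h1 h2
  rw [PiLp.sub_apply, abs_le]
  constructor <;> nlinarith

/-! ### Counting overlaps of doubled dyadic cubes. -/

/-- Induction on the largest element `a`: the other exponents are at most `a - 1`, so their sum is
at most `2 ^ a`, and adding the top term doubles it. -/
theorem sum_zpow_two_le (I : Finset ℤ) (K : ℤ) (h : ∀ k ∈ I, k ≤ K) :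
    ∑ k ∈ I, (2 : ℝ) ^ k ≤ (2 : ℝ) ^ (K + 1) := by
  induction I using Finset.induction_on_max generalizing K with
  | empty => simp; positivity
  | insert a s ha ih =>
    rw [Finset.sum_insert fun h => lt_irrefl _ (ha a h)]
    have h1 := ih (a - 1) fun k hk => by have := ha k hk; omega
    rw [sub_add_cancel] at h1
    calc (2 : ℝ) ^ a + ∑ k ∈ s, (2 : ℝ) ^ k ≤ 2 ^ a + 2 ^ a := by linarith
      _ = 2 ^ (a + 1) := by rw [zpow_add₀ (by norm_num)]; ring
      _ ≤ _ := zpow_le_zpow_right₀ (by norm_num)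
        (by have := h a (Finset.mem_insert_self _ _); omega)

/-- Each `m i` is confined to a window around `⌊x i / 2 ^ (-k)⌋`. Five values per coordinate is
generous; only dependence on `n` alone matters. -/
theorem card_doubleCube_le (x : Rn n) (k : ℤ) (M : Finset (Fin n → ℤ))
    (hM : ∀ m ∈ M, x ∈ doubleCube k m) : M.card ≤ 5 ^ n := by
  have hl : (0 : ℝ) < (2 : ℝ) ^ (-k) := by positivity
  have hsub : M ⊆ Fintype.piFinset fun i : Fin n =>
      Finset.Icc (⌊x i / (2 : ℝ) ^ (-k)⌋ - 2) (⌊x i / (2 : ℝ) ^ (-k)⌋ + 2) := by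
    intro m hm
    rw [Fintype.mem_piFinset]
    intro i
    have h1 := abs_le.1 (hM m hm i)
    rw [dyadicCenter_apply] at h1
    have f1 := Int.floor_le (x i / (2 : ℝ) ^ (-k))
    have f2 := Int.lt_floor_add_one (x i / (2 : ℝ) ^ (-k))
    rw [le_div_iff₀ hl] at f1
    rw [div_lt_iff₀ hl] at f2
    set t := ⌊x i / (2 : ℝ) ^ (-k)⌋
    rw [Finset.mem_Icc]
    have g1 : (m i : ℝ) < t + 2 := by
      by_contra hh
      push Not at hh
      nlinarith
    have g2 : (t : ℝ) - 2 < m i := by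
      by_contra hh
      push Not at hh
      nlinarith
    have g1' : m i < t + 2 := by exact_mod_cast g1
    have g2' : t - 2 < m i := by exact_mod_cast g2
    omega
  refine (Finset.card_le_card hsub).trans ?_
  rw [Fintype.card_piFinset]
  simp only [Int.card_Icc]
  have : ∀ t : ℤ, (t + 2 + 1 - (t - 2)).toNat = 5 := by intro t; omega
  simp [this]

/-- The inverse side lengths of distinct cubes whose doubles contain a point are dominated by the
largest of them. -/
theorem exists_sum_zpow_le (F : Finset (ℤ × (Fin n → ℤ))) (hF : F.Nonempty) (x : Rn n)
    (hx : ∀ c ∈ F, x ∈ doubleCube c.1 c.2) :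
    ∃ c ∈ F, ∑ c ∈ F, (2 : ℝ) ^ c.1 ≤ 2 * 5 ^ n * (2 : ℝ) ^ c.1 := by
  classical
  obtain ⟨c0, hc0, hmax⟩ := Finset.exists_max_image F (fun c => c.1) hF
  refine ⟨c0, hc0, ?_⟩
  -- Group the cubes by generation. Each generation contributes at most `5 ^ n` cubes, and the
  -- geometric sum over generations costs a factor `2`.
  have h1 : ∑ c ∈ F, (2 : ℝ) ^ c.1 =
      ∑ k ∈ F.image Prod.fst, ∑ c ∈ F with c.1 = k, (2 : ℝ) ^ c.1 :=
    (Finset.sum_fiberwise_of_maps_to (fun c hc => Finset.mem_image_of_mem _ hc) _).symm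
  rw [h1]
  have h2 : ∀ k ∈ F.image Prod.fst, ∑ c ∈ F with c.1 = k, (2 : ℝ) ^ c.1 ≤ 5 ^ n * (2 : ℝ) ^ k := by
    intro k _
    have e : ∑ c ∈ F with c.1 = k, (2 : ℝ) ^ c.1 = (F.filter fun c => c.1 = k).card * (2 : ℝ) ^ k := by
      rw [Finset.sum_congr rfl (g := fun _ => (2 : ℝ) ^ k)]
      · simp
      · intro c hc
        rw [(Finset.mem_filter.1 hc).2]
    rw [e]
    have hcard : (F.filter fun c => c.1 = k).card =
        ((F.filter fun c => c.1 = k).image Prod.snd).card := by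
      refine (Finset.card_image_of_injOn ?_).symm
      intro a ha b hb hab
      have ha' := (Finset.mem_filter.1 ha).2
      have hb' := (Finset.mem_filter.1 hb).2
      exact Prod.ext (ha'.trans hb'.symm) hab
    have hle := card_doubleCube_le x k ((F.filter fun c => c.1 = k).image Prod.snd) (by
      intro m hm
      obtain ⟨c, hc, rfl⟩ := Finset.mem_image.1 hm
      obtain ⟨hc1, hc2⟩ := Finset.mem_filter.1 hc
      rw [← hc2]
      exact hx c hc1)
    rw [← hcard] at hle
    gcongr
    exact_mod_cast hle
  refine (Finset.sum_le_sum h2).trans ?_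
  rw [← Finset.mul_sum]
  have h3 := sum_zpow_two_le (F.image Prod.fst) c0.1 (by
    intro k hk
    obtain ⟨c, hc, rfl⟩ := Finset.mem_image.1 hk
    exact hmax c hc)
  rw [zpow_add₀ (by norm_num), zpow_one] at h3
  calc (5 : ℝ) ^ n * ∑ k ∈ F.image Prod.fst, (2 : ℝ) ^ k ≤ 5 ^ n * (2 ^ c0.1 * 2) := by gcongr
    _ = _ := by ring

/-! ### Smooth cutoffs adapted to families of cubes. -/

/-- The gradient of a product of functions with values in `[0, 1]`. -/
theorem norm_fderiv_prod_le {ι : Type*} (F : Finset ι) (f : ι → Rn n → ℝ)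
    (hf : ∀ c, ContDiff ℝ ∞ (f c)) (hI : ∀ c x, f c x ∈ Icc (0 : ℝ) 1) (x : Rn n) :
    ‖fderiv ℝ (fun x => ∏ c ∈ F, f c x) x‖ ≤ ∑ c ∈ F, ‖fderiv ℝ (f c) x‖ := by
  classical
  induction F using Finset.induction_on with
  | empty => simp
  | insert a s ha ih =>
    have hs : ContDiff ℝ ∞ fun x => ∏ c ∈ s, f c x := contDiff_prod fun c _ => hf c
    simp only [Finset.prod_insert ha, Finset.sum_insert ha]
    rw [fderiv_fun_mul ((hf a).differentiable (by simp) x) (hs.differentiable (by simp) x)]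
    have b1 : ‖f a x‖ ≤ 1 := by
      rw [Real.norm_of_nonneg (hI a x).1]
      exact (hI a x).2
    have b2 : ‖∏ c ∈ s, f c x‖ ≤ 1 := by
      rw [Real.norm_of_nonneg (Finset.prod_nonneg fun c _ => (hI c x).1)]
      exact Finset.prod_le_one (fun c _ => (hI c x).1) fun c _ => (hI c x).2
    refine (norm_add_le _ _).trans ?_
    rw [norm_smul, norm_smul, add_comm]
    refine add_le_add ?_ ?_
    · exact mul_le_of_le_one_left (norm_nonneg _) b2
    · exact (mul_le_of_le_one_left (norm_nonneg _) b1).trans ih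

/-- Cutoffs adapted to dyadic cubes, with uniformly controlled gradients. -/
theorem exists_cube_cutoffs (n : ℕ) : ∃ (C : ℝ) (ψ : ℤ × (Fin n → ℤ) → Rn n → ℝ), 0 < C ∧
    (∀ c, ContDiff ℝ ∞ (ψ c)) ∧ (∀ c x, ψ c x ∈ Icc (0 : ℝ) 1) ∧
    (∀ c, ∀ x ∈ midCube c.1 c.2, ψ c x = 1) ∧
    (∀ c x, (∃ i, (2 : ℝ) ^ (-c.1) ≤ |x i - dyadicCenter c.1 c.2 i|) → ψ c x = 0) ∧
    (∀ c x, (∃ i, (2 : ℝ) ^ (-c.1) ≤ |x i - dyadicCenter c.1 c.2 i|) → fderiv ℝ (ψ c) x = 0) ∧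
    ∀ c x, ‖fderiv ℝ (ψ c) x‖ ≤ C * (2 : ℝ) ^ c.1 := by
  -- One profile at unit scale, equal to `1` on the cube of half-side `3/4` and supported in the
  -- open cube of half-side `1`. The affine map `T c` transports it to each dyadic cube, and its
  -- gradient gains the factor `2 ^ c.1`.
  obtain ⟨h, hs, hc, hU, hI, V, hV, hKV, hV1⟩ :=
    exists_smooth_cutoff (isCompact_coord_le (n := n) (3 / 4)) (isOpen_coord_lt 1)
      (fun x hx i => (hx i).trans_lt (by norm_num))
  obtain ⟨C, hC⟩ := (hc.fderiv ℝ).exists_bound_of_continuous (hs.continuous_fderiv (by simp))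
  have hC0 : 0 ≤ C := (norm_nonneg _).trans (hC 0)
  set T : ℤ × (Fin n → ℤ) → Rn n → Rn n :=
    fun c x => (2 : ℝ) ^ c.1 • (x - dyadicCenter c.1 c.2) with hT
  have Td : ∀ c x, HasFDerivAt (T c) ((2 : ℝ) ^ c.1 • ContinuousLinearMap.id ℝ (Rn n)) x :=
    fun c x => ((hasFDerivAt_id x).sub_const _).fun_const_smul _
  have Ts : ∀ c, ContDiff ℝ ∞ (T c) := fun c => (contDiff_id.sub contDiff_const).const_smul _
  have Tc : ∀ c x i, |T c x i| = (2 : ℝ) ^ c.1 * |x i - dyadicCenter c.1 c.2 i| := by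
    intro c x i
    simp only [hT, PiLp.smul_apply, PiLp.sub_apply, smul_eq_mul]
    rw [abs_mul, abs_of_pos (by positivity)]
  have fd : ∀ c x, fderiv ℝ (fun x => h (T c x)) x = (2 : ℝ) ^ c.1 • fderiv ℝ h (T c x) := by
    intro c x
    have := (((hs.differentiable (by simp)) (T c x)).hasFDerivAt.comp x (Td c x)).fderiv
    rw [show (fun x => h (T c x)) = h ∘ T c from rfl, this]
    ext v
    simp
  have out : ∀ c x, (∃ i, (2 : ℝ) ^ (-c.1) ≤ |x i - dyadicCenter c.1 c.2 i|) →
      T c x ∉ tsupport h := by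
    rintro c x ⟨i, hi⟩ hmem
    have := hU hmem i
    rw [Tc] at this
    have h2 : (0 : ℝ) < (2 : ℝ) ^ c.1 := by positivity
    rw [zpow_neg, inv_le_iff_one_le_mul₀ h2] at hi
    linarith
  refine ⟨C + 1, fun c x => h (T c x), by linarith, fun c => hs.comp (Ts c), fun c x => hI _, ?_,
    ?_, ?_, ?_⟩
  · intro c x hx
    refine hV1 _ (hKV fun i => ?_)
    rw [Tc]
    have := hx i
    have h2 : (0 : ℝ) < (2 : ℝ) ^ c.1 := by positivity
    calc _ ≤ (2 : ℝ) ^ c.1 * (3 / 4 * (2 : ℝ) ^ (-c.1)) := by gcongr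
      _ = 3 / 4 := by rw [zpow_neg]; field_simp
  · intro c x hx
    exact image_eq_zero_of_notMem_tsupport (out c x hx)
  · intro c x hx
    rw [fd, image_eq_zero_of_notMem_tsupport fun hh => out c x hx (tsupport_fderiv_subset ℝ hh),
      smul_zero]
  · intro c x
    rw [fd, norm_smul, Real.norm_of_nonneg (by positivity), mul_comm]
    have := hC (T c x)
    gcongr
    linarith

/-- The cutoff attached to a finite family of cubes: it vanishes near the cubes, equals `1` away
from their doubles, and its gradient is controlled by the smallest cube nearby. -/
theorem exists_family_cutoff (n : ℕ) : ∃ C : ℝ, 1 ≤ C ∧ ∀ F : Finset (ℤ × (Fin n → ℤ)),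
    ∃ η : Rn n → ℝ, ContDiff ℝ ∞ η ∧ (∀ x, η x ∈ Icc (0 : ℝ) 1) ∧
      (∀ c ∈ F, ∀ x ∈ midCube c.1 c.2, η x = 0) ∧
      (∀ x, (∀ c ∈ F, x ∉ doubleCube c.1 c.2) → η x = 1) ∧
      ∀ x, fderiv ℝ η x = 0 ∨ ∃ c ∈ F, x ∈ openDoubleCube c.1 c.2 ∧
        ‖fderiv ℝ η x‖ ≤ C * (2 : ℝ) ^ c.1 := by
  classical
  obtain ⟨C, ψ, hC, hs, hI, h1, h0, hd0, hd⟩ := exists_cube_cutoffs n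
  -- The factor `2 * 5 ^ n` is the overlap bound of `exists_sum_zpow_le`. The maximum with `1` makes
  -- powers of the constant monotone in the exponent later on.
  refine ⟨max 1 (C * (2 * 5 ^ n)), le_max_left _ _, fun F => ?_⟩
  have hs' : ∀ c, ContDiff ℝ ∞ fun x => 1 - ψ c x := fun c => contDiff_const.sub (hs c)
  have hI' : ∀ c x, 1 - ψ c x ∈ Icc (0 : ℝ) 1 := fun c x =>
    ⟨by linarith [(hI c x).2], by linarith [(hI c x).1]⟩
  refine ⟨fun x => ∏ c ∈ F, (1 - ψ c x), contDiff_prod fun c _ => hs' c, fun x =>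
    ⟨Finset.prod_nonneg fun c _ => (hI' c x).1,
      Finset.prod_le_one (fun c _ => (hI' c x).1) fun c _ => (hI' c x).2⟩, ?_, ?_, ?_⟩
  · intro c hc x hx
    exact Finset.prod_eq_zero hc (by rw [h1 c x hx, sub_self])
  · intro x hx
    refine Finset.prod_eq_one fun c hc => ?_
    have : ∃ i, (2 : ℝ) ^ (-c.1) ≤ |x i - dyadicCenter c.1 c.2 i| := by
      by_contra hh
      push Not at hh
      exact hx c hc fun i => (hh i).le
    rw [h0 c x this, sub_zero]
  · intro x
    -- Only cubes whose open double contains `x` contribute to the gradient at `x`.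
    set F' := F.filter fun c => ∀ i, |x i - dyadicCenter c.1 c.2 i| < (2 : ℝ) ^ (-c.1) with hF'
    have e1 : ∑ c ∈ F, ‖fderiv ℝ (fun x => 1 - ψ c x) x‖ ≤ ∑ c ∈ F', C * (2 : ℝ) ^ c.1 := by
      rw [hF', Finset.sum_filter]
      refine Finset.sum_le_sum fun c _ => ?_
      rw [fderiv_const_sub, norm_neg]
      split_ifs with hh
      · exact hd c x
      · push Not at hh
        rw [hd0 c x hh, norm_zero]
    have e2 := (norm_fderiv_prod_le F (fun c x => 1 - ψ c x) hs' hI' x).trans e1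
    by_cases hne : F'.Nonempty
    · right
      obtain ⟨c, hc, hle⟩ := exists_sum_zpow_le F' hne x fun c hc i =>
        ((Finset.mem_filter.1 hc).2 i).le
      refine ⟨c, (Finset.mem_filter.1 hc).1, (Finset.mem_filter.1 hc).2, ?_⟩
      refine e2.trans ?_
      rw [← Finset.mul_sum]
      calc C * ∑ c ∈ F', (2 : ℝ) ^ c.1 ≤ C * (2 * 5 ^ n * (2 : ℝ) ^ c.1) := by gcongr
        _ = C * (2 * 5 ^ n) * (2 : ℝ) ^ c.1 := by ring
        _ ≤ _ := by gcongr; exact le_max_right _ _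
    · left
      rw [Finset.not_nonempty_iff_eq_empty.1 hne, Finset.sum_empty] at e2
      exact norm_le_zero_iff.1 e2

end RemovableSing

namespace RemovableSing

variable {n : ℕ}

/-! ### Small cutoffs around sets of vanishing net measure -/

theorem powIntegral_mono_set {Ω S T : Set (Rn n)} (h : S ⊆ T) (ϑ s : Rn n → ℝ) (ℓ : ℝ) :
    powIntegral Ω S ϑ s ℓ ≤ powIntegral Ω T ϑ s ℓ :=
  lintegral_mono_set (inter_subset_inter_left _ h)

theorem ae_inter {Ω S : Set (Rn n)} {q : Rn n → Prop} (h : ∀ᵐ x ∂volume.restrict Ω, q x) :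
    ∀ᵐ x ∂volume.restrict (S ∩ Ω), q x :=
  ae_mono (Measure.restrict_mono inter_subset_right le_rfl) h

theorem powIntegral_le_sum_adjacent (Ω : Set (Rn n)) (ϑ s : Rn n → ℝ) (k : ℤ) (m : Fin n → ℤ)
    (ℓ : ℝ) : powIntegral Ω (doubleCube k m) ϑ s ℓ ≤
      ∑ d ∈ Fintype.piFinset fun _ : Fin n => Finset.Icc (-1 : ℤ) 1,
        powIntegral Ω (dyadicCube k (m + d)) ϑ s ℓ := by
  refine (powIntegral_mono_set (doubleCube_subset k m) ϑ s ℓ).trans ?_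
  unfold powIntegral
  rw [iUnion₂_inter]
  rw [← Finset.tsum_subtype]
  have e : (⋃ d ∈ Fintype.piFinset fun _ : Fin n => Finset.Icc (-1 : ℤ) 1,
      dyadicCube k (m + d) ∩ Ω) =
      ⋃ d : {d // d ∈ Fintype.piFinset fun _ : Fin n => Finset.Icc (-1 : ℤ) 1},
        dyadicCube k (m + d.1) ∩ Ω := by
    ext x
    simp only [mem_iUnion, Subtype.exists, exists_prop]
  rw [e]
  exact lintegral_iUnion_le _ _

/-- A locally bounded function on an open set is bounded on compact subsets. -/
theorem exists_bound_of_locally_bounded {X : Type*} [TopologicalSpace X] {K : Set X}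
    (hK : IsCompact K) {f : X → ℝ} (h : ∀ q ∈ K, ∃ M : ℝ, ∀ᶠ q' in 𝓝 q, f q' ≤ M) :
    ∃ M : ℝ, ∀ q ∈ K, f q ≤ M := by
  refine hK.induction_on (p := fun s => ∃ M : ℝ, ∀ q ∈ s, f q ≤ M) ⟨0, by simp⟩ ?_ ?_ ?_
  · rintro s t hst ⟨M, hM⟩
    exact ⟨M, fun q hq => hM q (hst hq)⟩
  · rintro s t ⟨M, hM⟩ ⟨N, hN⟩
    refine ⟨max M N, ?_⟩
    rintro q (hq | hq)
    · exact (hM q hq).trans (le_max_left _ _)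
    · exact (hN q hq).trans (le_max_right _ _)
  · intro q hq
    obtain ⟨M, hM⟩ := h q hq
    exact ⟨_, mem_nhdsWithin_of_mem_nhds hM, M, fun q' hq' => hq'⟩

theorem dyadicCenter_mem (k : ℤ) (m : Fin n → ℤ) : dyadicCenter k m ∈ dyadicCube k m := by
  intro i
  have hl : (0 : ℝ) < (2 : ℝ) ^ (-k) := by positivity
  rw [dyadicCenter_apply]
  constructor <;> nlinarith

/-- Near a compact subset of `Ω`, the integral over a doubled cube is controlled by the integral
over the cube. -/
theorem AdjacentComparable.exists_doubling {Ω E : Set (Rn n)} (hΩ : IsOpen Ω) (hE : IsCompact E)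
    (hEΩ : E ⊆ Ω) {ϑ τ : Rn n → ℝ} (h : AdjacentComparable Ω ϑ τ) :
    ∃ (r : ℝ) (D : ℝ≥0∞), 0 < r ∧ D ≠ ⊤ ∧ ∀ (k : ℤ) (m : Fin n → ℤ),
      (dyadicCube k m ∩ E).Nonempty → (2 : ℝ) ^ (-k) < r →
      Metric.closedBall (dyadicCenter k m) (Real.sqrt n * (2 : ℝ) ^ (-k)) ⊆ Ω ∧
      powIntegral Ω (doubleCube k m) ϑ (fun x => -τ x) ((2 : ℝ) ^ (-k)) ≤
        D * powIntegral Ω (dyadicCube k m) ϑ (fun x => -τ x) ((2 : ℝ) ^ (-k)) := by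
  obtain ⟨σ, -, hloc, hcmp⟩ := h
  obtain ⟨r0, hr0, hsub⟩ := hE.exists_cthickening_subset_open hΩ hEΩ
  set K := Metric.cthickening r0 E
  have hK : IsCompact K := hE.cthickening
  obtain ⟨M, hM⟩ := exists_bound_of_locally_bounded (hK.prod hK)
    fun q hq => hloc q ⟨hsub hq.1, hsub hq.2⟩
  -- The radius keeps the neighbouring cubes and the ball about the center within `r0` of a point of
  -- `E`. The doubled cube meets `3 ^ n` positions `m + d`; the maximum with `1` covers `d = 0`,
  -- since a cube is not adjacent to itself.
  refine ⟨r0 / (4 * (Real.sqrt n + 1)), 3 ^ n * max 1 (ENNReal.ofReal M), by positivity, ?_, ?_⟩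
  · exact ENNReal.mul_ne_top (by simp) (by simp)
  intro k m ⟨e, he, heE⟩ hk
  have hl : (0 : ℝ) < (2 : ℝ) ^ (-k) := by positivity
  have hs : 0 ≤ Real.sqrt n := Real.sqrt_nonneg _
  have hk2 : Real.sqrt n * (2 * (2 : ℝ) ^ (-k)) ≤ r0 / 2 := by
    rw [lt_div_iff₀ (by positivity)] at hk
    nlinarith
  have hball : ∀ x, dist x e ≤ r0 → x ∈ K := fun x hx =>
    Metric.mem_cthickening_of_dist_le x e r0 E heE hx
  have hcube : ∀ d ∈ Fintype.piFinset fun _ : Fin n => Finset.Icc (-1 : ℤ) 1,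
      dyadicCube k (m + d) ⊆ K := by
    intro d hd x hx
    have := dyadicCube_add_subset_closedBall he hd hx
    exact hball x ((Metric.mem_closedBall.1 this).trans (by linarith))
  have h0 : (0 : Fin n → ℤ) ∈ Fintype.piFinset fun _ : Fin n => Finset.Icc (-1 : ℤ) 1 := by
    simp
  have hcube0 : dyadicCube k m ⊆ K := by simpa using hcube 0 h0
  constructor
  · intro x hx
    refine hsub (hball x ?_)
    have h1 : dist (dyadicCenter k m) e ≤ Real.sqrt n * (2 * (2 : ℝ) ^ (-k)) :=
      dist_le_of_mem_doubleCube (fun i => by rw [sub_self, abs_zero]; exact hl.le) he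
    have h2 := dist_triangle x (dyadicCenter k m) e
    have h3 := Metric.mem_closedBall.1 hx
    nlinarith
  · refine (powIntegral_le_sum_adjacent Ω ϑ _ k m _).trans ?_
    calc _ ≤ ∑ d ∈ Fintype.piFinset fun _ : Fin n => Finset.Icc (-1 : ℤ) 1,
          max 1 (ENNReal.ofReal M) *
            powIntegral Ω (dyadicCube k m) ϑ (fun x => -τ x) ((2 : ℝ) ^ (-k)) := by
          refine Finset.sum_le_sum fun d hd => ?_
          by_cases hd0 : d = 0
          · rw [hd0, add_zero]
            exact le_mul_of_one_le_left' (le_max_left _ _)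
          · refine (hcmp k (m + d) m (by simpa using hd0) ?_ ((hcube d hd).trans hsub)
              (hcube0.trans hsub)).trans ?_
            · rw [inter_comm]
              exact dyadicCube_inter_nonempty k m d hd
            · gcongr
              refine le_trans ?_ (le_max_right _ _)
              refine ENNReal.ofReal_le_ofReal (hM _ ⟨hcube d hd (dyadicCenter_mem _ _),
                hcube0 (dyadicCenter_mem _ _)⟩)
      _ = _ := by
          rw [Finset.sum_const, Fintype.card_piFinset, nsmul_eq_mul, mul_assoc]
          simp

/-- For `ℓ ≤ 1` one has `ℓ^(-P) ℓ^s = ℓ^(s-P) ≤ ℓ^t` when `t ≤ s - P`. With `s = -τ` and `t = α - n`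
this is where the relation between `τ`, `α` and `P` enters. -/
theorem ofReal_rpow_mul_powIntegral_le {Ω S : Set (Rn n)} {ϑ s t : Rn n → ℝ} {P ℓ : ℝ}
    (hℓ : 0 < ℓ) (hℓ1 : ℓ ≤ 1) (hϑ : ∀ᵐ x ∂volume.restrict Ω, 0 < ϑ x)
    (hst : ∀ᵐ x ∂volume.restrict Ω, t x ≤ s x - P) :
    ENNReal.ofReal (ℓ⁻¹ ^ P) * powIntegral Ω S ϑ s ℓ ≤ powIntegral Ω S ϑ t ℓ := by
  unfold powIntegral
  rw [← lintegral_const_mul' _ _ ENNReal.ofReal_ne_top]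
  refine lintegral_mono_ae ?_
  filter_upwards [ae_inter hϑ, ae_inter hst] with x h1 h2
  rw [← ENNReal.ofReal_mul (by positivity)]
  refine ENNReal.ofReal_le_ofReal ?_
  rw [← mul_assoc, Real.inv_rpow hℓ.le, ← Real.rpow_neg hℓ.le, ← Real.rpow_add hℓ]
  refine mul_le_mul_of_nonneg_right ?_ h1.le
  exact Real.rpow_le_rpow_of_exponent_ge hℓ hℓ1 (by linarith)

/-- A set of vanishing net measure has covers with small sums. -/
theorem exists_cover_of_netMeasure_eq_zero {Ω E : Set (Rn n)} {α ϑ : Rn n → ℝ} {γ : ℝ}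
    (hγ : 0 < γ) (hγ1 : γ ≤ 1) (h : netMeasure Ω α γ ϑ E = 0) {ε : ℝ} (hε : 0 < ε) {δ : ℝ≥0∞}
    (hδ : 0 < δ) : ∃ S : Set (ℤ × (Fin n → ℤ)), (∀ c ∈ S, (2 : ℝ) ^ (-c.1) < ε) ∧
      E ⊆ (⋃ c ∈ S, dyadicCube c.1 c.2) ∧
      ∑' c : S, powIntegral Ω (dyadicCube c.1.1 c.1.2) ϑ (fun x => α x - n)
        ((2 : ℝ) ^ (-c.1.1)) < δ := by
  -- The cap `1` forces each term `a ^ γ ≤ 1`, hence `a ≤ 1`, and then `a ≤ a ^ γ` because `γ ≤ 1`: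
  -- the sum without the power is small as well.
  have h1 : netContent Ω α γ ϑ ε E < min δ 1 := by
    have : netContent Ω α γ ϑ ε E ≤ netMeasure Ω α γ ϑ E :=
      le_iSup₂ (f := fun (ε : ℝ) (_ : 0 < ε) => netContent Ω α γ ϑ ε E) ε hε
    rw [h] at this
    exact this.trans_lt (lt_min hδ one_pos)
  unfold netContent at h1
  simp only [iInf_lt_iff] at h1
  obtain ⟨S, hS1, hS2, hS3⟩ := h1
  refine ⟨S, hS1, hS2.trans interior_subset, lt_of_le_of_lt ?_ (hS3.trans_le (min_le_left _ _))⟩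
  refine ENNReal.tsum_le_tsum fun c => ?_
  set a := powIntegral Ω (dyadicCube c.1.1 c.1.2) ϑ (fun x => α x - n) ((2 : ℝ) ^ (-c.1.1))
  have h2 : a ^ γ ≤ 1 := (ENNReal.le_tsum c).trans (hS3.le.trans (min_le_right _ _))
  have h3 : a ≤ 1 := by
    by_contra hh
    push Not at hh
    exact absurd h2 (not_le.2 (ENNReal.one_lt_rpow hh hγ))
  simpa using ENNReal.rpow_le_rpow_of_exponent_ge h3 hγ1

/-- For sides below `1` and `α ≤ n` the factor `ℓ^(α-n)` is at least `1`, so the covering sums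
dominate the `ϑ`-measure of `E`. A weight that is positive a.e. has only Lebesgue null sets as null
sets in `Ω`. -/
theorem volume_eq_zero_of_netMeasure_eq_zero {Ω E : Set (Rn n)} (hEΩ : E ⊆ Ω) {α ϑ : Rn n → ℝ} {γ : ℝ}
    (hγ : 0 < γ) (hγ1 : γ ≤ 1) (hα : ∀ᵐ x ∂volume.restrict Ω, α x ≤ n)
    (hϑm : AEMeasurable ϑ (volume.restrict Ω)) (hϑ : ∀ᵐ x ∂volume.restrict Ω, 0 < ϑ x)
    (h : netMeasure Ω α γ ϑ E = 0) : volume E = 0 := by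
  have h0 : ∫⁻ x in E, ENNReal.ofReal (ϑ x) = 0 := by
    refine nonpos_iff_eq_zero.1 (le_of_forall_pos_le_add fun δ hδ => ?_)
    obtain ⟨S, hS1, hS2, hS3⟩ := exists_cover_of_netMeasure_eq_zero hγ hγ1 h one_pos hδ
    rw [zero_add]
    refine le_trans ?_ hS3.le
    have hsub : E ⊆ ⋃ c : S, dyadicCube c.1.1 c.1.2 ∩ Ω := by
      intro x hx
      obtain ⟨c, hc, hxc⟩ := mem_iUnion₂.1 (hS2 hx)
      exact mem_iUnion.2 ⟨⟨c, hc⟩, hxc, hEΩ hx⟩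
    refine (lintegral_mono_set hsub).trans ((lintegral_iUnion_le _ _).trans ?_)
    refine ENNReal.tsum_le_tsum fun c => ?_
    unfold powIntegral
    refine lintegral_mono_ae ?_
    filter_upwards [ae_inter hϑ, ae_inter hα] with x h1 h2
    refine ENNReal.ofReal_le_ofReal (le_mul_of_one_le_left h1.le ?_)
    exact Real.one_le_rpow_of_pos_of_le_one_of_nonpos (by positivity) (hS1 c.1 c.2).le
      (by linarith)
  have hr : volume.restrict E ≤ volume.restrict Ω := Measure.restrict_mono hEΩ le_rfl
  rw [lintegral_eq_zero_iff' (hϑm.mono_measure hr).ennreal_ofReal] at h0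
  have : ∀ᵐ x ∂volume.restrict E, False := by
    filter_upwards [h0, ae_mono hr hϑ] with x h1 h2
    simp only [Pi.zero_apply, ENNReal.ofReal_eq_zero] at h1
    linarith
  rw [ae_iff] at this
  simpa using this

/-- Gradient energy of a cutoff adapted to a finite family of cubes. -/
theorem lintegral_gradient_le {Ω : Set (Rn n)} {p ϑ b : Rn n → ℝ} {P C : ℝ}
    (hpm : AEMeasurable p (volume.restrict Ω)) (hϑm : AEMeasurable ϑ (volume.restrict Ω))
    (hbm : AEMeasurable b (volume.restrict Ω))
    (hp : ∀ᵐ x ∂volume.restrict Ω, 1 < p x ∧ p x ≤ P) (hϑ : ∀ᵐ x ∂volume.restrict Ω, 0 < ϑ x)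
    (hb : ∀ x, 0 ≤ b x) (hC : 1 ≤ C) {F : Finset (ℤ × (Fin n → ℤ))}
    (hF : ∀ c ∈ F, (2 : ℝ) ^ (-c.1) ≤ 1) {η : Rn n → ℝ}
    (hη : ∀ x, fderiv ℝ η x = 0 ∨ ∃ c ∈ F, x ∈ openDoubleCube c.1 c.2 ∧
        ‖fderiv ℝ η x‖ ≤ C * (2 : ℝ) ^ c.1) :
    ∫⁻ x in Ω, ENNReal.ofReal ((b x * ‖fderiv ℝ η x‖) ^ p x * ϑ x) ≤
      ENNReal.ofReal (C ^ P) * ∑ c ∈ F, ENNReal.ofReal (((2 : ℝ) ^ (-c.1))⁻¹ ^ P) *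
        ∫⁻ x in openDoubleCube c.1 c.2 ∩ Ω, ENNReal.ofReal (b x ^ p x * ϑ x) := by
  have hm : AEMeasurable (fun x => ENNReal.ofReal (b x ^ p x * ϑ x)) (volume.restrict Ω) :=
    ((hbm.pow hpm).mul hϑm).ennreal_ofReal
  have e : ∀ c : ℤ × (Fin n → ℤ),
      ∫⁻ x in openDoubleCube c.1 c.2 ∩ Ω, ENNReal.ofReal (b x ^ p x * ϑ x) =
      ∫⁻ x in Ω, (openDoubleCube c.1 c.2).indicator
        (fun x => ENNReal.ofReal (b x ^ p x * ϑ x)) x := by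
    intro c
    rw [lintegral_indicator (isOpen_openDoubleCube _ _).measurableSet,
      Measure.restrict_restrict (isOpen_openDoubleCube _ _).measurableSet]
  simp_rw [e]
  have e2 : ∀ c : ℤ × (Fin n → ℤ), ENNReal.ofReal (((2 : ℝ) ^ (-c.1))⁻¹ ^ P) *
      ∫⁻ x in Ω, (openDoubleCube c.1 c.2).indicator
        (fun x => ENNReal.ofReal (b x ^ p x * ϑ x)) x =
      ∫⁻ x in Ω, ENNReal.ofReal (((2 : ℝ) ^ (-c.1))⁻¹ ^ P) * (openDoubleCube c.1 c.2).indicator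
        (fun x => ENNReal.ofReal (b x ^ p x * ϑ x)) x := fun c =>
    (lintegral_const_mul' _ _ ENNReal.ofReal_ne_top).symm
  simp_rw [e2]
  rw [← lintegral_finsetSum' _ fun c _ =>
    (hm.indicator (isOpen_openDoubleCube _ _).measurableSet).const_mul _,
    ← lintegral_const_mul' _ _ ENNReal.ofReal_ne_top]
  refine lintegral_mono_ae ?_
  filter_upwards [hp, hϑ] with x hpx hϑx
  rcases hη x with h | ⟨c, hc, hxc, hle⟩
  · rw [h, norm_zero, mul_zero, Real.zero_rpow (by linarith), zero_mul, ENNReal.ofReal_zero]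
    exact zero_le
  -- The gradient at `x` is controlled by a single cube, so one term of the sum suffices.
  · refine le_trans ?_ (mul_le_mul_right (Finset.single_le_sum (fun _ _ => zero_le) hc) _)
    rw [indicator_of_mem hxc, ← ENNReal.ofReal_mul (by positivity),
      ← ENNReal.ofReal_mul (by positivity)]
    refine ENNReal.ofReal_le_ofReal ?_
    have h1 : (1 : ℝ) ≤ (2 : ℝ) ^ c.1 := by
      have := hF c hc
      rw [zpow_neg] at this
      exact (inv_le_one₀ (by positivity)).1 this
    have h2 : ((2 : ℝ) ^ (-c.1))⁻¹ = (2 : ℝ) ^ c.1 := by rw [zpow_neg, inv_inv]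
    rw [h2, ← mul_assoc, ← mul_assoc]
    refine mul_le_mul_of_nonneg_right ?_ hϑx.le
    calc (b x * ‖fderiv ℝ η x‖) ^ p x ≤ (C * (2 : ℝ) ^ c.1 * b x) ^ p x := by
          refine Real.rpow_le_rpow (mul_nonneg (hb x) (norm_nonneg _)) ?_ (by linarith)
          rw [mul_comm]
          exact mul_le_mul_of_nonneg_right hle (hb x)
      _ = C ^ p x * ((2 : ℝ) ^ c.1) ^ p x * b x ^ p x := by
          rw [Real.mul_rpow (by positivity) (hb x), Real.mul_rpow (by positivity) (by positivity)]
      _ ≤ C ^ P * ((2 : ℝ) ^ c.1) ^ P * b x ^ p x := by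
          refine mul_le_mul_of_nonneg_right ?_ (Real.rpow_nonneg (hb x) (p x))
          exact mul_le_mul (Real.rpow_le_rpow_of_exponent_le hC hpx.2)
            (Real.rpow_le_rpow_of_exponent_le h1 hpx.2) (by positivity) (by positivity)

/-- Cutoffs vanishing near `E` whose gradients have small weighted energy. -/
theorem exists_small_cutoff (hn : 0 < n) {Ω E : Set (Rn n)} (hΩ : IsOpen Ω) (hE : IsCompact E)
    (hEΩ : E ⊆ Ω) {p ϑ α τ v : Rn n → ℝ} {P γ : ℝ}
    (hpm : AEMeasurable p (volume.restrict Ω)) (hϑm : AEMeasurable ϑ (volume.restrict Ω))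
    (hvm : AEMeasurable v (volume.restrict Ω))
    (hp : ∀ᵐ x ∂volume.restrict Ω, 1 < p x ∧ p x ≤ P) (hϑ : ∀ᵐ x ∂volume.restrict Ω, 0 < ϑ x)
    (hτ0 : ∀ᵐ x ∂volume.restrict Ω, 0 ≤ τ x)
    (hτα : ∀ᵐ x ∂volume.restrict Ω, τ x ≤ n - α x - P)
    (hadj : AdjacentComparable Ω ϑ τ) (hγ : 0 < γ) (hγ1 : γ ≤ 1)
    (hnet : netMeasure Ω α γ ϑ E = 0) {C : ℝ}
    (hgrow : ∀ (y : Rn n) (r : ℝ), 0 < r → Metric.closedBall y r ⊆ Ω →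
      ∫⁻ x in Metric.ball y r, ENNReal.ofReal (|v x| ^ p x * ϑ x) ≤
        ENNReal.ofReal C * powIntegral Ω (Metric.ball y (r / Real.sqrt n)) ϑ (fun x => -τ x) r)
    {δ : ℝ} (hδ : 0 < δ) :
    ∃ η : Rn n → ℝ, ContDiff ℝ ∞ η ∧ (∀ x, η x ∈ Icc (0 : ℝ) 1) ∧
      (∃ V, IsOpen V ∧ E ⊆ V ∧ ∀ x ∈ V, η x = 0) ∧
      (∀ x, x ∉ Metric.thickening δ E → η x = 1) ∧
      ∫⁻ x in Ω, ENNReal.ofReal ((|v x| * ‖fderiv ℝ η x‖) ^ p x * ϑ x) ≤ ENNReal.ofReal δ ∧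
      ∫⁻ x in Ω, ENNReal.ofReal (‖fderiv ℝ η x‖ ^ p x * ϑ x) ≤ ENNReal.ofReal δ := by
  classical
  obtain ⟨r, D, hr, hD, hdoub⟩ := hadj.exists_doubling hΩ hE hEΩ
  obtain ⟨C1, hC1, hfam⟩ := exists_family_cutoff n
  have hsn : 0 < Real.sqrt n := Real.sqrt_pos.2 (by exact_mod_cast hn)
  have hsn1 : 1 ≤ Real.sqrt n := by
    rw [Real.one_le_sqrt]
    exact_mod_cast hn
  set B : ℝ≥0∞ := ENNReal.ofReal (C1 ^ P) * (max 1 (ENNReal.ofReal C) * D) with hB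
  have hBt : B ≠ ⊤ := ENNReal.mul_ne_top ENNReal.ofReal_ne_top
    (ENNReal.mul_ne_top (by simp) hD)
  have hδ' : 0 < ENNReal.ofReal δ / (B + 1) :=
    ENNReal.div_pos (by simpa using hδ) (by simpa using hBt)
  -- The side lengths are below `r` for the doubling estimate, below `1` for comparing powers, and
  -- below `δ / (4 √n)` so that doubled cubes meeting `E` stay in the `δ`-thickening of `E`.
  obtain ⟨S, hS1, hS2, hS3⟩ := exists_cover_of_netMeasure_eq_zero (Ω := Ω) (α := α) (ϑ := ϑ)
    hγ hγ1 hnet (ε := min (min r 1) (δ / (4 * Real.sqrt n))) (by positivity) hδ'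
  -- The doubling estimate concerns only cubes that meet `E`; the others are not needed to cover
  -- `E`. The enlarged open cubes `midCube` then give a finite subcover.
  set S' : Set (ℤ × (Fin n → ℤ)) := {c ∈ S | (dyadicCube c.1 c.2 ∩ E).Nonempty}
  obtain ⟨t, ht⟩ := hE.elim_finite_subcover (fun c : S' => midCube c.1.1 c.1.2)
    (fun c => isOpen_midCube _ _) (by
      intro x hx
      obtain ⟨c, hc, hxc⟩ := mem_iUnion₂.1 (hS2 hx)
      exact mem_iUnion.2 ⟨⟨c, hc, x, hxc, hx⟩, dyadicCube_subset_midCube _ _ hxc⟩)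
  set F : Finset (ℤ × (Fin n → ℤ)) := t.image Subtype.val with hFdef
  have hFS : ∀ c ∈ F, c ∈ S ∧ (dyadicCube c.1 c.2 ∩ E).Nonempty := by
    intro c hc
    obtain ⟨c', -, rfl⟩ := Finset.mem_image.1 hc
    exact c'.2
  have hsize : ∀ c ∈ F, (2 : ℝ) ^ (-c.1) < r ∧ (2 : ℝ) ^ (-c.1) < 1 ∧
      (2 : ℝ) ^ (-c.1) < δ / (4 * Real.sqrt n) := by
    intro c hc
    have := hS1 c (hFS c hc).1
    simp only [lt_min_iff] at this
    exact ⟨this.1.1, this.1.2, this.2⟩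
  obtain ⟨η, hη1, hη2, hη3, hη4, hη5⟩ := hfam F
  have hsum : ∑ c ∈ F, powIntegral Ω (dyadicCube c.1 c.2) ϑ (fun x => α x - n)
      ((2 : ℝ) ^ (-c.1)) ≤ ENNReal.ofReal δ / (B + 1) := by
    refine le_trans ?_ hS3.le
    rw [tsum_subtype S fun c => powIntegral Ω (dyadicCube c.1 c.2) ϑ (fun x => α x - n)
      ((2 : ℝ) ^ (-c.1))]
    refine le_trans (le_of_eq ?_) (ENNReal.sum_le_tsum F)
    refine Finset.sum_congr rfl fun c hc => ?_
    rw [indicator_of_mem (hFS c hc).1]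
  -- Applied below with `b = |v|`, by the growth bound, and with `b = 1`, where `1 ≤ ℓ^(-τ)` is
  -- enough.
  have energy : ∀ b : Rn n → ℝ, AEMeasurable b (volume.restrict Ω) → (∀ x, 0 ≤ b x) →
      (∀ c ∈ F, ∫⁻ x in openDoubleCube c.1 c.2 ∩ Ω, ENNReal.ofReal (b x ^ p x * ϑ x) ≤
        max 1 (ENNReal.ofReal C) * powIntegral Ω (doubleCube c.1 c.2) ϑ (fun x => -τ x)
          ((2 : ℝ) ^ (-c.1))) →
      ∫⁻ x in Ω, ENNReal.ofReal ((b x * ‖fderiv ℝ η x‖) ^ p x * ϑ x) ≤ ENNReal.ofReal δ := by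
    intro b hbm hb hbF
    refine (lintegral_gradient_le hpm hϑm hbm hp hϑ hb hC1
      (fun c hc => (hsize c hc).2.1.le) hη5).trans ?_
    calc _ ≤ ENNReal.ofReal (C1 ^ P) * ∑ c ∈ F, (max 1 (ENNReal.ofReal C) * D) *
          powIntegral Ω (dyadicCube c.1 c.2) ϑ (fun x => α x - n) ((2 : ℝ) ^ (-c.1)) := by
          refine mul_le_mul_right (Finset.sum_le_sum fun c hc => ?_) _
          have h1 := (hdoub c.1 c.2 (hFS c hc).2 (hsize c hc).1).2
          have h2 := ofReal_rpow_mul_powIntegral_le (S := dyadicCube c.1 c.2) (ϑ := ϑ)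
            (s := fun x => -τ x) (t := fun x => α x - n) (P := P) (ℓ := (2 : ℝ) ^ (-c.1))
            (by positivity) (hsize c hc).2.1.le hϑ (by
              filter_upwards [hτα] with x hx
              linarith)
          calc _ ≤ ENNReal.ofReal (((2 : ℝ) ^ (-c.1))⁻¹ ^ P) * (max 1 (ENNReal.ofReal C) *
                (D * powIntegral Ω (dyadicCube c.1 c.2) ϑ (fun x => -τ x)
                  ((2 : ℝ) ^ (-c.1)))) := by
                refine mul_le_mul_right ((hbF c hc).trans ?_) _
                exact mul_le_mul_right h1 _
            _ = max 1 (ENNReal.ofReal C) * D * (ENNReal.ofReal (((2 : ℝ) ^ (-c.1))⁻¹ ^ P) *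
                powIntegral Ω (dyadicCube c.1 c.2) ϑ (fun x => -τ x) ((2 : ℝ) ^ (-c.1))) := by
                ring
            _ ≤ _ := mul_le_mul_right h2 _
      _ = B * ∑ c ∈ F, powIntegral Ω (dyadicCube c.1 c.2) ϑ (fun x => α x - n)
          ((2 : ℝ) ^ (-c.1)) := by rw [← Finset.mul_sum, hB, ← mul_assoc]
      _ ≤ B * (ENNReal.ofReal δ / (B + 1)) := mul_le_mul_right hsum _
      _ ≤ (B + 1) * (ENNReal.ofReal δ / (B + 1)) := mul_le_mul_left le_self_add _
      _ ≤ _ := ENNReal.mul_div_le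
  refine ⟨η, hη1, hη2, ⟨⋃ c ∈ F, midCube c.1 c.2, isOpen_biUnion fun c _ => isOpen_midCube _ _,
    ?_, ?_⟩, ?_, ?_, ?_⟩
  · refine ht.trans ?_
    intro x hx
    obtain ⟨c, hc, hxc⟩ := mem_iUnion₂.1 hx
    exact mem_iUnion₂.2 ⟨c.1, Finset.mem_image_of_mem _ hc, hxc⟩
  · intro x hx
    obtain ⟨c, hc, hxc⟩ := mem_iUnion₂.1 hx
    exact hη3 c hc x hxc
  · intro x hx
    refine hη4 x fun c hc hxc => hx ?_
    obtain ⟨e, he, heE⟩ := (hFS c hc).2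
    refine Metric.mem_thickening_iff.2 ⟨e, heE, ?_⟩
    refine (dist_le_of_mem_doubleCube hxc he).trans_lt ?_
    have := (hsize c hc).2.2
    rw [lt_div_iff₀ (by positivity)] at this
    have hl : (0 : ℝ) < (2 : ℝ) ^ (-c.1) := by positivity
    nlinarith
  · refine energy (fun x => |v x|) (continuous_abs.measurable.comp_aemeasurable hvm)
      (fun x => abs_nonneg _) fun c hc => ?_
    have hl : (0 : ℝ) < (2 : ℝ) ^ (-c.1) := by positivity
    -- The ball of radius `√n ℓ` contains the open double cube, while the ball of radius `√n ℓ / √n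
    -- = ℓ` on the right lies inside the closed one. Replacing `(√n ℓ)^(-τ)` by `ℓ^(-τ)` uses `τ ≥
    -- 0`.
    have h1 := hgrow (dyadicCenter c.1 c.2) (Real.sqrt n * (2 : ℝ) ^ (-c.1)) (by positivity)
      (hdoub c.1 c.2 (hFS c hc).2 (hsize c hc).1).1
    rw [mul_div_cancel_left₀ _ hsn.ne'] at h1
    refine (lintegral_mono_set (inter_subset_left.trans
      (openDoubleCube_subset_ball hn c.1 c.2))).trans (h1.trans ?_)
    refine mul_le_mul' (le_max_right _ _) ?_
    refine le_trans ?_ (powIntegral_mono_set (ball_subset_doubleCube c.1 c.2) _ _ _)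
    unfold powIntegral
    refine lintegral_mono_ae ?_
    filter_upwards [ae_inter hϑ, ae_inter hτ0] with x hx1 hx2
    refine ENNReal.ofReal_le_ofReal (mul_le_mul_of_nonneg_right ?_ hx1.le)
    exact Real.rpow_le_rpow_of_nonpos hl (le_mul_of_one_le_left hl.le hsn1) (by linarith)
  · have := energy (fun _ => 1) aemeasurable_const (fun _ => zero_le_one) fun c hc => by
      have hl : (0 : ℝ) < (2 : ℝ) ^ (-c.1) := by positivity
      refine le_trans ?_ (mul_le_mul' (le_max_left _ _)
        (powIntegral_mono_set (openDoubleCube_subset c.1 c.2) _ _ _))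
      rw [one_mul]
      unfold powIntegral
      refine lintegral_mono_ae ?_
      filter_upwards [ae_inter hϑ, ae_inter hτ0] with x hx1 hx2
      refine ENNReal.ofReal_le_ofReal (mul_le_mul_of_nonneg_right ?_ hx1.le)
      rw [Real.one_rpow]
      exact Real.one_le_rpow_of_pos_of_le_one_of_nonpos hl (hsize c hc).2.1.le (by linarith)
    simpa using this

end RemovableSing

namespace RemovableSing

variable {n : ℕ}

/-! ### Weighted integrability with a bounded variable exponent -/

/-- Measurability and a.e. bounds for the exponent and the weight on `S`. -/
structure Admissible (S : Set (Rn n)) (p ϑ : Rn n → ℝ) (P : ℝ) : Prop where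
  aemeasurable_exponent : AEMeasurable p (volume.restrict S)
  aemeasurable_weight : AEMeasurable ϑ (volume.restrict S)
  exponent : ∀ᵐ x ∂volume.restrict S, 1 < p x ∧ p x ≤ P
  weight_pos : ∀ᵐ x ∂volume.restrict S, 0 < ϑ x

theorem Admissible.mono {S T : Set (Rn n)} {p ϑ : Rn n → ℝ} {P : ℝ} (h : Admissible S p ϑ P)
    (hTS : T ⊆ S) : Admissible T p ϑ P where
  aemeasurable_exponent := h.aemeasurable_exponent.mono_set hTS
  aemeasurable_weight := h.aemeasurable_weight.mono_set hTS
  exponent := ae_restrict_of_ae_restrict_of_subset hTS h.exponent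
  weight_pos := ae_restrict_of_ae_restrict_of_subset hTS h.weight_pos

/-- Let `s = θ^(-1/(p-1))`, so `s^(p-1) θ = 1`. Either `b ≤ κ s`, or `b^(p-1) θ ≥ κ^(p-1)` and
multiplying by `b` gives the second term. Since `κ ≤ 1`, the constant depends on `P` and not on the
variable exponent. -/
theorem le_young_dual {b κ θ p P : ℝ} (hb : 0 ≤ b) (hκ : 0 < κ) (hκ1 : κ ≤ 1) (hθ : 0 < θ)
    (hp : 1 < p) (hpP : p ≤ P) :
    b ≤ κ * θ ^ (-(1 / (p - 1))) + κ ^ (1 - P) * (b ^ p * θ) := by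
  have hp1 : 0 < p - 1 := by linarith
  set s := θ ^ (-(1 / (p - 1))) with hs
  have hs0 : 0 < s := Real.rpow_pos_of_pos hθ _
  have hsp : s ^ (p - 1) * θ = 1 := by
    rw [hs, ← Real.rpow_mul hθ.le, show -(1 / (p - 1)) * (p - 1) = -1 by field_simp,
      Real.rpow_neg_one, inv_mul_cancel₀ hθ.ne']
  rcases le_total b (κ * s) with h | h
  · have : 0 ≤ κ ^ (1 - P) * (b ^ p * θ) := by positivity
    linarith
  · have hb0 : 0 < b := lt_of_lt_of_le (by positivity) h
    have h1 : 1 ≤ κ ^ (1 - p) * b ^ (p - 1) * θ := by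
      have h2 : (κ * s) ^ (p - 1) ≤ b ^ (p - 1) := Real.rpow_le_rpow (by positivity) h hp1.le
      rw [Real.mul_rpow hκ.le hs0.le] at h2
      have h3 : κ ^ (1 - p) * κ ^ (p - 1) = 1 := by
        rw [← Real.rpow_add hκ]
        simp
      calc (1 : ℝ) = κ ^ (1 - p) * (κ ^ (p - 1) * s ^ (p - 1)) * θ := by
            rw [← mul_assoc, h3, one_mul, hsp]
        _ ≤ _ := by gcongr
    have h4 : κ ^ (1 - p) ≤ κ ^ (1 - P) :=
      Real.rpow_le_rpow_of_exponent_ge hκ hκ1 (by linarith)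
    have h5 : b ^ p = b ^ (p - 1) * b := by
      rw [← Real.rpow_add_one hb0.ne']
      simp
    have h6 : b ≤ κ ^ (1 - P) * (b ^ p * θ) := by
      calc b = 1 * b := (one_mul b).symm
        _ ≤ (κ ^ (1 - p) * b ^ (p - 1) * θ) * b := by gcongr
        _ = κ ^ (1 - p) * (b ^ p * θ) := by rw [h5]; ring
        _ ≤ _ := by gcongr
    have : 0 ≤ κ * s := by positivity
    linarith

/-- If `b ≤ κ a` the first term suffices; otherwise `a ≤ b / κ` and the second does. The constant is
again uniform over exponents up to `P`. -/
theorem rpow_sub_one_mul_le_young {a b κ p P : ℝ} (ha : 0 ≤ a) (hb : 0 ≤ b) (hκ : 0 < κ)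
    (hκ1 : κ ≤ 1) (hp : 1 < p) (hpP : p ≤ P) :
    a ^ (p - 1) * b ≤ κ * a ^ p + κ ^ (1 - P) * b ^ p := by
  have hp1 : 0 < p - 1 := by linarith
  have key : ∀ t : ℝ, 0 ≤ t → t ^ p = t ^ (p - 1) * t := by
    intro t ht
    rcases ht.eq_or_lt with h | h
    · rw [← h, Real.zero_rpow (by linarith), mul_zero]
    · rw [← Real.rpow_add_one h.ne']
      simp
  have h4 : κ ^ (1 - p) ≤ κ ^ (1 - P) :=
    Real.rpow_le_rpow_of_exponent_ge hκ hκ1 (by linarith)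
  rcases le_total b (κ * a) with h | h
  · have h1 : a ^ (p - 1) * b ≤ κ * a ^ p := by
      rw [key a ha]
      calc a ^ (p - 1) * b ≤ a ^ (p - 1) * (κ * a) := by gcongr
        _ = _ := by ring
    have : 0 ≤ κ ^ (1 - P) * b ^ p := by positivity
    linarith
  · have h2 : a ^ (p - 1) ≤ κ ^ (1 - p) * b ^ (p - 1) := by
      have h3 : (κ * a) ^ (p - 1) ≤ b ^ (p - 1) := Real.rpow_le_rpow (by positivity) h hp1.le
      rw [Real.mul_rpow hκ.le ha] at h3
      have h5 : κ ^ (1 - p) * κ ^ (p - 1) = 1 := by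
        rw [← Real.rpow_add hκ]
        simp
      calc a ^ (p - 1) = κ ^ (1 - p) * (κ ^ (p - 1) * a ^ (p - 1)) := by
            rw [← mul_assoc, h5, one_mul]
        _ ≤ _ := by gcongr
    have h1 : a ^ (p - 1) * b ≤ κ ^ (1 - P) * b ^ p := by
      rw [key b hb]
      calc a ^ (p - 1) * b ≤ κ ^ (1 - p) * b ^ (p - 1) * b := by gcongr
        _ = κ ^ (1 - p) * (b ^ (p - 1) * b) := by ring
        _ ≤ _ := by gcongr
    have : 0 ≤ κ * a ^ p := by positivity
    linarith

theorem rpow_le_of_le_mul_add {a b c C p P : ℝ} (ha : 0 ≤ a) (hb : 0 ≤ b) (hc : 0 ≤ c)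
    (hC : 1 ≤ C) (hp : 1 < p) (hpP : p ≤ P) (h : a ≤ C * (b + c)) :
    a ^ p ≤ (2 * C) ^ P * (b ^ p + c ^ p) := by
  have h1 : a ≤ 2 * C * max b c := by
    refine h.trans ?_
    have := le_max_left b c
    have := le_max_right b c
    nlinarith
  have hm : 0 ≤ max b c := le_max_of_le_left hb
  calc a ^ p ≤ (2 * C * max b c) ^ p := Real.rpow_le_rpow ha h1 (by linarith)
    _ = (2 * C) ^ p * max b c ^ p := Real.mul_rpow (by positivity) hm
    _ ≤ (2 * C) ^ P * (b ^ p + c ^ p) := by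
        have h2 : max b c ^ p ≤ b ^ p + c ^ p := by
          have := Real.rpow_nonneg hb p
          have := Real.rpow_nonneg hc p
          rcases max_cases b c with ⟨h, -⟩ | ⟨h, -⟩ <;> rw [h] <;> linarith
        exact mul_le_mul (Real.rpow_le_rpow_of_exponent_le (by linarith) hpP) h2
          (Real.rpow_nonneg hm p) (by positivity)

variable {S : Set (Rn n)} {p ϑ : Rn n → ℝ} {P : ℝ}

theorem Admissible.aemeasurable_density (h : Admissible S p ϑ P) {f : Rn n → ℝ}
    (hf : AEMeasurable f (volume.restrict S)) :
    AEMeasurable (fun x => |f x| ^ p x * ϑ x) (volume.restrict S) :=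
  ((continuous_abs.measurable.comp_aemeasurable hf).pow h.aemeasurable_exponent).mul
    h.aemeasurable_weight

theorem Admissible.integrableOn_density_iff (h : Admissible S p ϑ P) {f : Rn n → ℝ}
    (hf : AEMeasurable f (volume.restrict S)) :
    IntegrableOn (fun x => |f x| ^ p x * ϑ x) S ↔
      ∫⁻ x in S, ENNReal.ofReal (|f x| ^ p x * ϑ x) < ⊤ := by
  rw [IntegrableOn, Integrable, and_iff_right (h.aemeasurable_density hf).aestronglyMeasurable,
    hasFiniteIntegral_iff_ofReal]
  filter_upwards [h.weight_pos] with x hx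
  exact mul_nonneg (Real.rpow_nonneg (abs_nonneg _) _) hx.le

/-- A bounded exponent makes the dilation `t` in the definition harmless: removing it costs at most
the factor `max 1 t⁻¹ ^ P`. -/
theorem Admissible.memLpVar_iff (h : Admissible S p ϑ P) {f : Rn n → ℝ} :
    MemLpVar S p ϑ f ↔ AEMeasurable f (volume.restrict S) ∧
      IntegrableOn (fun x => |f x| ^ p x * ϑ x) S := by
  constructor
  · rintro ⟨hf, t, ht, hI⟩
    refine ⟨hf, ?_⟩
    have h1 : IntegrableOn (fun x => |t * f x| ^ p x * ϑ x) S :=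
      (h.integrableOn_density_iff (hf.const_mul t)).2 hI
    refine Integrable.mono' (h1.const_mul (max 1 t⁻¹ ^ P))
      (h.aemeasurable_density hf).aestronglyMeasurable ?_
    filter_upwards [h.exponent, h.weight_pos] with x hp hx
    have hf0 : 0 ≤ |f x| ^ p x := Real.rpow_nonneg (abs_nonneg _) _
    rw [Real.norm_of_nonneg (mul_nonneg hf0 hx.le), ← mul_assoc]
    refine mul_le_mul_of_nonneg_right ?_ hx.le
    have e : |f x| ^ p x = t⁻¹ ^ p x * |t * f x| ^ p x := by
      rw [← Real.mul_rpow (by positivity) (abs_nonneg _), abs_mul, abs_of_pos ht, ← mul_assoc,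
        inv_mul_cancel₀ ht.ne', one_mul]
    rw [e]
    refine mul_le_mul_of_nonneg_right ?_ (Real.rpow_nonneg (abs_nonneg _) _)
    calc t⁻¹ ^ p x ≤ (max 1 t⁻¹) ^ p x :=
          Real.rpow_le_rpow (by positivity) (le_max_right _ _) (by linarith)
      _ ≤ _ := Real.rpow_le_rpow_of_exponent_le (le_max_left _ _) hp.2
  · rintro ⟨hf, hI⟩
    refine ⟨hf, 1, one_pos, ?_⟩
    simpa using (h.integrableOn_density_iff hf).1 hI

theorem MemLpVar.mono {T : Set (Rn n)} (hTS : T ⊆ S) {f : Rn n → ℝ} (hf : MemLpVar S p ϑ f) :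
    MemLpVar T p ϑ f := by
  obtain ⟨h1, t, ht, h2⟩ := hf
  exact ⟨h1.mono_set hTS, t, ht, (lintegral_mono_set hTS).trans_lt h2⟩

theorem Admissible.memLpVar_of_le (h : Admissible S p ϑ P) {f f₁ f₂ : Rn n → ℝ} {C : ℝ}
    (hf : AEMeasurable f (volume.restrict S)) (h₁ : MemLpVar S p ϑ f₁) (h₂ : MemLpVar S p ϑ f₂)
    (hle : ∀ᵐ x ∂volume.restrict S, |f x| ≤ C * (|f₁ x| + |f₂ x|)) : MemLpVar S p ϑ f := by
  rw [h.memLpVar_iff] at h₁ h₂ ⊢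
  refine ⟨hf, ?_⟩
  refine Integrable.mono' ((h₁.2.add h₂.2).const_mul ((2 * max 1 C) ^ P))
    (h.aemeasurable_density hf).aestronglyMeasurable ?_
  filter_upwards [h.exponent, h.weight_pos, hle] with x hp hx hl
  have hf0 : 0 ≤ |f x| ^ p x := Real.rpow_nonneg (abs_nonneg _) _
  rw [Real.norm_of_nonneg (mul_nonneg hf0 hx.le)]
  simp only [Pi.add_apply]
  rw [← add_mul, ← mul_assoc]
  refine mul_le_mul_of_nonneg_right ?_ hx.le
  refine rpow_le_of_le_mul_add (abs_nonneg _) (abs_nonneg _) (abs_nonneg _) (le_max_left 1 C)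
    hp.1 hp.2 (hl.trans ?_)
  exact mul_le_mul_of_nonneg_right (le_max_right _ _) (by positivity)

theorem Admissible.memLpVar_of_zero_off (h : Admissible S p ϑ P) {K : Set (Rn n)}
    (hK : MeasurableSet K) (hKS : K ⊆ S) {f : Rn n → ℝ}
    (hfm : AEMeasurable f (volume.restrict S)) (hf : MemLpVar K p ϑ f)
    (h0 : ∀ᵐ x ∂volume.restrict S, x ∉ K → f x = 0) : MemLpVar S p ϑ f := by
  rw [(h.mono hKS).memLpVar_iff] at hf
  rw [h.memLpVar_iff]
  refine ⟨hfm, ?_⟩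
  have h1 : Integrable (K.indicator fun x => |f x| ^ p x * ϑ x) (volume.restrict S) := by
    rw [integrable_indicator_iff hK, IntegrableOn, Measure.restrict_restrict hK,
      inter_eq_left.2 hKS]
    exact hf.2
  refine h1.congr ?_
  filter_upwards [h.exponent, h0] with x hp hx
  by_cases hxK : x ∈ K
  · rw [indicator_of_mem hxK]
  · rw [indicator_of_notMem hxK, hx hxK, abs_zero, Real.zero_rpow (by linarith), zero_mul]

/-- `L^{p(·)}(S, ϑ) ⊆ L¹(S)` when the dual weight is integrable. -/
theorem Admissible.integrableOn_of_memLpVar (h : Admissible S p ϑ P) {f : Rn n → ℝ}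
    (hf : MemLpVar S p ϑ f) (hd : IntegrableOn (fun x => ϑ x ^ (-(1 / (p x - 1)))) S) :
    IntegrableOn f S := by
  rw [h.memLpVar_iff] at hf
  refine Integrable.mono' (hd.add hf.2) hf.1.aestronglyMeasurable ?_
  filter_upwards [h.exponent, h.weight_pos] with x hp hx
  simpa using le_young_dual (abs_nonneg (f x)) one_pos le_rfl hx hp.1 hp.2

theorem MemLpVarLoc.locallyIntegrableOn {Ω : Set (Rn n)} (hΩ : IsOpen Ω)
    (h : Admissible Ω p ϑ P) (hϑ : IsWeight Ω p ϑ) {f : Rn n → ℝ} (hf : MemLpVarLoc Ω p ϑ f) :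
    LocallyIntegrableOn f Ω := by
  rw [locallyIntegrableOn_iff hΩ.isLocallyClosed]
  intro K hK hKc
  exact (h.mono hK).integrableOn_of_memLpVar (hf K hKc hK)
    (hϑ.locallyIntegrable_dual.integrableOn_compact_subset hK hKc)

/-! ### The structure conditions -/

/-- `A` is measurable for the completed σ-algebra in `x`, so the map `x ↦ (x, g x)`, with a Borel
representative of `g`, is taken into that product. The composition is null measurable, hence a.e.
measurable. -/
theorem StructureConditions.aemeasurable_comp {Ω : Set (Rn n)} {A : Rn n → Rn n → Rn n} {μ : ℝ}
    (hA : StructureConditions Ω p ϑ A μ) {g : Rn n → Rn n}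
    (hg : AEMeasurable g (volume.restrict Ω)) :
    AEMeasurable (fun x => A x (g x)) (volume.restrict Ω) := by
  have h1 : NullMeasurable (fun x => A x (hg.mk g x)) (volume.restrict Ω) := by
    have hm : Measurable (fun x : NullMeasurableSpace (Rn n) (volume.restrict Ω) =>
        ((x, hg.mk g x) : NullMeasurableSpace (Rn n) (volume.restrict Ω) × Rn n)) := by
      refine measurable_id.prodMk ?_
      intro s hs
      exact (hg.measurable_mk hs).nullMeasurableSet
    exact fun s hs => (hA.measurable.comp hm) hs
  refine h1.aemeasurable.congr ?_
  filter_upwards [hg.ae_eq_mk] with x hx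
  rw [hx]

theorem StructureConditions.abs_inner_le {Ω : Set (Rn n)} {A : Rn n → Rn n → Rn n} {μ : ℝ}
    (hA : StructureConditions Ω p ϑ A μ) : ∀ᵐ x ∂volume.restrict Ω, ∀ η ξ : Rn n,
      |inner ℝ (A x η) ξ| ≤ μ⁻¹ * (‖η‖ ^ (p x - 1) * ‖ξ‖) * ϑ x := by
  filter_upwards [hA.growth] with x hx η ξ
  refine (abs_real_inner_le_norm _ _).trans ?_
  calc ‖A x η‖ * ‖ξ‖ ≤ (μ⁻¹ * ‖η‖ ^ (p x - 1) * ϑ x) * ‖ξ‖ := by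
        have := hx η
        gcongr
    _ = _ := by ring

/-- Pointwise form of the energy estimate. -/
theorem StructureConditions.pointwise_energy {Ω : Set (Rn n)} {A : Rn n → Rn n → Rn n} {μ : ℝ}
    (hμ : 0 < μ) (hA : StructureConditions Ω p ϑ A μ) (h : Admissible Ω p ϑ P) {N : ℕ}
    (hN : P ≤ N) : ∃ C : ℝ, 0 < C ∧ ∀ᵐ x ∂volume.restrict Ω, ∀ (w v : ℝ) (g d : Rn n),
      0 ≤ w → w ≤ 1 → μ / 2 * (w ^ N * ‖g‖ ^ p x * ϑ x) ≤
        inner ℝ (A x g) (w ^ N • g + v • ((N : ℝ) * w ^ (N - 1)) • d) +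
          C * ((|v| * ‖d‖) ^ p x * ϑ x) := by
  -- Chosen so that `μ⁻¹ (N + 1) κ ≤ μ / 2`: half of the coercive term absorbs the mixed term.
  set κ : ℝ := min 1 (μ * μ / (2 * (N + 1))) with hκ
  have hκ0 : 0 < κ := lt_min one_pos (by positivity)
  have hκ1 : κ ≤ 1 := min_le_left _ _
  refine ⟨(N + 1) * μ⁻¹ * κ ^ (1 - P), by positivity, ?_⟩
  filter_upwards [hA.coercive, hA.abs_inner_le, h.exponent, h.weight_pos] with x hc hg hp hϑ
    w v g d hw hw1
  have hN1 : 1 < (N : ℝ) := by linarith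
  have hN2 : 1 ≤ N := by
    have : (1 : ℝ) ≤ N := hN1.le
    exact_mod_cast this
  set a := ‖g‖
  have ha : 0 ≤ a := norm_nonneg _
  set b := |v| * ‖d‖
  have hb : 0 ≤ b := by positivity
  -- the mixed term
  have hy : w ^ (N - 1) * (a ^ (p x - 1) * b) ≤
      κ * (w ^ N * a ^ p x) + κ ^ (1 - P) * b ^ p x := by
    rcases hw.eq_or_lt with h0 | h0
    · have hN3 : N - 1 ≠ 0 := by
        have : 1 < N := by exact_mod_cast hN1
        omega
      rw [← h0, zero_pow hN3, zero_mul]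
      positivity
    -- Young's inequality is applied to `w a` and `b`. The leftover factor `w^(N-p)` is at most `1`
    -- because `N ≥ P ≥ p` and `w ≤ 1`; this is why a power `N ≥ P` of the cutoff is used.
    · have e1 : w ^ (N - 1) = w ^ ((N : ℝ) - p x) * w ^ (p x - 1) := by
        rw [← Real.rpow_add h0, ← Real.rpow_natCast, Nat.cast_sub hN2]
        congr 1
        push_cast
        ring
      have e2 : w ^ N = w ^ ((N : ℝ) - p x) * w ^ p x := by
        rw [← Real.rpow_add h0, ← Real.rpow_natCast]
        congr 1
        ring
      have hwle : w ^ ((N : ℝ) - p x) ≤ 1 := Real.rpow_le_one hw hw1 (by linarith)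
      have hw0 : 0 ≤ w ^ ((N : ℝ) - p x) := Real.rpow_nonneg hw _
      have hY := rpow_sub_one_mul_le_young (mul_nonneg hw ha) hb hκ0 hκ1 hp.1 hp.2
      rw [Real.mul_rpow hw ha, Real.mul_rpow hw ha] at hY
      rw [e1, e2]
      calc _ = w ^ ((N : ℝ) - p x) * (w ^ (p x - 1) * a ^ (p x - 1) * b) := by ring
        _ ≤ w ^ ((N : ℝ) - p x) * (κ * (w ^ p x * a ^ p x) + κ ^ (1 - P) * b ^ p x) := by gcongr
        _ = κ * (w ^ ((N : ℝ) - p x) * w ^ p x * a ^ p x) +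
            w ^ ((N : ℝ) - p x) * (κ ^ (1 - P) * b ^ p x) := by ring
        _ ≤ _ := by
            exact add_le_add (le_of_eq (by ring)) (mul_le_of_le_one_left (by positivity) hwle)
  rw [inner_add_right, real_inner_smul_right]
  have h1 : μ * (w ^ N * a ^ p x * ϑ x) ≤ w ^ N * inner ℝ (A x g) g := by
    calc _ = w ^ N * (μ * a ^ p x * ϑ x) := by ring
      _ ≤ _ := by
        have := hc g
        gcongr
  have h2 := (abs_le.1 (hg g (v • ((N : ℝ) * w ^ (N - 1)) • d))).1
  have h3 : ‖v • ((N : ℝ) * w ^ (N - 1)) • d‖ = N * w ^ (N - 1) * b := by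
    rw [norm_smul, norm_smul, Real.norm_eq_abs, Real.norm_of_nonneg (by positivity)]
    ring
  rw [h3] at h2
  have h4 : μ⁻¹ * (a ^ (p x - 1) * (N * w ^ (N - 1) * b)) * ϑ x ≤
      μ / 2 * (w ^ N * a ^ p x * ϑ x) + (N + 1) * μ⁻¹ * κ ^ (1 - P) * (b ^ p x * ϑ x) := by
    calc μ⁻¹ * (a ^ (p x - 1) * (N * w ^ (N - 1) * b)) * ϑ x
        = μ⁻¹ * N * (w ^ (N - 1) * (a ^ (p x - 1) * b)) * ϑ x := by ring
      _ ≤ μ⁻¹ * (N + 1) * (κ * (w ^ N * a ^ p x) + κ ^ (1 - P) * b ^ p x) * ϑ x := by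
          gcongr
          linarith
      _ = (μ⁻¹ * (N + 1) * κ) * (w ^ N * a ^ p x * ϑ x) +
          (N + 1) * μ⁻¹ * κ ^ (1 - P) * (b ^ p x * ϑ x) := by ring
      _ ≤ _ := by
          gcongr
          calc μ⁻¹ * (N + 1) * κ ≤ μ⁻¹ * (N + 1) * (μ * μ / (2 * (N + 1))) := by
                gcongr
                exact min_le_right _ _
            _ = μ / 2 := by field_simp
  linarith

end RemovableSing

namespace RemovableSing

variable {n : ℕ} {p ϑ : Rn n → ℝ} {P : ℝ}

/-! ### Test functions -/

theorem HasWeakGrad.ae_eq_zero_off {Ω K : Set (Rn n)} (hΩ : IsOpen Ω) (hK : IsClosed K)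
    {φ : Rn n → ℝ} {d : Rn n → Rn n} (h : HasWeakGrad Ω φ d)
    (h0 : ∀ᵐ x ∂volume.restrict Ω, x ∉ K → φ x = 0) :
    ∀ᵐ x ∂volume.restrict Ω, x ∉ K → d x = 0 := by
  have hO : IsOpen (Ω \ K) := hΩ.sdiff hK
  have := h.ae_eq_zero_of_ae_eq_zero hO sdiff_subset (by
    rw [ae_restrict_iff' hO.measurableSet]
    rw [ae_restrict_iff' hΩ.measurableSet] at h0
    filter_upwards [h0] with x hx hxO
    exact hx hxO.1 hxO.2)
  rw [ae_restrict_iff' hO.measurableSet] at this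
  rw [ae_restrict_iff' hΩ.measurableSet]
  filter_upwards [this] with x hx hxΩ hxK
  exact hx ⟨hxΩ, hxK⟩

/-- A smooth multiple with compact support of a Sobolev function is a Sobolev function. -/
theorem Admissible.memW1p_smooth_mul {Ω U K : Set (Rn n)} (h : Admissible Ω p ϑ P)
    (hΩ : IsOpen Ω) (hUΩ : U ⊆ Ω) {f : Rn n → ℝ} {g : Rn n → Rn n}
    (hfg : HasWeakGrad U f g) (hK : IsCompact K) (hKU : K ⊆ U) (hfK : MemLpVar K p ϑ f)
    (hgK : MemLpVar K p ϑ fun x => ‖g x‖) {ζ : Rn n → ℝ} (hζ : ContDiff ℝ ∞ ζ)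
    (hs : tsupport ζ ∩ Ω ⊆ U) (h0 : ∀ᵐ x ∂volume.restrict Ω, x ∉ K → ζ x * f x = 0) :
    MemW1p Ω p ϑ (fun x => ζ x * f x) ∧ weakGrad Ω (fun x => ζ x * f x) =ᵐ[volume.restrict Ω]
      fun x => ζ x • g x + f x • gradient ζ x := by
  have hw := hfg.smooth_mul hΩ hUΩ hζ hs
  have hae := hw.weakGrad_ae_eq hΩ
  have hKΩ := hKU.trans hUΩ
  obtain ⟨C1, hC1⟩ := hK.exists_bound_of_continuousOn hζ.continuous.continuousOn
  obtain ⟨C2, hC2⟩ := hK.exists_bound_of_continuousOn (continuous_gradient hζ).continuousOn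
  have m1 : AEMeasurable (fun x => ζ x * f x) (volume.restrict Ω) :=
    hw.locallyIntegrable.aestronglyMeasurable.aemeasurable
  have m2 : AEMeasurable (weakGrad Ω fun x => ζ x * f x) (volume.restrict Ω) :=
    (hasWeakGrad_weakGrad ⟨_, hw⟩).locallyIntegrable_grad.aestronglyMeasurable.aemeasurable
  refine ⟨⟨?_, ⟨_, hw⟩, ?_⟩, hae⟩
  · refine h.memLpVar_of_zero_off hK.measurableSet hKΩ m1 ?_ h0
    refine (h.mono hKΩ).memLpVar_of_le (C := C1) (m1.mono_set hKΩ) hfK hfK ?_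
    refine ae_restrict_of_forall_mem hK.measurableSet fun x hx => ?_
    rw [abs_mul]
    have h1 : |ζ x| ≤ C1 := hC1 x hx
    have h2 : 0 ≤ C1 := (abs_nonneg _).trans h1
    have := abs_nonneg (f x)
    nlinarith
  · refine h.memLpVar_of_zero_off hK.measurableSet hKΩ m2.norm ?_ ?_
    · refine (h.mono hKΩ).memLpVar_of_le (C := max C1 C2) (m2.norm.mono_set hKΩ) hgK hfK ?_
      filter_upwards [ae_restrict_of_ae_restrict_of_subset hKΩ hae,
        ae_restrict_mem hK.measurableSet] with x hx hxK
      rw [hx, abs_norm, abs_norm]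
      refine (norm_add_le _ _).trans ?_
      rw [norm_smul, norm_smul]
      have h1 := (hC1 x hxK).trans (le_max_left C1 C2)
      have h2 := (hC2 x hxK).trans (le_max_right C1 C2)
      have h3 := norm_nonneg (g x)
      have h4 := norm_nonneg (f x)
      rw [← Real.norm_eq_abs]
      nlinarith
    · filter_upwards [(hasWeakGrad_weakGrad ⟨_, hw⟩).ae_eq_zero_off hΩ hK.isClosed h0] with x hx hxK
      rw [hx hxK, norm_zero]

theorem gradient_pow {w : Rn n → ℝ} (hw : ContDiff ℝ ∞ w) (N : ℕ) (x : Rn n) :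
    gradient (fun x => w x ^ N) x = ((N : ℝ) * w x ^ (N - 1)) • gradient w x := by
  have : fderiv ℝ (fun x => w x ^ N) x = ((N : ℝ) * w x ^ (N - 1)) • fderiv ℝ w x := by
    have h1 := (hw.differentiable (by simp) x).hasFDerivAt.pow N
    have h2 := h1.fderiv
    rw [h2]
    simp
  simp [gradient, this]

/-- The energy (Caccioppoli) estimate for sub-solutions. -/
theorem energy_estimate {Ω U : Set (Rn n)} (hΩ : IsOpen Ω) (hUΩ : U ⊆ Ω)
    (hR : volume.restrict U = volume.restrict Ω) (h : Admissible Ω p ϑ P)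
    {A : Rn n → Rn n → Rn n} {μ : ℝ} (hμ : 0 < μ) (hA : StructureConditions Ω p ϑ A μ)
    {u : Rn n → EReal} (hu : MemW1pLoc U p ϑ u) (hu0 : ∀ᵐ x ∂volume.restrict Ω, 0 ≤ u x)
    (hsub : SubsolutionIneq Ω U p ϑ A u) {N : ℕ} (hN : P ≤ N) :
    ∃ C : ℝ, 0 < C ∧ ∀ w : Rn n → ℝ, ContDiff ℝ ∞ w → HasCompactSupport w → tsupport w ⊆ U →
      (∀ x, w x ∈ Icc (0 : ℝ) 1) →
      ∫⁻ x in Ω, ENNReal.ofReal (w x ^ N * ‖weakGrad U (fun y => (u y).toReal) x‖ ^ p x * ϑ x) ≤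
        ENNReal.ofReal C * ∫⁻ x in Ω,
          ENNReal.ofReal ((|(u x).toReal| * ‖fderiv ℝ w x‖) ^ p x * ϑ x) := by
  obtain ⟨C, hC, hpt⟩ := hA.pointwise_energy hμ h hN
  obtain ⟨-, hvloc, hvg, hgloc⟩ := hu
  set v : Rn n → ℝ := fun y => (u y).toReal with hv
  set g := weakGrad U v with hg
  refine ⟨2 / μ * C, by positivity, fun w hw hwc hwU hwI => ?_⟩
  by_cases htop : ∫⁻ x in Ω, ENNReal.ofReal ((|v x| * ‖fderiv ℝ w x‖) ^ p x * ϑ x) = ⊤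
  · rw [htop, ENNReal.mul_top (by simpa using by positivity)]
    exact le_top
  have hgw := hasWeakGrad_weakGrad hvg
  have hvm : AEMeasurable v (volume.restrict Ω) := by
    rw [← hR]
    exact hgw.locallyIntegrable.aestronglyMeasurable.aemeasurable
  -- Unless `Ω` is null, `N ≥ P > 1`, so `w ^ N` vanishes where `w` does.
  have hNpos : N ≠ 0 ∨ volume.restrict Ω = 0 := by
    by_cases hz : volume.restrict Ω = 0
    · exact Or.inr hz
    · left
      rintro rfl
      have : (MeasureTheory.ae (volume.restrict Ω)).NeBot := ae_neBot.2 hz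
      obtain ⟨x, hx⟩ := h.exponent.exists
      have : P ≤ 0 := by simpa using hN
      linarith [hx.1, hx.2]
  rcases hNpos with hNpos | hz
  swap
  · simp [hz]
  have hζ : ContDiff ℝ ∞ fun x => w x ^ N := hw.pow N
  have hζs : tsupport (fun x => w x ^ N) ⊆ tsupport w := by
    refine closure_mono fun x hx hx0 => hx ?_
    simp only [hx0]
    exact zero_pow hNpos
  obtain ⟨hφ, hφg⟩ := h.memW1p_smooth_mul hΩ hUΩ hgw hwc hwU (hvloc _ hwc hwU)
    (hgloc _ hwc hwU) hζ (inter_subset_left.trans (hζs.trans hwU))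
    (Filter.Eventually.of_forall fun x hx => by
      rw [image_eq_zero_of_notMem_tsupport fun hh => hx (hζs hh), zero_mul])
  obtain ⟨hI, hle⟩ := hsub _ hφ (by
      filter_upwards [hu0] with x hx
      exact mul_nonneg (pow_nonneg (hwI x).1 _) (EReal.toReal_nonneg hx))
    ⟨tsupport w, hwc, hwU, Filter.Eventually.of_forall fun x hx => by
      rw [image_eq_zero_of_notMem_tsupport fun hh => hx (hζs hh), zero_mul]⟩
  rw [IntegrableOn, hR] at hI
  rw [hR] at hle
  set X : Rn n → ℝ := fun x => inner ℝ (A x (g x)) (weakGrad Ω (fun x => w x ^ N * v x) x)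
  set H : Rn n → ℝ := fun x => (|v x| * ‖fderiv ℝ w x‖) ^ p x * ϑ x with hH
  have hHm : AEMeasurable H (volume.restrict Ω) :=
    (((continuous_abs.measurable.comp_aemeasurable hvm).mul
      (hw.continuous_fderiv (by simp)).norm.measurable.aemeasurable).pow
      h.aemeasurable_exponent).mul h.aemeasurable_weight
  have hH0 : 0 ≤ᵐ[volume.restrict Ω] H := by
    filter_upwards [h.weight_pos] with x hx
    exact mul_nonneg (Real.rpow_nonneg (by positivity) _) hx.le
  have hHi : Integrable H (volume.restrict Ω) := by
    refine ⟨hHm.aestronglyMeasurable, ?_⟩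
    rw [hasFiniteIntegral_iff_ofReal hH0]
    exact lt_top_iff_ne_top.2 htop
  have hae : ∀ᵐ x ∂volume.restrict Ω,
      w x ^ N * ‖g x‖ ^ p x * ϑ x ≤ 2 / μ * (X x + C * H x) := by
    filter_upwards [hpt, hφg] with x hx hx2
    have h1 := hx (w x) (v x) (g x) (gradient w x) (hwI x).1 (hwI x).2
    rw [← gradient_pow hw, ← hx2, norm_gradient_eq] at h1
    have h2 : 0 < 2 / μ := by positivity
    calc w x ^ N * ‖g x‖ ^ p x * ϑ x = 2 / μ * (μ / 2 * (w x ^ N * ‖g x‖ ^ p x * ϑ x)) := by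
          field_simp
      _ ≤ _ := mul_le_mul_of_nonneg_left h1 h2.le
  have hS : Integrable (fun x => 2 / μ * (X x + C * H x)) (volume.restrict Ω) :=
    (hI.add (hHi.const_mul C)).const_mul _
  -- `X` itself has no sign, but the sum dominates a nonnegative quantity, which permits the passage
  -- between the two integrals.
  have hS0 : 0 ≤ᵐ[volume.restrict Ω] fun x => 2 / μ * (X x + C * H x) := by
    filter_upwards [hae, h.weight_pos] with x hx hϑ
    refine le_trans ?_ hx
    have := (hwI x).1
    positivity
  calc _ ≤ ∫⁻ x in Ω, ENNReal.ofReal (2 / μ * (X x + C * H x)) := by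
        refine lintegral_mono_ae ?_
        filter_upwards [hae] with x hx
        exact ENNReal.ofReal_le_ofReal hx
    _ = ENNReal.ofReal (∫ x in Ω, 2 / μ * (X x + C * H x)) :=
        (ofReal_integral_eq_lintegral_ofReal hS hS0).symm
    _ ≤ ENNReal.ofReal (2 / μ * C * ∫ x in Ω, H x) := by
        refine ENNReal.ofReal_le_ofReal ?_
        rw [integral_const_mul, integral_add hI (hHi.const_mul C), integral_const_mul]
        have h2 : 0 < 2 / μ := by positivity
        nlinarith
    _ = _ := by
        rw [ENNReal.ofReal_mul (by positivity), ofReal_integral_eq_lintegral_ofReal hHi hH0]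

/-! ### Cutoff sequences and integrability of the gradient across `E`. -/

/-- Smooth functions vanishing near `E`, tending to `1` off `E`, with gradients of vanishing
weighted energy. -/
structure IsCutoffSeq (Ω E : Set (Rn n)) (p ϑ v : Rn n → ℝ) (η : ℕ → Rn n → ℝ) : Prop where
  contDiff : ∀ k, ContDiff ℝ ∞ (η k)
  mem_Icc : ∀ k x, η k x ∈ Icc (0 : ℝ) 1
  disjoint : ∀ k, ∀ x ∈ E, x ∉ tsupport (η k)
  eventually_eq_one : ∀ x, x ∉ E → ∀ᶠ k in Filter.atTop, η k x = 1
  energy : ∀ k, ∫⁻ x in Ω, ENNReal.ofReal ((|v x| * ‖fderiv ℝ (η k) x‖) ^ p x * ϑ x) ≤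
    ENNReal.ofReal (1 / (k + 1))
  energy_one : ∀ k, ∫⁻ x in Ω, ENNReal.ofReal (‖fderiv ℝ (η k) x‖ ^ p x * ϑ x) ≤
    ENNReal.ofReal (1 / (k + 1))

/-- Take `δ = 1 / (k + 1)`. Vanishing on an open neighbourhood of `E` keeps the closed support away
from `E`, and a point off the closed set `E` eventually leaves the shrinking thickenings. -/
theorem exists_isCutoffSeq {Ω E : Set (Rn n)} (hE : IsClosed E) {v : Rn n → ℝ}
    (h : ∀ δ : ℝ, 0 < δ → ∃ η : Rn n → ℝ, ContDiff ℝ ∞ η ∧ (∀ x, η x ∈ Icc (0 : ℝ) 1) ∧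
      (∃ V, IsOpen V ∧ E ⊆ V ∧ ∀ x ∈ V, η x = 0) ∧
      (∀ x, x ∉ Metric.thickening δ E → η x = 1) ∧
      ∫⁻ x in Ω, ENNReal.ofReal ((|v x| * ‖fderiv ℝ η x‖) ^ p x * ϑ x) ≤ ENNReal.ofReal δ ∧
      ∫⁻ x in Ω, ENNReal.ofReal (‖fderiv ℝ η x‖ ^ p x * ϑ x) ≤ ENNReal.ofReal δ) :
    ∃ η, IsCutoffSeq Ω E p ϑ v η := by
  have hpos : ∀ k : ℕ, (0 : ℝ) < 1 / (k + 1) := fun k => by positivity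
  choose η h1 h2 h3 h4 h5 h6 using fun k : ℕ => h (1 / (k + 1)) (hpos k)
  refine ⟨η, h1, h2, ?_, ?_, h5, h6⟩
  · intro k x hx hx'
    obtain ⟨V, hV, hEV, hV0⟩ := h3 k
    have : V ∩ Function.support (η k) = ∅ := by
      ext y
      simp only [mem_inter_iff, Function.mem_support, mem_empty_iff_false, iff_false, not_and,
        not_not]
      exact hV0 y
    have hne := mem_closure_iff.1 hx' V hV (hEV hx)
    rw [this] at hne
    exact not_nonempty_empty hne
  · intro x hx
    obtain ⟨r, hr, hball⟩ := Metric.isOpen_iff.1 hE.isOpen_compl x hx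
    have := (tendsto_order.1 (tendsto_one_div_add_atTop_nhds_zero_nat (𝕜 := ℝ))).2 r hr
    filter_upwards [this] with k hk
    refine h4 k x fun hmem => ?_
    obtain ⟨z, hz, hd⟩ := Metric.mem_thickening_iff.1 hmem
    refine hball (a := z) ?_ hz
    rw [Metric.mem_ball, dist_comm]
    exact hd.trans hk

theorem norm_fderiv_mul_le {ζ η : Rn n → ℝ} (hζ : ContDiff ℝ ∞ ζ) (hη : ContDiff ℝ ∞ η)
    (hζI : ∀ x, ζ x ∈ Icc (0 : ℝ) 1) (hηI : ∀ x, η x ∈ Icc (0 : ℝ) 1) (x : Rn n) :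
    ‖fderiv ℝ (fun x => ζ x * η x) x‖ ≤ ‖fderiv ℝ ζ x‖ + ‖fderiv ℝ η x‖ := by
  rw [fderiv_fun_mul (hζ.differentiable (by simp) x) (hη.differentiable (by simp) x)]
  refine (norm_add_le _ _).trans ?_
  rw [norm_smul, norm_smul, add_comm]
  refine add_le_add ?_ ?_
  · refine mul_le_of_le_one_left (norm_nonneg _) ?_
    rw [Real.norm_of_nonneg (hηI x).1]
    exact (hηI x).2
  · refine mul_le_of_le_one_left (norm_nonneg _) ?_
    rw [Real.norm_of_nonneg (hζI x).1]
    exact (hζI x).2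

theorem restrict_diff_of_null (Ω : Set (Rn n)) {E : Set (Rn n)} (hE0 : volume E = 0) :
    (volume : Measure (Rn n)).restrict (Ω \ E) = volume.restrict Ω :=
  Measure.restrict_congr_set (sdiff_null_ae_eq_self hE0)

open Filter in
/-- The gradient of the sub-solution is locally `p(·)`-integrable across the singular set. -/
theorem memLpVarLoc_norm_weakGrad {Ω E : Set (Rn n)} (hΩ : IsOpen Ω)
    (hE0 : volume E = 0) (h : Admissible Ω p ϑ P)
    {A : Rn n → Rn n → Rn n} {μ : ℝ} (hμ : 0 < μ) (hA : StructureConditions Ω p ϑ A μ)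
    {u : Rn n → EReal} (hu : MemW1pLoc (Ω \ E) p ϑ u)
    (hu0 : ∀ᵐ x ∂volume.restrict Ω, 0 ≤ u x) (hsub : SubsolutionIneq Ω (Ω \ E) p ϑ A u)
    (hv : MemLpVarLoc Ω p ϑ fun x => (u x).toReal) {η : ℕ → Rn n → ℝ}
    (hη : IsCutoffSeq Ω E p ϑ (fun x => (u x).toReal) η) :
    MemLpVarLoc Ω p ϑ fun x => ‖weakGrad (Ω \ E) (fun y => (u y).toReal) x‖ := by
  intro K hK hKΩ
  have hR := restrict_diff_of_null Ω hE0
  obtain ⟨N, hN⟩ := exists_nat_ge P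
  obtain ⟨C, hC, hen⟩ := energy_estimate hΩ sdiff_subset hR h hμ hA hu hu0 hsub hN
  set v : Rn n → ℝ := fun y => (u y).toReal
  set g := weakGrad (Ω \ E) v
  have hvm : AEMeasurable v (volume.restrict Ω) := by
    rw [← hR]
    exact (hasWeakGrad_weakGrad hu.2.2.1).locallyIntegrable.aestronglyMeasurable.aemeasurable
  have hgm : AEMeasurable g (volume.restrict Ω) := by
    rw [← hR]
    exact (hasWeakGrad_weakGrad hu.2.2.1).locallyIntegrable_grad.aestronglyMeasurable.aemeasurable
  obtain ⟨ζ, hζ, hζc, hζΩ, hζI, V, -, hKV, hV1⟩ := exists_smooth_cutoff hK hΩ hKΩ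
  set w : ℕ → Rn n → ℝ := fun k x => ζ x * η k x
  -- the energy of the fixed cutoff is finite
  have hfin : ∫⁻ x in Ω, ENNReal.ofReal ((|v x| * ‖fderiv ℝ ζ x‖) ^ p x * ϑ x) < ⊤ := by
    have hcf : Continuous fun x => ‖fderiv ℝ ζ x‖ := (hζ.continuous_fderiv (by simp)).norm
    have hm : AEMeasurable (fun x => v x * ‖fderiv ℝ ζ x‖) (volume.restrict Ω) :=
      hvm.mul hcf.measurable.aemeasurable
    have : MemLpVar Ω p ϑ fun x => v x * ‖fderiv ℝ ζ x‖ := by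
      refine h.memLpVar_of_zero_off hζc.measurableSet hζΩ hm ?_ ?_
      · obtain ⟨B, hB⟩ := IsCompact.exists_bound_of_continuousOn hζc hcf.continuousOn
        refine (h.mono hζΩ).memLpVar_of_le (C := B) (hm.mono_set hζΩ) (hv _ hζc hζΩ)
          (hv _ hζc hζΩ) ?_
        refine ae_restrict_of_forall_mem hζc.measurableSet fun x hx => ?_
        have h1 : |‖fderiv ℝ ζ x‖| ≤ B := hB x hx
        have h2 : 0 ≤ B := (abs_nonneg _).trans h1
        have h3 := abs_nonneg (v x)
        rw [abs_mul]
        nlinarith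
      · refine Eventually.of_forall fun x hx => ?_
        rw [← norm_gradient_eq, gradient_eq_zero_of_notMem_tsupport hx]
        simp
    rw [h.memLpVar_iff] at this
    have := (h.integrableOn_density_iff this.1).1 this.2
    refine lt_of_le_of_lt (le_of_eq ?_) this
    congr 1
    ext x
    rw [abs_mul, abs_norm]
  have hbound : ∀ k, ∫⁻ x in Ω, ENNReal.ofReal ((|v x| * ‖fderiv ℝ (w k) x‖) ^ p x * ϑ x) ≤
      ENNReal.ofReal ((2 * 1) ^ P) *
        ((∫⁻ x in Ω, ENNReal.ofReal ((|v x| * ‖fderiv ℝ ζ x‖) ^ p x * ϑ x)) + 1) := by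
    intro k
    have hm : AEMeasurable (fun x => ENNReal.ofReal ((|v x| * ‖fderiv ℝ ζ x‖) ^ p x * ϑ x))
        (volume.restrict Ω) := by
      exact ((((continuous_abs.measurable.comp_aemeasurable hvm).mul
        (hζ.continuous_fderiv (by simp)).norm.measurable.aemeasurable).pow
        h.aemeasurable_exponent).mul h.aemeasurable_weight).ennreal_ofReal
    calc _ ≤ ∫⁻ x in Ω, ENNReal.ofReal ((2 * 1) ^ P) *
          (ENNReal.ofReal ((|v x| * ‖fderiv ℝ ζ x‖) ^ p x * ϑ x) +
            ENNReal.ofReal ((|v x| * ‖fderiv ℝ (η k) x‖) ^ p x * ϑ x)) := by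
          refine lintegral_mono_ae ?_
          filter_upwards [h.exponent, h.weight_pos] with x hp hx
          have a1 : 0 ≤ (|v x| * ‖fderiv ℝ ζ x‖) ^ p x := by positivity
          have a2 : 0 ≤ (|v x| * ‖fderiv ℝ (η k) x‖) ^ p x := by positivity
          rw [← ENNReal.ofReal_add (by positivity) (by positivity),
            ← ENNReal.ofReal_mul (by positivity), ← add_mul, ← mul_assoc]
          refine ENNReal.ofReal_le_ofReal (mul_le_mul_of_nonneg_right ?_ hx.le)
          refine rpow_le_of_le_mul_add (by positivity) (by positivity) (by positivity) le_rfl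
            hp.1 hp.2 ?_
          rw [one_mul, ← mul_add]
          exact mul_le_mul_of_nonneg_left
            (norm_fderiv_mul_le hζ (hη.contDiff k) hζI (hη.mem_Icc k) x) (abs_nonneg _)
      _ = ENNReal.ofReal ((2 * 1) ^ P) *
          ((∫⁻ x in Ω, ENNReal.ofReal ((|v x| * ‖fderiv ℝ ζ x‖) ^ p x * ϑ x)) +
            ∫⁻ x in Ω, ENNReal.ofReal ((|v x| * ‖fderiv ℝ (η k) x‖) ^ p x * ϑ x)) := by
          rw [lintegral_const_mul' _ _ ENNReal.ofReal_ne_top, lintegral_add_left' hm]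
      _ ≤ _ := by
          refine mul_le_mul_right (add_le_add le_rfl ((hη.energy k).trans ?_)) _
          rw [ENNReal.ofReal_le_one, div_le_one (by positivity)]
          have : (0 : ℝ) ≤ k := Nat.cast_nonneg k
          linarith
  set Q := ENNReal.ofReal C * (ENNReal.ofReal ((2 * 1) ^ P) *
        ((∫⁻ x in Ω, ENNReal.ofReal ((|v x| * ‖fderiv ℝ ζ x‖) ^ p x * ϑ x)) + 1)) with hQ
  have hQt : Q < ⊤ := by
    refine ENNReal.mul_lt_top ENNReal.ofReal_lt_top (ENNReal.mul_lt_top ENNReal.ofReal_lt_top ?_)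
    exact ENNReal.add_lt_top.2 ⟨hfin, ENNReal.one_lt_top⟩
  have hw : ∀ k, ∫⁻ x in Ω, ENNReal.ofReal (w k x ^ N * ‖g x‖ ^ p x * ϑ x) ≤ Q := by
    intro k
    have hs1 : tsupport (w k) ⊆ tsupport ζ :=
      closure_mono fun x hx hx0 => hx (by simp only [w, hx0, zero_mul])
    have hs2 : tsupport (w k) ⊆ tsupport (η k) :=
      closure_mono fun x hx hx0 => hx (by simp only [w, hx0, mul_zero])
    refine (hen (w k) (hζ.mul (hη.contDiff k)) (hζc.of_isClosed_subset (isClosed_tsupport _) hs1)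
      (fun x hx => ⟨hζΩ (hs1 hx), fun hxE => hη.disjoint k x hxE (hs2 hx)⟩) fun x =>
        ⟨mul_nonneg (hζI x).1 (hη.mem_Icc k x).1,
          mul_le_one₀ (hζI x).2 (hη.mem_Icc k x).1 (hη.mem_Icc k x).2⟩).trans ?_
    exact mul_le_mul_right (hbound k) _
  have hmk : ∀ k, AEMeasurable (fun x => ENNReal.ofReal (w k x ^ N * ‖g x‖ ^ p x * ϑ x))
      (volume.restrict K) := by
    intro k
    have hwm : Measurable (w k) := (hζ.continuous.mul (hη.contDiff k).continuous).measurable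
    refine AEMeasurable.mono_set hKΩ (AEMeasurable.ennreal_ofReal ?_)
    exact ((hwm.pow_const N).aemeasurable.mul (hgm.norm.pow h.aemeasurable_exponent)).mul
      h.aemeasurable_weight
  have hnotE : ∀ᵐ x ∂volume.restrict K, x ∉ E := by
    exact ae_restrict_of_ae (measure_eq_zero_iff_ae_notMem.1 hE0)
  refine (h.mono hKΩ).memLpVar_iff.2 ⟨hgm.norm.mono_set hKΩ, ?_⟩
  refine ((h.mono hKΩ).integrableOn_density_iff (hgm.norm.mono_set hKΩ)).2 ?_
  -- Fatou's lemma: `w k x` is eventually `1` for every `x ∈ K \ E`, and `E` is null.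
  calc ∫⁻ x in K, ENNReal.ofReal (|‖g x‖| ^ p x * ϑ x)
      ≤ ∫⁻ x in K, liminf (fun k => ENNReal.ofReal (w k x ^ N * ‖g x‖ ^ p x * ϑ x)) atTop := by
        refine lintegral_mono_ae ?_
        filter_upwards [hnotE, ae_restrict_mem hK.measurableSet] with x hx hxK
        refine le_of_eq (Tendsto.liminf_eq ?_).symm
        refine tendsto_const_nhds.congr' ?_
        filter_upwards [hη.eventually_eq_one x hx] with k hk
        simp [w, hk, hV1 x (hKV hxK)]
    _ ≤ liminf (fun k => ∫⁻ x in K, ENNReal.ofReal (w k x ^ N * ‖g x‖ ^ p x * ϑ x)) atTop :=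
        lintegral_liminf_le' hmk
    _ ≤ Q := by
        refine liminf_le_of_le ⟨0, by simp⟩ fun b hb => ?_
        obtain ⟨k, hk⟩ := hb.exists
        exact hk.trans ((lintegral_mono_set hKΩ).trans (hw k))
    _ < ⊤ := hQt

end RemovableSing

namespace RemovableSing

variable {n : ℕ} {p ϑ : Rn n → ℝ} {P : ℝ}

/-! ### Passing to the limit along the cutoffs -/

open Filter in
-- Fix `κ` first, making the term with `D` small; then `B κ` is a constant and `k` can be sent to
-- infinity.
theorem tendsto_zero_of_le_young {a : ℕ → ℝ≥0∞} {D : ℝ≥0∞} (hD : D ≠ ⊤) {B : ℝ → ℝ}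
    (h : ∀ κ : ℝ, 0 < κ → κ ≤ 1 → ∀ k : ℕ,
      a k ≤ ENNReal.ofReal κ * D + ENNReal.ofReal (B κ) * ENNReal.ofReal (1 / (k + 1))) :
    Tendsto a atTop (𝓝 0) := by
  rw [ENNReal.tendsto_nhds_zero]
  intro ε hε
  have hε2 : 0 < ε / 2 := ENNReal.half_pos hε.ne'
  have t1 : Tendsto (fun κ : ℝ => ENNReal.ofReal κ * D) (𝓝[>] 0) (𝓝 0) := by
    have h0 : Tendsto (fun κ : ℝ => ENNReal.ofReal κ) (𝓝[>] 0) (𝓝 0) := by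
      have := (ENNReal.continuous_ofReal.tendsto 0).mono_left (nhdsWithin_le_nhds (s := Ioi 0))
      simpa using this
    simpa using ENNReal.Tendsto.mul_const h0 (Or.inr hD)
  have e1 := (ENNReal.tendsto_nhds_zero.1 t1) _ hε2
  have e2 : ∀ᶠ κ : ℝ in 𝓝[>] 0, κ ∈ Ioc (0 : ℝ) 1 := Ioc_mem_nhdsGT one_pos
  obtain ⟨κ, h1, h2, h3⟩ := (e1.and e2).exists
  have t2 : Tendsto (fun k : ℕ => ENNReal.ofReal (B κ) * ENNReal.ofReal (1 / (k + 1))) atTop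
      (𝓝 0) := by
    have h0 := (ENNReal.continuous_ofReal.tendsto 0).comp
      (tendsto_one_div_add_atTop_nhds_zero_nat (𝕜 := ℝ))
    rw [ENNReal.ofReal_zero] at h0
    simpa using ENNReal.Tendsto.const_mul h0 (Or.inr ENNReal.ofReal_ne_top)
  filter_upwards [(ENNReal.tendsto_nhds_zero.1 t2) _ hε2] with k hk
  calc a k ≤ _ := h κ h2 h3 k
    _ ≤ ε / 2 + ε / 2 := add_le_add h1 hk
    _ = ε := ENNReal.add_halves ε

open Filter in
theorem tendsto_integral_zero_of_le {Ω K : Set (Rn n)} (hK : MeasurableSet K) (hKΩ : K ⊆ Ω)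
    {F f : ℕ → Rn n → ℝ} {C : ℝ}
    (h : ∀ k, ∀ᵐ x ∂volume.restrict Ω, (x ∈ K → |F k x| ≤ C * f k x) ∧ (x ∉ K → F k x = 0))
    (hC : 0 ≤ C) (hf : Tendsto (fun k => ∫⁻ x in K, ENNReal.ofReal (f k x)) atTop (𝓝 0)) :
    Tendsto (fun k => ∫ x in Ω, F k x) atTop (𝓝 0) := by
  have h1 : ∀ k, ∫⁻ x in Ω, ENNReal.ofReal ‖F k x‖ ≤
      ENNReal.ofReal C * ∫⁻ x in K, ENNReal.ofReal (f k x) := by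
    intro k
    have e : ∫⁻ x in K, ENNReal.ofReal (f k x) =
        ∫⁻ x in Ω, K.indicator (fun x => ENNReal.ofReal (f k x)) x := by
      rw [lintegral_indicator hK, Measure.restrict_restrict hK, inter_eq_left.2 hKΩ]
    rw [e, ← lintegral_const_mul' _ _ ENNReal.ofReal_ne_top]
    refine lintegral_mono_ae ?_
    filter_upwards [h k] with x hx
    by_cases hxK : x ∈ K
    · rw [indicator_of_mem hxK, ← ENNReal.ofReal_mul hC]
      exact ENNReal.ofReal_le_ofReal (hx.1 hxK)
    · rw [hx.2 hxK]
      simp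
  have h2 : Tendsto (fun k => ∫⁻ x in Ω, ENNReal.ofReal ‖F k x‖) atTop (𝓝 0) := by
    have := ENNReal.Tendsto.const_mul hf (Or.inr (ENNReal.ofReal_ne_top (r := C)))
    rw [mul_zero] at this
    exact tendsto_of_tendsto_of_tendsto_of_le_of_le tendsto_const_nhds this
      (fun _ => zero_le) h1
  have h3 := (ENNReal.tendsto_toReal ENNReal.zero_ne_top).comp h2
  rw [ENNReal.toReal_zero] at h3
  exact squeeze_zero_norm (fun k => norm_integral_le_lintegral_norm _) h3

open Filter in
theorem IsCutoffSeq.tendsto_integral_mul {Ω E : Set (Rn n)} {v : Rn n → ℝ}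
    {η : ℕ → Rn n → ℝ} (hη : IsCutoffSeq Ω E p ϑ v η) (hE0 : volume E = 0) {f : Rn n → ℝ}
    (hf : IntegrableOn f Ω) :
    Tendsto (fun k => ∫ x in Ω, η k x * f x) atTop (𝓝 (∫ x in Ω, f x)) := by
  refine tendsto_integral_of_dominated_convergence (fun x => ‖f x‖)
    (fun k => (hη.contDiff k).continuous.aestronglyMeasurable.mul hf.aestronglyMeasurable)
    hf.norm ?_ ?_
  · intro k
    refine Eventually.of_forall fun x => ?_
    rw [norm_mul, Real.norm_of_nonneg (hη.mem_Icc k x).1]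
    exact mul_le_of_le_one_left (norm_nonneg _) (hη.mem_Icc k x).2
  · filter_upwards [ae_restrict_of_ae (measure_eq_zero_iff_ae_notMem.1 hE0)] with x hx
    refine tendsto_const_nhds.congr' ?_
    filter_upwards [hη.eventually_eq_one x hx] with k hk
    rw [hk, one_mul]

open Filter in
-- The weak gradient identity is unweighted, while the energy is weighted. `le_young_dual` bridges
-- the two at the cost of a small multiple of the locally integrable dual weight.
theorem IsCutoffSeq.tendsto_lintegral_gradient {Ω E K : Set (Rn n)} {v : Rn n → ℝ}
    {η : ℕ → Rn n → ℝ} (hη : IsCutoffSeq Ω E p ϑ v η) (h : Admissible Ω p ϑ P)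
    (hϑ : IsWeight Ω p ϑ) (hK : IsCompact K) (hKΩ : K ⊆ Ω) :
    Tendsto (fun k => ∫⁻ x in K, ENNReal.ofReal (|v x| * ‖fderiv ℝ (η k) x‖)) atTop (𝓝 0) := by
  have hd := hϑ.locallyIntegrable_dual.integrableOn_compact_subset hKΩ hK
  have hdm : AEMeasurable (fun x => ENNReal.ofReal (ϑ x ^ (-(1 / (p x - 1)))))
      (volume.restrict K) := hd.aestronglyMeasurable.aemeasurable.ennreal_ofReal
  have hK' := h.mono hKΩ
  refine tendsto_zero_of_le_young (B := fun κ => κ ^ (1 - P))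
    (D := ∫⁻ x in K, ENNReal.ofReal (ϑ x ^ (-(1 / (p x - 1))))) ?_ ?_
  · have : 0 ≤ᵐ[volume.restrict K] fun x => ϑ x ^ (-(1 / (p x - 1))) := by
      filter_upwards [hK'.weight_pos] with x hx
      exact Real.rpow_nonneg hx.le _
    exact ((hasFiniteIntegral_iff_ofReal this).1 hd.2).ne
  · intro κ hκ hκ1 k
    calc _ ≤ ∫⁻ x in K, (ENNReal.ofReal κ * ENNReal.ofReal (ϑ x ^ (-(1 / (p x - 1)))) +
          ENNReal.ofReal (κ ^ (1 - P)) *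
            ENNReal.ofReal ((|v x| * ‖fderiv ℝ (η k) x‖) ^ p x * ϑ x)) := by
          refine lintegral_mono_ae ?_
          filter_upwards [hK'.exponent, hK'.weight_pos] with x hp hx
          have a1 : 0 ≤ (|v x| * ‖fderiv ℝ (η k) x‖) ^ p x := by positivity
          rw [← ENNReal.ofReal_mul hκ.le, ← ENNReal.ofReal_mul (by positivity),
            ← ENNReal.ofReal_add (by positivity) (by positivity)]
          exact ENNReal.ofReal_le_ofReal
            (le_young_dual (by positivity) hκ hκ1 hx hp.1 hp.2)
      _ = ENNReal.ofReal κ * (∫⁻ x in K, ENNReal.ofReal (ϑ x ^ (-(1 / (p x - 1))))) +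
          ENNReal.ofReal (κ ^ (1 - P)) *
            ∫⁻ x in K, ENNReal.ofReal ((|v x| * ‖fderiv ℝ (η k) x‖) ^ p x * ϑ x) := by
          rw [lintegral_add_left' (hdm.const_mul _),
            lintegral_const_mul' _ _ ENNReal.ofReal_ne_top,
            lintegral_const_mul' _ _ ENNReal.ofReal_ne_top]
      _ ≤ _ := add_le_add le_rfl
          (mul_le_mul_right ((lintegral_mono_set hKΩ).trans (hη.energy k)) _)

open Filter in
-- Young's inequality puts a small constant on `|f|^p`; the pure energy `energy_one` handles the
-- rest. It is used for `f = ‖∇u‖` in the flux error term.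
theorem IsCutoffSeq.tendsto_lintegral_rpow_mul_gradient {Ω E K : Set (Rn n)} {v f : Rn n → ℝ}
    {η : ℕ → Rn n → ℝ} (hη : IsCutoffSeq Ω E p ϑ v η) (h : Admissible Ω p ϑ P)
    (hKΩ : K ⊆ Ω) (hf : MemLpVar K p ϑ f) :
    Tendsto (fun k => ∫⁻ x in K, ENNReal.ofReal
      (|f x| ^ (p x - 1) * ‖fderiv ℝ (η k) x‖ * ϑ x)) atTop (𝓝 0) := by
  have hK' := h.mono hKΩ
  rw [hK'.memLpVar_iff] at hf
  refine tendsto_zero_of_le_young (B := fun κ => κ ^ (1 - P))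
    (D := ∫⁻ x in K, ENNReal.ofReal (|f x| ^ p x * ϑ x))
    ((hK'.integrableOn_density_iff hf.1).1 hf.2).ne ?_
  intro κ hκ hκ1 k
  calc _ ≤ ∫⁻ x in K, (ENNReal.ofReal κ * ENNReal.ofReal (|f x| ^ p x * ϑ x) +
          ENNReal.ofReal (κ ^ (1 - P)) *
            ENNReal.ofReal (‖fderiv ℝ (η k) x‖ ^ p x * ϑ x)) := by
        refine lintegral_mono_ae ?_
        filter_upwards [hK'.exponent, hK'.weight_pos] with x hp hx
        rw [← ENNReal.ofReal_mul hκ.le, ← ENNReal.ofReal_mul (by positivity),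
          ← ENNReal.ofReal_add (by positivity) (by positivity), ← mul_assoc, ← mul_assoc,
          ← add_mul]
        exact ENNReal.ofReal_le_ofReal (mul_le_mul_of_nonneg_right
          (rpow_sub_one_mul_le_young (abs_nonneg _) (norm_nonneg _) hκ hκ1 hp.1 hp.2) hx.le)
    _ = ENNReal.ofReal κ * (∫⁻ x in K, ENNReal.ofReal (|f x| ^ p x * ϑ x)) +
        ENNReal.ofReal (κ ^ (1 - P)) *
          ∫⁻ x in K, ENNReal.ofReal (‖fderiv ℝ (η k) x‖ ^ p x * ϑ x) := by
        rw [lintegral_add_left' ((hK'.aemeasurable_density hf.1).ennreal_ofReal.const_mul _),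
          lintegral_const_mul' _ _ ENNReal.ofReal_ne_top,
          lintegral_const_mul' _ _ ENNReal.ofReal_ne_top]
    _ ≤ _ := add_le_add le_rfl
        (mul_le_mul_right ((lintegral_mono_set hKΩ).trans (hη.energy_one k)) _)

open Filter in
/-- The weak gradient off `E` is a weak gradient across `E`. -/
theorem IsCutoffSeq.hasWeakGrad {Ω E : Set (Rn n)} (hΩ : IsOpen Ω) (hE0 : volume E = 0)
    {v : Rn n → ℝ} {g : Rn n → Rn n} {η : ℕ → Rn n → ℝ} (hη : IsCutoffSeq Ω E p ϑ v η)
    (h : Admissible Ω p ϑ P) (hϑ : IsWeight Ω p ϑ) (hw : HasWeakGrad (Ω \ E) v g)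
    (hv : MemLpVarLoc Ω p ϑ v) (hg : MemLpVarLoc Ω p ϑ fun x => ‖g x‖) : HasWeakGrad Ω v g := by
  have hR := restrict_diff_of_null Ω hE0
  have hvl : LocallyIntegrableOn v Ω := hv.locallyIntegrableOn hΩ h hϑ
  have hgm : AEStronglyMeasurable g (volume.restrict Ω) := by
    rw [← hR]
    exact hw.locallyIntegrable_grad.aestronglyMeasurable
  have hgl : LocallyIntegrableOn g Ω := by
    have := hg.locallyIntegrableOn hΩ h hϑ
    rw [locallyIntegrableOn_iff hΩ.isLocallyClosed] at this ⊢
    intro K hK hKc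
    exact (integrable_norm_iff (hgm.mono_set hK)).1 (this K hK hKc)
  refine ⟨hvl, hgl, ?_⟩
  intro φ hφ hc hs i
  set e : Rn n := EuclideanSpace.single i 1
  have cφ : Continuous fun x => fderiv ℝ φ x e :=
    (hφ.continuous_fderiv (by simp)).clm_apply continuous_const
  have sφ : tsupport (fun x => fderiv ℝ φ x e) ⊆ tsupport φ := by
    refine closure_minimal ?_ (isClosed_tsupport φ)
    intro x hx
    by_contra hh
    refine hx ?_
    change fderiv ℝ φ x (EuclideanSpace.single i 1) = 0
    rw [← gradient_apply_coord, gradient_eq_zero_of_notMem_tsupport hh]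
    simp
  have I1 := integrable_mul_of_tsupport_subset hvl cφ (hc.fderiv_apply ℝ e) (sφ.trans hs)
  have I2 := integrable_mul_of_tsupport_subset (locallyIntegrableOn_coord hgl i)
    hφ.continuous hc hs
  have T1 := hη.tendsto_integral_mul hE0 I1.integrableOn
  have T2 := hη.tendsto_integral_mul hE0 I2.integrableOn
  obtain ⟨B, hB⟩ := hc.exists_bound_of_continuous hφ.continuous
  have hB0 : 0 ≤ B := (norm_nonneg _).trans (hB 0)
  have T3 : Tendsto (fun k => ∫ x in Ω, v x * (φ x * fderiv ℝ (η k) x e)) atTop (𝓝 0) := by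
    refine tendsto_integral_zero_of_le hc.measurableSet hs (C := B)
      (f := fun k x => |v x| * ‖fderiv ℝ (η k) x‖) ?_ hB0
      (hη.tendsto_lintegral_gradient h hϑ hc hs)
    intro k
    refine Eventually.of_forall fun x => ⟨fun _ => ?_, fun hx => ?_⟩
    · rw [abs_mul, abs_mul]
      have h1 : |fderiv ℝ (η k) x e| ≤ ‖fderiv ℝ (η k) x‖ := by
        have := (fderiv ℝ (η k) x).le_opNorm e
        simpa [e] using this
      have h2 : |φ x| ≤ B := hB x
      calc |v x| * (|φ x| * |fderiv ℝ (η k) x e|) ≤ |v x| * (B * ‖fderiv ℝ (η k) x‖) := by gcongr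
        _ = _ := by ring
    · rw [image_eq_zero_of_notMem_tsupport hx]
      simp
  -- The test function `η k * φ` is supported off `E`, where the gradient is known. The extra term,
  -- with the derivative on `η k`, tends to zero by `T3`.
  have key : ∀ k, (∫ x in Ω, η k x * (v x * fderiv ℝ φ x e)) +
      ∫ x in Ω, v x * (φ x * fderiv ℝ (η k) x e) = -∫ x in Ω, η k x * (g x i * φ x) := by
    intro k
    have hs1 : tsupport (fun x => η k x * φ x) ⊆ tsupport φ :=
      closure_mono fun x hx hx0 => hx (by simp only [hx0, mul_zero])
    have hs2 : tsupport (fun x => η k x * φ x) ⊆ tsupport (η k) :=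
      closure_mono fun x hx hx0 => hx (by simp only [hx0, zero_mul])
    have := hw.integral_eq (fun x => η k x * φ x) ((hη.contDiff k).mul hφ)
      (hc.of_isClosed_subset (isClosed_tsupport _) hs1)
      (fun x hx => ⟨hs (hs1 hx), fun hxE => hη.disjoint k x hxE (hs2 hx)⟩) i
    rw [hR] at this
    have i1 : IntegrableOn (fun x => η k x * (v x * fderiv ℝ φ x e)) Ω :=
      I1.integrableOn.bdd_mul (c := 1) (hη.contDiff k).continuous.aestronglyMeasurable
        (Eventually.of_forall fun x => by
          rw [Real.norm_of_nonneg (hη.mem_Icc k x).1]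
          exact (hη.mem_Icc k x).2)
    have i2 : IntegrableOn (fun x => v x * (φ x * fderiv ℝ (η k) x e)) Ω := by
      have cη : Continuous fun x => fderiv ℝ (η k) x e :=
        ((hη.contDiff k).continuous_fderiv (by simp)).clm_apply continuous_const
      have hs3 : tsupport (fun x => φ x * fderiv ℝ (η k) x e) ⊆ tsupport φ :=
        closure_mono fun x hx hx0 => hx (by simp only [hx0, zero_mul])
      exact (integrable_mul_of_tsupport_subset (φ := fun x => φ x * fderiv ℝ (η k) x e) hvl
        (hφ.continuous.mul cη) (hc.of_isClosed_subset (isClosed_tsupport _) hs3)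
        (hs3.trans hs)).integrableOn
    rw [← integral_add i1 i2]
    calc _ = ∫ x in Ω, v x * fderiv ℝ (fun x => η k x * φ x) x e := by
          refine integral_congr_ae (Eventually.of_forall fun x => ?_)
          simp only
          rw [fderiv_fun_mul ((hη.contDiff k).differentiable (by simp) x)
            (hφ.differentiable (by simp) x)]
          simp only [add_apply, smul_apply, smul_eq_mul]
          ring
      _ = _ := this
      _ = _ := by
          congr 1
          refine integral_congr_ae (Eventually.of_forall fun x => ?_)
          simp only
          ring
  have T4 := tendsto_nhds_unique ((T1.add T3).congr key) T2.neg
  simpa using T4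

/-! ### The sub-solution inequality across the singular set -/

/-- The growth condition and Young's inequality with `κ = 1` dominate the integrand by `μ⁻¹ (|g|^p +
|d|^p) ϑ` on `K`. -/
theorem Admissible.integrable_inner {Ω K : Set (Rn n)} (h : Admissible Ω p ϑ P)
    {A : Rn n → Rn n → Rn n} {μ : ℝ} (hμ : 0 < μ) (hA : StructureConditions Ω p ϑ A μ)
    (hK : MeasurableSet K) (hKΩ : K ⊆ Ω) {g d : Rn n → Rn n}
    (hgm : AEMeasurable g (volume.restrict Ω)) (hdm : AEMeasurable d (volume.restrict Ω))
    (hg : MemLpVar K p ϑ fun x => ‖g x‖) (hd : MemLpVar K p ϑ fun x => ‖d x‖)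
    (h0 : ∀ᵐ x ∂volume.restrict Ω, x ∉ K → d x = 0) :
    IntegrableOn (fun x => inner ℝ (A x (g x)) (d x)) Ω := by
  rw [(h.mono hKΩ).memLpVar_iff] at hg hd
  have hB : Integrable (K.indicator fun x => μ⁻¹ * (|‖g x‖| ^ p x * ϑ x + |‖d x‖| ^ p x * ϑ x))
      (volume.restrict Ω) := by
    rw [integrable_indicator_iff hK, IntegrableOn, Measure.restrict_restrict hK,
      inter_eq_left.2 hKΩ]
    exact (hg.2.add hd.2).const_mul _
  refine hB.mono' ((hA.aemeasurable_comp hgm).inner hdm).aestronglyMeasurable ?_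
  filter_upwards [hA.abs_inner_le, h0, h.exponent, h.weight_pos] with x hx hx0 hp hϑ
  by_cases hxK : x ∈ K
  · rw [indicator_of_mem hxK, abs_norm, abs_norm]
    refine (hx (g x) (d x)).trans ?_
    have := rpow_sub_one_mul_le_young (norm_nonneg (g x)) (norm_nonneg (d x)) one_pos le_rfl
      hp.1 hp.2
    rw [Real.one_rpow, one_mul, one_mul] at this
    rw [mul_assoc, ← add_mul]
    gcongr
  · rw [indicator_of_notMem hxK, hx0 hxK]
    simp

open Filter in
/-- The sub-solution inequality for bounded test functions. -/
theorem IsCutoffSeq.integral_inner_le_zero_of_bounded {Ω E K : Set (Rn n)} (hΩ : IsOpen Ω)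
    (hE0 : volume E = 0) {η : ℕ → Rn n → ℝ} {u : Rn n → EReal}
    (hη : IsCutoffSeq Ω E p ϑ (fun x => (u x).toReal) η) (h : Admissible Ω p ϑ P)
    {A : Rn n → Rn n → Rn n} {μ : ℝ} (hμ : 0 < μ) (hA : StructureConditions Ω p ϑ A μ)
    (hsub : SubsolutionIneq Ω (Ω \ E) p ϑ A u)
    (hgm : AEMeasurable (weakGrad (Ω \ E) fun y => (u y).toReal) (volume.restrict Ω))
    (hg : MemLpVarLoc Ω p ϑ fun x => ‖weakGrad (Ω \ E) (fun y => (u y).toReal) x‖)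
    {φ : Rn n → ℝ} (hφ : MemW1p Ω p ϑ φ) (hφ0 : ∀ᵐ x ∂volume.restrict Ω, 0 ≤ φ x)
    (hK : IsCompact K) (hKΩ : K ⊆ Ω) (h0 : ∀ᵐ x ∂volume.restrict Ω, x ∉ K → φ x = 0)
    {M : ℝ} (hM : ∀ x, |φ x| ≤ M) :
    ∫ x in Ω, inner ℝ (A x (weakGrad (Ω \ E) (fun y => (u y).toReal) x)) (weakGrad Ω φ x) ≤
      0 := by
  have hR := restrict_diff_of_null Ω hE0
  set g := weakGrad (Ω \ E) fun y => (u y).toReal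
  set d := weakGrad Ω φ
  have hd := hasWeakGrad_weakGrad hφ.2.1
  have hd0 := hd.ae_eq_zero_off hΩ hK.isClosed h0
  have hdm : AEMeasurable d (volume.restrict Ω) :=
    hd.locallyIntegrable_grad.aestronglyMeasurable.aemeasurable
  have hX := h.integrable_inner hμ hA hK.measurableSet hKΩ hgm hdm (hg K hK hKΩ)
    (hφ.2.2.mono hKΩ) hd0
  have hM0 : 0 ≤ M := (abs_nonneg _).trans (hM 0)
  have T1 := hη.tendsto_integral_mul hE0 hX
  have test : ∀ k, IntegrableOn (fun x => inner ℝ (A x (g x)) (φ x • gradient (η k) x)) Ω ∧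
      (∫ x in Ω, η k x * inner ℝ (A x (g x)) (d x)) +
        ∫ x in Ω, inner ℝ (A x (g x)) (φ x • gradient (η k) x) ≤ 0 := by
    intro k
    have h0' : ∀ᵐ x ∂volume.restrict Ω, x ∉ K → η k x * φ x = 0 := by
      filter_upwards [h0] with x hx hxK
      rw [hx hxK, mul_zero]
    obtain ⟨m1, m2⟩ := h.memW1p_smooth_mul hΩ le_rfl hd hK hKΩ (hφ.1.mono hKΩ)
      (hφ.2.2.mono hKΩ) (hη.contDiff k) inter_subset_right h0'
    obtain ⟨hI, hle⟩ := hsub _ m1 (by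
        filter_upwards [hφ0] with x hx
        exact mul_nonneg (hη.mem_Icc k x).1 hx)
      ⟨K ∩ tsupport (η k), hK.inter_right (isClosed_tsupport _),
        fun x hx => ⟨hKΩ hx.1, fun hxE => hη.disjoint k x hxE hx.2⟩, by
        filter_upwards [h0'] with x hx hxK
        by_cases hxK' : x ∈ K
        · rw [image_eq_zero_of_notMem_tsupport fun hh => hxK ⟨hxK', hh⟩, zero_mul]
        · exact hx hxK'⟩
    rw [IntegrableOn, hR] at hI
    rw [hR] at hle
    have i1 : Integrable (fun x => η k x * inner ℝ (A x (g x)) (d x)) (volume.restrict Ω) :=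
      hX.bdd_mul (c := 1) (hη.contDiff k).continuous.aestronglyMeasurable
        (Eventually.of_forall fun x => by
          rw [Real.norm_of_nonneg (hη.mem_Icc k x).1]
          exact (hη.mem_Icc k x).2)
    have e : (fun x => inner ℝ (A x (g x)) (weakGrad Ω (fun x => η k x * φ x) x))
        =ᵐ[volume.restrict Ω] fun x => η k x * inner ℝ (A x (g x)) (d x) +
          inner ℝ (A x (g x)) (φ x • gradient (η k) x) := by
      filter_upwards [m2] with x hx
      rw [hx, inner_add_right, real_inner_smul_right]
    have i2 : Integrable (fun x => inner ℝ (A x (g x)) (φ x • gradient (η k) x))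
        (volume.restrict Ω) := by
      refine ((hI.congr e).sub i1).congr (Eventually.of_forall fun x => ?_)
      simp
    refine ⟨i2, ?_⟩
    rw [← integral_add i1 i2, ← integral_congr_ae e]
    exact hle
  -- Here boundedness of `φ` enters: the factor `|φ| ≤ M` comes out, leaving an error that involves
  -- only `|g|^(p-1) |∇η_k| ϑ`.
  have T2 : Tendsto (fun k => ∫ x in Ω, inner ℝ (A x (g x)) (φ x • gradient (η k) x)) atTop
      (𝓝 0) := by
    refine tendsto_integral_zero_of_le hK.measurableSet hKΩ (C := μ⁻¹ * M)
      (f := fun k x => |‖g x‖| ^ (p x - 1) * ‖fderiv ℝ (η k) x‖ * ϑ x) ?_ (by positivity)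
      (hη.tendsto_lintegral_rpow_mul_gradient h hKΩ (hg K hK hKΩ))
    intro k
    filter_upwards [hA.abs_inner_le, h0, h.weight_pos] with x hx hx0 hϑ
    refine ⟨fun _ => (hx _ _).trans ?_, fun hxK => by rw [hx0 hxK]; simp⟩
    rw [abs_norm, norm_smul, norm_gradient_eq, Real.norm_eq_abs]
    calc μ⁻¹ * (‖g x‖ ^ (p x - 1) * (|φ x| * ‖fderiv ℝ (η k) x‖)) * ϑ x
        ≤ μ⁻¹ * (‖g x‖ ^ (p x - 1) * (M * ‖fderiv ℝ (η k) x‖)) * ϑ x := by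
          have := hM x
          gcongr
      _ = _ := by ring
  have T3 := T1.add T2
  rw [add_zero] at T3
  exact le_of_tendsto' T3 fun k => (test k).2

/-! ### From bounded to general test functions by truncation. -/

/-- A smooth truncation at height comparable to `k + 1`. -/
noncomputable def softTrunc (k : ℕ) (t : ℝ) : ℝ := (k + 1) * Real.arctan (t / (k + 1))

theorem hasDerivAt_softTrunc (k : ℕ) (t : ℝ) :
    HasDerivAt (softTrunc k) (1 / (1 + (t / (k + 1)) ^ 2)) t := by
  have hk : (0 : ℝ) < k + 1 := by positivity
  have := (((hasDerivAt_id t).div_const ((k : ℝ) + 1)).arctan).const_mul ((k : ℝ) + 1)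
  refine this.congr_deriv ?_
  simp only [id]
  field_simp

theorem deriv_softTrunc (k : ℕ) (t : ℝ) :
    deriv (softTrunc k) t = 1 / (1 + (t / (k + 1)) ^ 2) := (hasDerivAt_softTrunc k t).deriv

theorem contDiff_softTrunc (k : ℕ) : ContDiff ℝ 1 (softTrunc k) :=
  contDiff_const.mul (Real.contDiff_arctan.comp (contDiff_id.div_const _))

theorem abs_deriv_softTrunc_le (k : ℕ) (t : ℝ) : |deriv (softTrunc k) t| ≤ 1 := by
  rw [deriv_softTrunc, abs_of_nonneg (by positivity), div_le_one (by positivity)]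
  have := sq_nonneg (t / ((k : ℝ) + 1))
  linarith

theorem softTrunc_zero (k : ℕ) : softTrunc k 0 = 0 := by simp [softTrunc]

theorem softTrunc_nonneg (k : ℕ) {t : ℝ} (ht : 0 ≤ t) : 0 ≤ softTrunc k t := by
  have : 0 ≤ Real.arctan (t / (k + 1)) := Real.arctan_nonneg.2 (by positivity)
  unfold softTrunc
  positivity

theorem abs_softTrunc_le (k : ℕ) (t : ℝ) : |softTrunc k t| ≤ (k + 1) * (Real.pi / 2) := by
  unfold softTrunc
  rw [abs_mul, abs_of_pos (by positivity : (0 : ℝ) < k + 1)]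
  refine mul_le_mul_of_nonneg_left ?_ (by positivity)
  exact abs_le.2 ⟨(Real.neg_pi_div_two_lt_arctan _).le, (Real.arctan_lt_pi_div_two _).le⟩

open Filter in
theorem tendsto_deriv_softTrunc (t : ℝ) :
    Tendsto (fun k => deriv (softTrunc k) t) atTop (𝓝 1) := by
  simp_rw [deriv_softTrunc]
  have h1 : Tendsto (fun k : ℕ => t / ((k : ℝ) + 1)) atTop (𝓝 0) := by
    have := (tendsto_one_div_add_atTop_nhds_zero_nat (𝕜 := ℝ)).const_mul t
    simpa [div_eq_mul_inv] using this
  have h2 : Tendsto (fun k : ℕ => 1 / (1 + (t / ((k : ℝ) + 1)) ^ 2)) atTop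
      (𝓝 (1 / (1 + 0 ^ 2))) := by
    refine Tendsto.div tendsto_const_nhds (tendsto_const_nhds.add (h1.pow 2)) (by norm_num)
  simpa using h2

theorem Admissible.memW1p_softTrunc {Ω : Set (Rn n)} (h : Admissible Ω p ϑ P) (hΩ : IsOpen Ω)
    {φ : Rn n → ℝ} (hφ : MemW1p Ω p ϑ φ) (k : ℕ) :
    MemW1p Ω p ϑ (fun x => softTrunc k (φ x)) ∧
      weakGrad Ω (fun x => softTrunc k (φ x)) =ᵐ[volume.restrict Ω]
        fun x => deriv (softTrunc k) (φ x) • weakGrad Ω φ x := by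
  have hd := hasWeakGrad_weakGrad hφ.2.1
  have hw := hd.comp hΩ (contDiff_softTrunc k) (softTrunc_zero k) (abs_deriv_softTrunc_le k)
  have hae := hw.weakGrad_ae_eq hΩ
  refine ⟨⟨?_, ⟨_, hw⟩, ?_⟩, hae⟩
  · refine h.memLpVar_of_le (C := 1) hw.locallyIntegrable.aestronglyMeasurable.aemeasurable
      hφ.1 hφ.1 (Filter.Eventually.of_forall fun x => ?_)
    have := abs_sub_le_of_abs_deriv_le_one (contDiff_softTrunc k) (abs_deriv_softTrunc_le k)
      (φ x) 0
    rw [softTrunc_zero, sub_zero, sub_zero] at this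
    have := abs_nonneg (φ x)
    linarith
  · refine h.memLpVar_of_le (C := 1) ?_ hφ.2.2 hφ.2.2 ?_
    · exact (hasWeakGrad_weakGrad ⟨_, hw⟩).locallyIntegrable_grad.aestronglyMeasurable.aemeasurable.norm
    · filter_upwards [hae] with x hx
      rw [hx, norm_smul, abs_mul, abs_norm, abs_norm]
      have h1 : ‖deriv (softTrunc k) (φ x)‖ ≤ 1 := abs_deriv_softTrunc_le k _
      have h2 := norm_nonneg (weakGrad Ω φ x)
      nlinarith

open Filter in
/-- The sub-solution inequality extends across the singular set. -/
theorem IsCutoffSeq.subsolutionIneq {Ω E : Set (Rn n)} (hΩ : IsOpen Ω)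
    (hE0 : volume E = 0) {η : ℕ → Rn n → ℝ} {u : Rn n → EReal}
    (hη : IsCutoffSeq Ω E p ϑ (fun x => (u x).toReal) η) (h : Admissible Ω p ϑ P)
    {A : Rn n → Rn n → Rn n} {μ : ℝ} (hμ : 0 < μ) (hA : StructureConditions Ω p ϑ A μ)
    (hsub : SubsolutionIneq Ω (Ω \ E) p ϑ A u)
    (hw : HasWeakGrad Ω (fun y => (u y).toReal) (weakGrad (Ω \ E) fun y => (u y).toReal))
    (hg : MemLpVarLoc Ω p ϑ fun x => ‖weakGrad (Ω \ E) (fun y => (u y).toReal) x‖) :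
    SubsolutionIneq Ω Ω p ϑ A u := by
  rintro φ hφ hφ0 ⟨K, hK, hKΩ, h0⟩
  have hgm := hw.locallyIntegrable_grad.aestronglyMeasurable.aemeasurable
  set g := weakGrad (Ω \ E) fun y => (u y).toReal with hgdef
  have hgg : weakGrad Ω (fun y => (u y).toReal) =ᵐ[volume.restrict Ω] g := hw.weakGrad_ae_eq hΩ
  set d := weakGrad Ω φ
  have hd := hasWeakGrad_weakGrad hφ.2.1
  have hd0 := hd.ae_eq_zero_off hΩ hK.isClosed h0
  have hdm : AEMeasurable d (volume.restrict Ω) :=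
    hd.locallyIntegrable_grad.aestronglyMeasurable.aemeasurable
  have hφm : AEStronglyMeasurable φ (volume.restrict Ω) :=
    hd.locallyIntegrable.aestronglyMeasurable
  have hX := h.integrable_inner hμ hA hK.measurableSet hKΩ hgm hdm (hg K hK hKΩ)
    (hφ.2.2.mono hKΩ) hd0
  have e : (fun x => inner ℝ (A x (weakGrad Ω (fun y => (u y).toReal) x)) (d x))
      =ᵐ[volume.restrict Ω] fun x => inner ℝ (A x (g x)) (d x) := by
    filter_upwards [hgg] with x hx
    rw [hx]
  refine ⟨hX.congr e.symm, ?_⟩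
  rw [integral_congr_ae e]
  have le : ∀ k, ∫ x in Ω, deriv (softTrunc k) (φ x) * inner ℝ (A x (g x)) (d x) ≤ 0 := by
    intro k
    obtain ⟨m1, m2⟩ := h.memW1p_softTrunc hΩ hφ k
    have := hη.integral_inner_le_zero_of_bounded hΩ hE0 h hμ hA hsub hgm hg m1
      (by filter_upwards [hφ0] with x hx using softTrunc_nonneg k hx) hK hKΩ
      (by
        filter_upwards [h0] with x hx hxK
        rw [hx hxK, softTrunc_zero])
      (fun x => abs_softTrunc_le k (φ x))
    refine le_trans (le_of_eq (integral_congr_ae ?_)) this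
    filter_upwards [m2] with x hx
    rw [hx, real_inner_smul_right]
  -- The derivatives of the truncations are bounded by `1` and tend to `1` pointwise, so dominated
  -- convergence recovers the integral for `φ`.
  refine le_of_tendsto' (f := fun k =>
    ∫ x in Ω, deriv (softTrunc k) (φ x) * inner ℝ (A x (g x)) (d x)) (x := atTop) ?_ le
  refine tendsto_integral_of_dominated_convergence (fun x => ‖inner ℝ (A x (g x)) (d x)‖) ?_
    hX.norm ?_ ?_
  · intro k
    exact (((contDiff_softTrunc k).continuous_deriv (by simp)).comp_aestronglyMeasurable hφm).mul
      hX.aestronglyMeasurable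
  · intro k
    refine Eventually.of_forall fun x => ?_
    rw [norm_mul]
    exact mul_le_of_le_one_left (norm_nonneg _) (abs_deriv_softTrunc_le k _)
  · refine Eventually.of_forall fun x => ?_
    simpa using (tendsto_deriv_softTrunc (φ x)).mul_const (inner ℝ (A x (g x)) (d x))

end RemovableSing

namespace RemovableSing

variable {n : ℕ} {p ϑ : Rn n → ℝ}

/-! ### Consequences of the hypotheses on exponents and weights -/

theorem IsExponent.exists_ae_abs_le {Ω : Set (Rn n)} (hp : IsExponent Ω p) :
    ∃ M : ℝ, ∀ᵐ x ∂volume.restrict Ω, |p x| ≤ M := by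
  have h1 := hp.1.2
  rw [eLpNorm_exponent_top] at h1
  refine ⟨(eLpNormEssSup p (volume.restrict Ω)).toReal, ?_⟩
  filter_upwards [enorm_ae_le_eLpNormEssSup p (volume.restrict Ω)] with x hx
  have := ENNReal.toReal_mono h1.ne hx
  simpa using this

theorem IsExponent.ae_bounds {Ω : Set (Rn n)} (hp : IsExponent Ω p) :
    ∀ᵐ x ∂volume.restrict Ω, 1 < p x ∧ p x ≤ pPlus Ω p := by
  obtain ⟨M, hM⟩ := hp.exists_ae_abs_le
  have b1 : Filter.IsBoundedUnder (· ≤ ·) (ae (volume.restrict Ω)) p :=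
    ⟨M, Filter.eventually_map.2 (hM.mono fun x hx => (abs_le.1 hx).2)⟩
  have b2 : Filter.IsBoundedUnder (· ≥ ·) (ae (volume.restrict Ω)) p :=
    ⟨-M, Filter.eventually_map.2 (hM.mono fun x hx => (abs_le.1 hx).1)⟩
  filter_upwards [ae_le_essSup b1, ae_essInf_le b2] with x h1 h2
  exact ⟨hp.2.trans_le h2, h1⟩

theorem IsExponent.restrict_ne_zero {Ω : Set (Rn n)} (hp : IsExponent Ω p) :
    (volume.restrict Ω : Measure (Rn n)) ≠ 0 := by
  intro h
  have := hp.2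
  -- For the zero measure the essential infimum is the supremum of all reals, which takes the
  -- default value `0` and contradicts `1 < essInf`.
  rw [h, essInf, ae_zero, Filter.liminf_eq] at this
  simp only [Filter.eventually_bot, ofPred_true, Real.sSup_univ] at this
  linarith

theorem IsExponent.one_lt_pPlus {Ω : Set (Rn n)} (hp : IsExponent Ω p) : 1 < pPlus Ω p := by
  have : (ae (volume.restrict Ω)).NeBot := ae_neBot.2 hp.restrict_ne_zero
  obtain ⟨x, hx⟩ := hp.ae_bounds.exists
  exact hx.1.trans_le hx.2

theorem IsExponent.admissible {Ω : Set (Rn n)} (hp : IsExponent Ω p)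
    (hϑ : IsWeight Ω p ϑ) : Admissible Ω p ϑ (pPlus Ω p) where
  aemeasurable_exponent := hp.1.1.aemeasurable
  aemeasurable_weight := hϑ.locallyIntegrable.aestronglyMeasurable.aemeasurable
  exponent := hp.ae_bounds
  weight_pos := hϑ.pos

/-- Since `0 ≤ τ ≤ n`, the factor `r^(-τ)` is at most `1` for `r ≥ 1` and at most `r^(-n)` for `r ≤
1`, while `ϑ` is integrable on `K`. -/
theorem powIntegral_lt_top {Ω S K : Set (Rn n)} {τ : Rn n → ℝ} {r : ℝ} (hr : 0 < r)
    (hϑ : IsWeight Ω p ϑ) (hτ : ∀ x ∈ Ω, τ x ∈ Icc (0 : ℝ) n) (hΩ : IsOpen Ω)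
    (hK : IsCompact K) (hKΩ : K ⊆ Ω) (hSK : S ⊆ K) :
    powIntegral Ω S ϑ (fun x => -τ x) r < ⊤ := by
  have hi := (hϑ.locallyIntegrable.integrableOn_compact_subset hKΩ hK).mono_set hSK
  have hSΩ : S ∩ Ω = S := inter_eq_left.2 (hSK.trans hKΩ)
  unfold powIntegral
  rw [hSΩ]
  have hpos := ae_restrict_of_ae_restrict_of_subset (hSK.trans hKΩ) hϑ.pos
  calc _ ≤ ∫⁻ x in S, ENNReal.ofReal (1 + r ^ (-(n : ℝ))) * ENNReal.ofReal (ϑ x) := by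
        refine lintegral_mono_ae ?_
        have hmem : ∀ᵐ x ∂volume.restrict S, x ∈ Ω :=
          ae_restrict_of_ae_restrict_of_subset (hSK.trans hKΩ) (ae_restrict_mem hΩ.measurableSet)
        filter_upwards [hpos, hmem] with x hx hxΩ
        rw [← ENNReal.ofReal_mul (by positivity)]
        refine ENNReal.ofReal_le_ofReal (mul_le_mul_of_nonneg_right ?_ hx.le)
        have hrn : 0 ≤ r ^ (-(n : ℝ)) := Real.rpow_nonneg hr.le _
        rcases le_total 1 r with h | h
        · have := Real.rpow_le_one_of_one_le_of_nonpos h (neg_nonpos.2 (hτ x hxΩ).1)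
          linarith
        · have := Real.rpow_le_rpow_of_exponent_ge hr h (neg_le_neg (hτ x hxΩ).2)
          linarith
    _ = ENNReal.ofReal (1 + r ^ (-(n : ℝ))) * ∫⁻ x in S, ENNReal.ofReal (ϑ x) :=
        lintegral_const_mul' _ _ ENNReal.ofReal_ne_top
    _ < ⊤ := by
        refine ENNReal.mul_lt_top ENNReal.ofReal_lt_top ?_
        refine (hasFiniteIntegral_iff_ofReal ?_).1 hi.2
        filter_upwards [hpos] with x hx using hx.le

/-- The growth condition for the real-valued representative. -/
theorem GrowthBound.exists_toReal {Ω : Set (Rn n)} {τ : Rn n → ℝ} {u : Rn n → EReal}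
    (h : GrowthBound Ω p ϑ τ u) {P : ℝ} (hp : Admissible Ω p ϑ P)
    (hu0 : ∀ᵐ x ∂volume.restrict Ω, 0 ≤ u x) (hut : ∀ᵐ x ∂volume.restrict Ω, u x ≠ ⊤) :
    ∃ C : ℝ, ∀ (y : Rn n) (r : ℝ), 0 < r → Metric.closedBall y r ⊆ Ω →
      ∫⁻ x in Metric.ball y r, ENNReal.ofReal (|(u x).toReal| ^ p x * ϑ x) ≤
        ENNReal.ofReal C *
          powIntegral Ω (Metric.ball y (r / Real.sqrt n)) ϑ (fun x => -τ x) r := by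
  obtain ⟨C, -, hC⟩ := h
  refine ⟨C, fun y r hr hy => (le_of_eq ?_).trans (hC y r hr hy)⟩
  have hsub : Metric.ball y r ⊆ Ω := Metric.ball_subset_closedBall.trans hy
  refine lintegral_congr_ae ?_
  filter_upwards [ae_restrict_of_ae_restrict_of_subset hsub hu0,
    ae_restrict_of_ae_restrict_of_subset hsub hut,
    (hp.mono hsub).exponent] with x h0 ht hpx
  have hv : 0 ≤ (u x).toReal := EReal.toReal_nonneg h0
  rw [EReal.toENNReal_of_ne_top ht, abs_of_nonneg hv,
    ENNReal.ofReal_rpow_of_nonneg hv (by linarith),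
    ENNReal.ofReal_mul (Real.rpow_nonneg hv _)]

/-- Compactness reduces to small balls, where the right side of the growth bound is finite. The
balls may meet `E`, so this already gives integrability of `v` across the singular set. -/
theorem memLpVarLoc_of_growth (hn : 0 < n) {Ω : Set (Rn n)} (hΩ : IsOpen Ω)
    (hϑ : IsWeight Ω p ϑ) {P : ℝ} (hp : Admissible Ω p ϑ P) {τ v : Rn n → ℝ}
    (hτ : ∀ x ∈ Ω, τ x ∈ Icc (0 : ℝ) n) (hv : AEMeasurable v (volume.restrict Ω)) {C : ℝ}
    (hgrow : ∀ (y : Rn n) (r : ℝ), 0 < r → Metric.closedBall y r ⊆ Ω →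
      ∫⁻ x in Metric.ball y r, ENNReal.ofReal (|v x| ^ p x * ϑ x) ≤
        ENNReal.ofReal C *
          powIntegral Ω (Metric.ball y (r / Real.sqrt n)) ϑ (fun x => -τ x) r) :
    MemLpVarLoc Ω p ϑ v := by
  intro K hK hKΩ
  rw [(hp.mono hKΩ).memLpVar_iff]
  refine ⟨hv.mono_set hKΩ, ((hp.mono hKΩ).integrableOn_density_iff (hv.mono_set hKΩ)).2 ?_⟩
  refine hK.induction_on (p := fun s => ∫⁻ x in s, ENNReal.ofReal (|v x| ^ p x * ϑ x) < ⊤)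
    (by simp) (fun s t hst ht => (lintegral_mono_set hst).trans_lt ht)
    (fun s t hs ht => (lintegral_union_le _ s t).trans_lt (ENNReal.add_lt_top.2 ⟨hs, ht⟩)) ?_
  intro y hy
  obtain ⟨r, hr, hball⟩ := Metric.nhds_basis_closedBall.mem_iff.1 (hΩ.mem_nhds (hKΩ hy))
  refine ⟨Metric.ball y r, mem_nhdsWithin_of_mem_nhds (Metric.ball_mem_nhds y hr),
    (hgrow y r hr hball).trans_lt (ENNReal.mul_lt_top ENNReal.ofReal_lt_top ?_)⟩
  refine powIntegral_lt_top hr hϑ hτ hΩ (isCompact_closedBall y r) hball ?_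
  refine (Metric.ball_subset_ball ?_).trans Metric.ball_subset_closedBall
  refine div_le_self hr.le ?_
  rw [Real.one_le_sqrt]
  exact_mod_cast hn

end RemovableSing

/-! ### Assembling the theorem. -/

open RemovableSing
theorem theorem3p2 (n : ℕ) (hn : 3 ≤ n)
    (Ω : Set (Rn n)) (hΩ : IsOpen Ω) (hΩb : Bornology.IsBounded Ω)
    (E : Set (Rn n)) (hE : IsCompact E) (hEΩ : E ⊆ Ω)
    (p : Rn n → ℝ) (hp : IsExponent Ω p)
    (ϑ : Rn n → ℝ) (hϑ : IsWeight Ω p ϑ)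
    (α τ : Rn n → ℝ)
    (hα : AEMeasurable α (volume.restrict Ω)) (hα' : ∀ x ∈ Ω, α x ∈ Icc (0 : ℝ) n)
    (hτ : AEMeasurable τ (volume.restrict Ω)) (hτ' : ∀ x ∈ Ω, τ x ∈ Icc (0 : ℝ) n)
    (A : Rn n → Rn n → Rn n) (μ : ℝ) (hμ : 0 < μ)
    (hA : StructureConditions Ω p ϑ A μ)
    (hτα : ∀ᵐ x ∂volume.restrict Ω,
      τ x ≤ n - α x - pPlus Ω p - pPlus Ω p / pMinus Ω p)
    (hadj : AdjacentComparable Ω ϑ τ)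
    (γ : ℝ) (hγ : 0 < γ) (hγp : γ ≤ 1 / pPlus Ω p)
    (hnet : netMeasure Ω α γ ϑ E = 0)
    (u : Rn n → EReal) (hu : IsSubsolution Ω E p ϑ A u)
    (hu0 : ∀ᵐ x ∂volume.restrict Ω, 0 ≤ u x)
    (hgrowth : GrowthBound Ω p ϑ τ u) :
    HasRemovableSingularity Ω p ϑ A u := by
  have hn0 : 0 < n := by omega
  have hP := hp.one_lt_pPlus
  have hadm := hp.admissible hϑ
  have hγ1 : γ ≤ 1 := hγp.trans ((div_le_one (by linarith)).2 hP.le)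
  have hmem := ae_restrict_mem (μ := (volume : Measure (Rn n))) hΩ.measurableSet
  -- Once `E` is null, the restrictions of Lebesgue measure to `Ω \ E` and `Ω` coincide, so
  -- measurability and a.e. finiteness of `u` transfer to `Ω`.
  have hE0 : volume E = 0 := volume_eq_zero_of_netMeasure_eq_zero hEΩ hγ hγ1
    (hmem.mono fun x hx => (hα' x hx).2) hadm.aemeasurable_weight hadm.weight_pos hnet
  have hR := restrict_diff_of_null Ω hE0
  obtain ⟨⟨-, hloc, -⟩, hsub⟩ := hu
  have hfin : ∀ᵐ x ∂volume.restrict Ω, u x ≠ ⊤ ∧ u x ≠ ⊥ := by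
    rw [← hR]
    exact hloc.1
  have hw0 := hasWeakGrad_weakGrad hloc.2.2.1
  have hvm : AEMeasurable (fun x => (u x).toReal) (volume.restrict Ω) := by
    rw [← hR]
    exact hw0.locallyIntegrable.aestronglyMeasurable.aemeasurable
  obtain ⟨C, hC⟩ := hgrowth.exists_toReal hadm hu0 (hfin.mono fun x hx => hx.1)
  have hv := memLpVarLoc_of_growth hn0 hΩ hϑ hadm hτ' hvm hC
  have hτα' : ∀ᵐ x ∂volume.restrict Ω, τ x ≤ n - α x - pPlus Ω p := by
    filter_upwards [hτα] with x hx
    have : 0 ≤ pPlus Ω p / pMinus Ω p :=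
      div_nonneg (by linarith) (zero_le_one.trans hp.2.le)
    linarith
  obtain ⟨η, hη⟩ := exists_isCutoffSeq hE.isClosed fun δ hδ =>
    exists_small_cutoff hn0 hΩ hE hEΩ hadm.aemeasurable_exponent hadm.aemeasurable_weight hvm
      hadm.exponent hadm.weight_pos (hmem.mono fun x hx => (hτ' x hx).1) hτα' hadj hγ hγ1 hnet
      hC hδ
  have hg := memLpVarLoc_norm_weakGrad hΩ hE0 hadm hμ hA hloc hu0 hsub hv hη
  have hw := hη.hasWeakGrad hΩ hE0 hadm hϑ hw0 hv hg
  refine ⟨⟨hfin, hv, ⟨_, hw⟩, ?_⟩, hη.subsolutionIneq hΩ hE0 hadm hμ hA hsub hw hg⟩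
  intro K hK hKΩ
  have hm := (hasWeakGrad_weakGrad ⟨_, hw⟩).locallyIntegrable_grad.aestronglyMeasurable
  -- The gradient chosen on `Ω` agrees a.e. with the one chosen on `Ω \ E`, whose integrability is
  -- `hg`.
  refine (hadm.mono hKΩ).memLpVar_of_le (C := 1) (hm.norm.aemeasurable.mono_set hKΩ)
    (hg K hK hKΩ) (hg K hK hKΩ) ?_
  filter_upwards [ae_restrict_of_ae_restrict_of_subset hKΩ (hw.weakGrad_ae_eq hΩ)] with x hx
  rw [hx, one_mul]
  exact le_add_of_nonneg_right (abs_nonneg _)
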